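/- **Setting.** Let $1\le d\le 3$, $m=d+2$, and let $\Omega\subset\mathbb R^d$ be a bounded open set with $\Omega=\operatorname{int}\overline\Omega$ (for instance a bounded Lipschitz domain). For a calorically perfect gas ($\gamma>1$, $c_v>0$, $Pr>0$, $s_0\in\mathbb R$) let $u=(\rho,\rho V,\rho E)\in\mathbb R^m$ be the conservation variables, $p=(\gamma-1)(\rho E-\rho|V|^2/2)$, $T=p/((\gamma-1)c_v\rho)$, $X_u=\{\rho>0,\ p>0\}$, $F(u)$ the inviscid fluxes (columns $(\rho V_j,\ \rho V_iV_j+\delta_{ij}p,\ V_j(\rho E+p))$), $s=\log(p/\rho^\gamma)-s_0$, $H=-\rho s$, $\mathcal F=HV$, $v(u)=\partial H/\partial u$ the entropy variables, $X_v=v(X_u)$ (a convex set), $u(v)$ the inverse map, and $\tilde A_0=\partial u/\partial v$. Functions of $u$ are evaluated at $u(v)$ when written as functions of $v$. Let $$G(u,\nabla u)=-\big(0,\ \tau_{ij},\ V_i\tau_{ij}-f_j\big),\quad \tau_{ij}=\mu\big(\partial_jV_i+\partial_iV_j-\tfrac23\delta_{ij}\nabla\!\cdot\! V\big)+\beta\,\delta_{ij}\nabla\!\cdot\!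 V,\quad f_j=-\kappa\,\partial_jT,\quad \kappa=\gamma c_v\mu/Pr,$$ with viscosities $\mu,\beta$ that are constant or depend continuously on $u\in X_u$. Write $G_{ij}=-[\mathcal K_{jk}(u)]_{is}\,\partial_k u_s$, $\widetilde{\mathcal K}_{jk}(v)=\mathcal K_{jk}(u(v))\tilde A_0(v)$, $G_{ij}(v,q)=-[\widetilde{\mathcal K}_{jk}(v)]_{is}q_{sk}$ and $q^t\widetilde{\mathcal K}q=q_{ij}[\widetilde{\mathcal K}_{jk}]_{is}q_{sk}$. For a vector $n$ let $F_n=F\cdot n$, $\mathcal F_n=\mathcal F\cdot n$, $A_n=(\partial F/\partial u)\cdot n$, $\tilde A_n=A_n\tilde A_0$, $|\tilde A_n|_{\tilde A_0}=\tilde A_0|\tilde A_0^{-1}\tilde A_n|=|A_n|\tilde A_0$ and $A^{\pm}_{n,\tilde A_0}=\tfrac12(A_n\pm|A_n|)\tilde A_0$, where $|A|=P|D|P^{-1}$ if $A=PDP^{-1}$ with $D$ diagonal. Let $\tilde v(\theta;v_1,v_2)=v_1+\theta(v_2-v_1)$ and $$\sigma_{MV}(v_1,v_2;n)=\int_0^1(1-\theta)\Big(|\tilde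 A_n(\tilde v(\theta;v_1,v_2);n)|_{\tilde A_0}+|\tilde A_n(\tilde v(\theta;v_2,v_1);n)|_{\tilde A_0}\Big)d\theta .$$ **Scheme.** Let $\mathcal T_h$ be a finite non-curved mesh: non-degenerate closed simplices with disjoint interiors and union $\overline\Omega$. The interior faces are the sets $\partial K\cap\partial L$ ($K\neq L$), the boundary faces the sets $f\cap\partial\Omega$ ($f$ a facet of an element), in both cases only those of nonzero $(d-1)$-dimensional measure. Integrals over $\mathcal T_h$ and $\partial\mathcal T_h$ are sums over elements, respectively over pairs of an element and a face on its boundary (interior faces count twice); $n$ is the outward unit normal. Let $\mathcal V_h^k$, $\mathcal Q_h^k$ be the functions with values in $\mathbb R^m$, $\mathbb R^{m\times d}$ that are polynomials of degree $\le k$ on each element, and $\mathcal M_h^k$ a linear space with $\widetilde{\mathcal M}{}_h^k\subseteq\mathcal M_h^k\subseteq\widehat{\mathcal M}{}_h^k$, where $\widehat{\mathcal M}{}_h^k$ consists of the $\mathbb R^m$-valued functions that are polynomials of degree $\le k$ on each face and $\widetilde{\mathcal M}{}_h^k$ of those that are also continuous on the union of all faces. Let $$\hat f_h=\tfrac12\big(F(\hat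 v_h)+F(v_h)\big)\cdot n+\tfrac12\,\sigma_{MV}(\hat v_h,v_h;n)(v_h-\hat v_h),\qquad \hat g_h=\Pi_{\mathcal Q_h^k}[G(v_h,q_h)]\cdot n,$$ with $\Pi_{\mathcal Q_h^k}$ the $L^2$ projection, and let $\hat b_h=\hat b_h(\hat v_h,v_h,q_h;v^{\partial\Omega})$ be an arbitrary boundary condition term. Let $(q_h(t),v_h(t),\hat v_h(t))\in\mathcal Q_h^k\times\mathcal V_h^k\times\mathcal M_h^k$, with $v_h$ differentiable in time, satisfy for all $t\in(0,t_f)$ and all $(r,w,\mu)\in\mathcal Q_h^k\times\mathcal V_h^k\times\mathcal M_h^k$ $$(q_h,r)_{\mathcal T_h}+(v_h,\nabla\!\cdot r)_{\mathcal T_h}-\langle\hat v_h,r\cdot n\rangle_{\partial\mathcal T_h}=0,$$ $$(\partial_tu(v_h),w)_{\mathcal T_h}-(F(v_h)+G(v_h,q_h),\nabla w)_{\mathcal T_h}+\langle\hat f_h+\hat g_h,w\rangle_{\partial\mathcal T_h}=0,$$ $$\langle\hat f_h+\hat g_h,\mu\rangle_{\partial\mathcal T_h\setminus\partial\Omega}+\langle\hat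 b_h,\mu\rangle_{\partial\Omega}=0,$$ and $(v_h|_{t=0}-v(u_0),w)_{\mathcal T_h}=0$ for all $w\in\mathcal V_h^k$, where $v_h|_{t=0}\in\mathcal V_h^k$. **Claim.** Let $t\in(0,t_f)$ be such that the solution at time $t$ is physical ($v_h\in X_v$ on all closed elements, $\hat v_h\in X_v$ on all faces) and $\hat b_h$ at time $t$ is integrable on every boundary face. Then $\int_{\mathcal T_h}H(u(v_h))$ is differentiable in time at $t$, and at time $t$ $$\frac{d}{dt}\int_{\mathcal T_h}H(u(v_h))+\int_{\mathcal T_h}q_h^t\,\widetilde{\mathcal K}(v_h)\,q_h+\int_{\partial\mathcal T_h}\int_0^1(1-\theta)(v_h-\hat v_h)^t\Big(A^+_{n,\tilde A_0}(\tilde v(\theta;v_h,\hat v_h);n)-A^-_{n,\tilde A_0}(\tilde v(\theta;\hat v_h,v_h);n)\Big)(v_h-\hat v_h)\,d\theta+\mathcal B_{\partial\Omega}=0,$$ $$\mathcal B_{\partial\Omega}=\int_{\partial\Omega}\mathcal F_n(\hat v_h)-\int_{\partial\Omega}\hat v_h^t\,F_n(\hat v_h)+\int_{\partial\Omega}\hat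 v_h^t\,(\hat f_h+\hat g_h-\hat b_h).$$ -/

import Mathlib

open MeasureTheory

noncomputable section

namespace HDG

/-! ### States, fluxes and entropy variables -/

/-- Physical space `ℝᵈ` with the Euclidean norm. -/
abbrev Space (d : ℕ) := EuclideanSpace ℝ (Fin d)

/-- Vectors of `m = d + 2` state variables: mass, `d` momenta, energy. -/
abbrev State (d : ℕ) := Fin (d + 2) → ℝ

/-- Square matrices acting on states. -/
abbrev StateMat (d : ℕ) := Matrix (Fin (d + 2)) (Fin (d + 2)) ℝ

/-- `m × d` matrices: gradients of states, and fluxes. -/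
abbrev Grad (d : ℕ) := Matrix (Fin (d + 2)) (Fin d) ℝ

/-- The state `(a, w₁, …, w_d, b)`. -/
def mkState {d : ℕ} (a : ℝ) (w : Fin d → ℝ) (b : ℝ) : State d :=
  Fin.cons a (Fin.snoc (α := fun _ => ℝ) w b : Fin (d + 1) → ℝ)

/-- First entry (the density `ρ`, for conservation variables). -/
def fstVar {d : ℕ} (u : State d) : ℝ := u 0

/-- Middle entries (the momentum `ρ V`, for conservation variables). -/
def midVar {d : ℕ} (u : State d) (j : Fin d) : ℝ := u j.castSucc.succ

/-- Last entry (the total energy `ρ E`, for conservation variables). -/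
def lastVar {d : ℕ} (u : State d) : ℝ := u (Fin.last (d + 1))

/-- A calorically perfect gas: the ratio of specific heats `γ = c_p / c_v`, the specific heat `c_v`,
the Prandtl number and the baseline entropy level. -/
structure PerfectGas where
  γ : ℝ
  cv : ℝ
  Pr : ℝ
  s₀ : ℝ
  one_lt_γ : 1 < γ
  cv_pos : 0 < cv
  Pr_pos : 0 < Pr

variable {d : ℕ}

/-- Velocity `V = (ρ V) / ρ`. -/
def velocity (u : State d) : Fin d → ℝ := fun j => midVar u j / fstVar u

/-- Pressure `p = (γ - 1) (ρ E - ρ |V|² / 2)`. -/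
def pressure (g : PerfectGas) (u : State d) : ℝ :=
  (g.γ - 1) * (lastVar u - fstVar u * (∑ j, velocity u j ^ 2) / 2)

/-- Temperature, from the ideal gas law `p = ρ R T` with `R = c_p - c_v = (γ - 1) c_v`. -/
def temperature (g : PerfectGas) (u : State d) : ℝ :=
  pressure g u / ((g.γ - 1) * g.cv * fstVar u)

/-- The set `X_u` of physical states: positive density and pressure. -/
def physU (g : PerfectGas) : Set (State d) := {u | 0 < fstVar u ∧ 0 < pressure g u}

/-- Inviscid fluxes `F(u)`. -/
def inviscidFlux (g : PerfectGas) (u : State d) : Grad d := Matrix.of fun i j =>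
  mkState (fstVar u * velocity u j)
    (fun l => fstVar u * velocity u l * velocity u j + if l = j then pressure g u else 0)
    (velocity u j * (lastVar u + pressure g u)) i

/-- Thermodynamic entropy `s = log (p / ρ ^ γ) - s₀`. -/
def thermoEntropy (g : PerfectGas) (u : State d) : ℝ :=
  Real.log (pressure g u / fstVar u ^ g.γ) - g.s₀

/-- Generalized entropy `H = - ρ s`. -/
def genEntropy (g : PerfectGas) (u : State d) : ℝ := -(fstVar u * thermoEntropy g u)

/-- Entropy flux `𝓕 = - ρ s V`. -/
def entropyFlux (g : PerfectGas) (u : State d) : Fin d → ℝ :=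
  fun j => genEntropy g u * velocity u j

/-- Entropy variables `v(u) = ∂H/∂u`. -/
def entropyVars (g : PerfectGas) (u : State d) : State d :=
  (g.γ - 1) • mkState
    (-thermoEntropy g u / (g.γ - 1) + (g.γ + 1) / (g.γ - 1) - lastVar u / pressure g u)
    (fun j => fstVar u * velocity u j / pressure g u)
    (-fstVar u / pressure g u)

/-- The set `X_v = v(X_u)` of physical states in entropy variables. -/
def physV (g : PerfectGas) : Set (State d) := entropyVars g '' physU g

/-- Conservation variables `u(v)`: the inverse of `entropyVars` on physical states
(see `consVars_entropyVars`). With `v_m` the last entry of `v`, `ρ / p = -v_m / (γ - 1)`,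
`V_j = -v_j / v_m`, and `s = γ - v_1 + |(v_2, …, v_{m-1})|² / (2 v_m)` determine the state. -/
def consVars (g : PerfectGas) (v : State d) : State d :=
  let b := -lastVar v / (g.γ - 1)
  let V : Fin d → ℝ := fun j => -midVar v j / lastVar v
  let s := g.γ - fstVar v + (∑ j, midVar v j ^ 2) / (2 * lastVar v)
  let ρ := Real.exp (-(s + g.s₀ + Real.log b) / (g.γ - 1))
  mkState ρ (fun j => ρ * V j) (ρ / b / (g.γ - 1) + ρ * (∑ j, V j ^ 2) / 2)

@[simp] lemma fstVar_mkState (a : ℝ) (w : Fin d → ℝ) (b : ℝ) : fstVar (mkState a w b) = a := rfl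

@[simp] lemma midVar_mkState (a : ℝ) (w : Fin d → ℝ) (b : ℝ) (j : Fin d) :
    midVar (mkState a w b) j = w j := by
  simp [midVar, mkState]

@[simp] lemma lastVar_mkState (a : ℝ) (w : Fin d → ℝ) (b : ℝ) :
    lastVar (mkState a w b) = b := by
  simp only [lastVar, mkState]
  rw [← Fin.succ_last, Fin.cons_succ, Fin.snoc_last]

lemma mkState_vars (u : State d) : mkState (fstVar u) (midVar u) (lastVar u) = u := by
  funext i
  refine Fin.cases rfl (fun i => ?_) i
  refine Fin.lastCases ?_ (fun i => ?_) i
  · simp [mkState, lastVar]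
  · simp [mkState, midVar]

@[simp] lemma fstVar_smul (c : ℝ) (u : State d) : fstVar (c • u) = c * fstVar u := rfl

@[simp] lemma midVar_smul (c : ℝ) (u : State d) (j : Fin d) :
    midVar (c • u) j = c * midVar u j := rfl

@[simp] lemma lastVar_smul (c : ℝ) (u : State d) : lastVar (c • u) = c * lastVar u := rfl

/-- `u(v(u)) = u` for physical states. -/
lemma consVars_entropyVars (g : PerfectGas) {u : State d} (hu : u ∈ physU g) :
    consVars g (entropyVars g u) = u := by
  obtain ⟨hρ, hp⟩ := hu
  have hγ : 0 < g.γ - 1 := by linarith [g.one_lt_γ]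
  have hs : thermoEntropy g u
      = Real.log (pressure g u) - g.γ * Real.log (fstVar u) - g.s₀ := by
    rw [thermoEntropy, Real.log_div hp.ne' (Real.rpow_pos_of_pos hρ _).ne', Real.log_rpow hρ]
  have hE : lastVar u = pressure g u / (g.γ - 1)
      + fstVar u * (∑ j, velocity u j ^ 2) / 2 := by
    rw [pressure]; field_simp; ring
  have hb : -lastVar (entropyVars g u) / (g.γ - 1) = fstVar u / pressure g u := by
    simp only [entropyVars, lastVar_smul, lastVar_mkState]; field_simp
  have hV : (fun j => -midVar (entropyVars g u) j / lastVar (entropyVars g u))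
      = velocity u := by
    funext j
    simp only [entropyVars, lastVar_smul, lastVar_mkState, midVar_smul, midVar_mkState]
    field_simp
  have hsum : (∑ j, midVar (entropyVars g u) j ^ 2)
      = ((g.γ - 1) * fstVar u / pressure g u) ^ 2 * ∑ j, velocity u j ^ 2 := by
    rw [Finset.mul_sum]
    refine Finset.sum_congr rfl fun j _ => ?_
    simp only [entropyVars, midVar_smul, midVar_mkState]
    ring
  have hS : g.γ - fstVar (entropyVars g u)
      + (∑ j, midVar (entropyVars g u) j ^ 2) / (2 * lastVar (entropyVars g u))
      = thermoEntropy g u := by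
    rw [hsum]
    simp only [entropyVars, lastVar_smul, lastVar_mkState, fstVar_smul, fstVar_mkState]
    rw [hE]
    field_simp
    ring
  have hR : Real.exp (-(thermoEntropy g u + g.s₀ + Real.log (fstVar u / pressure g u))
      / (g.γ - 1)) = fstVar u := by
    rw [hs, Real.log_div hρ.ne' hp.ne']
    have : -(Real.log (pressure g u) - g.γ * Real.log (fstVar u) - g.s₀ + g.s₀
        + (Real.log (fstVar u) - Real.log (pressure g u))) / (g.γ - 1)
        = Real.log (fstVar u) := by field_simp; ring
    rw [this, Real.exp_log hρ]
  have key : consVars g (entropyVars g u) = mkState (fstVar u)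
      (fun j => fstVar u * velocity u j)
      (fstVar u / (fstVar u / pressure g u) / (g.γ - 1)
        + fstVar u * (∑ j, velocity u j ^ 2) / 2) := by
    simp only [consVars]
    rw [hS, hb, hR]
    have hV' : ∀ j, -midVar (entropyVars g u) j / lastVar (entropyVars g u) = velocity u j :=
      fun j => congrFun hV j
    simp only [hV']
  rw [key]
  conv_rhs => rw [← mkState_vars u]
  congr 1
  · funext j; simp only [velocity]; field_simp
  · rw [hE]; field_simp

/-! ### Viscous flux -/

/-- Viscosity laws: the dynamic viscosity `μ` and the bulk viscosity `β`, which may depend on the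
state (constants included), continuously on the physical states. -/
structure Viscosity (g : PerfectGas) (d : ℕ) where
  μ : State d → ℝ
  β : State d → ℝ
  μ_cont : ContinuousOn μ (physU g)
  β_cont : ContinuousOn β (physU g)

/-- Thermal conductivity `κ = c_p μ / Pr`, with `c_p = γ c_v`. -/
def conductivity {g : PerfectGas} (vis : Viscosity g d) (u : State d) : ℝ :=
  g.γ * g.cv * vis.μ u / g.Pr

/-- `∂V_i/∂x_j` for a state `u` with gradient `D`, by the chain rule. -/
def velocityGrad (u : State d) (D : Grad d) (i j : Fin d) : ℝ :=
  fderiv ℝ (fun w : State d => velocity w i) u (fun s => D s j)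

/-- `∂T/∂x_j` for a state `u` with gradient `D`, by the chain rule. -/
def temperatureGrad (g : PerfectGas) (u : State d) (D : Grad d) (j : Fin d) : ℝ :=
  fderiv ℝ (fun w : State d => temperature g w) u (fun s => D s j)

/-- Viscous stress tensor `τ`. -/
def stress {g : PerfectGas} (vis : Viscosity g d) (u : State d) (D : Grad d) (i j : Fin d) : ℝ :=
  vis.μ u * (velocityGrad u D i j + velocityGrad u D j i
      - 2 / 3 * (∑ k, velocityGrad u D k k) * (if i = j then 1 else 0))
    + vis.β u * (∑ k, velocityGrad u D k k) * (if i = j then 1 else 0)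

/-- Heat flux `f_j = -κ ∂T/∂x_j`. -/
def heatFlux {g : PerfectGas} (vis : Viscosity g d) (u : State d) (D : Grad d) (j : Fin d) : ℝ :=
  -(conductivity vis u * temperatureGrad g u D j)

/-- Viscous fluxes `G(u, ∇u)`. -/
def viscousFluxCons {g : PerfectGas} (vis : Viscosity g d) (u : State d) (D : Grad d) : Grad d :=
  Matrix.of fun i j => -mkState 0 (fun l => stress vis u D l j)
    ((∑ l, velocity u l * stress vis u D l j) - heatFlux vis u D j) i

/-- The matrices `𝒦_{jk}(u)` with `G_{ij}(u, ∇u) = - [𝒦_{jk}(u)]_{is} ∂u_s/∂x_k`. -/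
def viscMat {g : PerfectGas} (vis : Viscosity g d) (u : State d) (j k : Fin d) : StateMat d :=
  Matrix.of fun i s => -viscousFluxCons vis u (Matrix.single s k 1) i j

/-- `Ã₀(v) = ∂u/∂v`. -/
def A0 (g : PerfectGas) (v : State d) : StateMat d :=
  Matrix.of fun l s => fderiv ℝ (fun w : State d => consVars g w l) v (Pi.single s 1)

/-- `𝒦̃_{jk}(v) = 𝒦_{jk}(u(v)) Ã₀(v)`. -/
def viscMatV {g : PerfectGas} (vis : Viscosity g d) (v : State d) (j k : Fin d) : StateMat d :=
  viscMat vis (consVars g v) j k * A0 g v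

/-- Viscous flux in entropy variables,
`G_{ij}(v, q) = - [𝒦_{jk}(u(v))]_{il} (∂u_l/∂v_s) q_{sk}`. -/
def viscousFlux {g : PerfectGas} (vis : Viscosity g d) (v : State d) (q : Grad d) : Grad d :=
  Matrix.of fun i j => -∑ k, ∑ l, ∑ s, viscMat vis (consVars g v) j k i l * A0 g v l s * q s k

/-- The quadratic form `qᵗ 𝒦̃(v) q = q_{ij} [𝒦̃_{jk}(v)]_{is} q_{sk}`. -/
def viscForm {g : PerfectGas} (vis : Viscosity g d) (v : State d) (q : Grad d) : ℝ :=
  ∑ i, ∑ j, ∑ s, ∑ k, q i j * viscMatV vis v j k i s * q s k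

/-! ### Flux Jacobians and the mean-value stabilization matrix -/

/-- `A_n(v; n) = (∂F/∂u)(u(v)) · n`. -/
def An (g : PerfectGas) (v : State d) (n : Space d) : StateMat d :=
  Matrix.of fun i l => ∑ j,
    fderiv ℝ (fun w : State d => inviscidFlux g w i j) (consVars g v) (Pi.single l 1) * n j

/-- `Ã_n = A_n Ã₀`. -/
def AnV (g : PerfectGas) (v : State d) (n : Space d) : StateMat d := An g v n * A0 g v

/-- The absolute value `|A| = P |D| P⁻¹` of a diagonalizable matrix `A = P D P⁻¹`
(see `matAbs_conj_diagonal`): the value at `A` of a polynomial that takes the value `|x|` at every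
eigenvalue `x` of `A`. -/
def matAbs {n : Type*} [Fintype n] [DecidableEq n] (A : Matrix n n ℝ) : Matrix n n ℝ :=
  Polynomial.aeval A (Lagrange.interpolate A.charpoly.roots.toFinset id fun x => |x|)

lemma matAbs_conj_diagonal {n : Type*} [Fintype n] [DecidableEq n] (P : Matrix n n ℝ)
    (hP : IsUnit P.det) (D : n → ℝ) :
    matAbs (P * Matrix.diagonal D * P⁻¹) = P * Matrix.diagonal (fun i => |D i|) * P⁻¹ := by
  have hPP : P⁻¹ * P = 1 := Matrix.nonsing_inv_mul P hP
  have hPP' : P * P⁻¹ = 1 := Matrix.mul_nonsing_inv P hP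
  have hchar : (P * Matrix.diagonal D * P⁻¹).charpoly = (Matrix.diagonal D).charpoly := by
    rw [Matrix.charpoly_mul_comm, ← mul_assoc, hPP, one_mul]
  have hev : ∀ p : Polynomial ℝ, Polynomial.aeval (P * Matrix.diagonal D * P⁻¹) p
      = P * Matrix.diagonal (fun i => p.eval (D i)) * P⁻¹ := by
    intro p
    induction p using Polynomial.induction_on' with
    | add p q hp hq =>
      rw [map_add, hp, hq, ← add_mul, ← mul_add, Matrix.diagonal_add]
      simp
    | monomial k a =>
      have hpow : (P * Matrix.diagonal D * P⁻¹) ^ k = P * Matrix.diagonal D ^ k * P⁻¹ := by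
        induction k with
        | zero => simp [hPP']
        | succ k ih =>
          rw [pow_succ, ih, pow_succ]
          calc P * Matrix.diagonal D ^ k * P⁻¹ * (P * Matrix.diagonal D * P⁻¹)
              = P * Matrix.diagonal D ^ k * (P⁻¹ * P) * Matrix.diagonal D * P⁻¹ := by
                simp only [mul_assoc]
            _ = _ := by rw [hPP, mul_one]; simp only [mul_assoc]
      rw [Polynomial.aeval_monomial, hpow, Matrix.diagonal_pow, Algebra.algebraMap_eq_smul_one,
        smul_mul_assoc, one_mul, ← smul_mul_assoc, ← mul_smul_comm, ← Matrix.diagonal_smul]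
      congr 3
      funext i
      simp
  have hroot : ∀ i, D i ∈ (P * Matrix.diagonal D * P⁻¹).charpoly.roots.toFinset := by
    intro i
    rw [hchar, Matrix.charpoly_diagonal, Multiset.mem_toFinset,
      Polynomial.mem_roots (Finset.prod_ne_zero_iff.mpr fun j _ => Polynomial.X_sub_C_ne_zero _),
      Polynomial.IsRoot, Polynomial.eval_prod]
    exact Finset.prod_eq_zero (Finset.mem_univ i) (by simp)
  rw [matAbs, hev]
  congr 3
  funext i
  exact Lagrange.eval_interpolate_at_node (v := id) _ (Function.injective_id.injOn) (hroot i)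

/-- The generalized absolute value `|Ã_n|_{Ã₀} = Ã₀ |Ã₀⁻¹ Ã_n|`. -/
def genAbs (g : PerfectGas) (v : State d) (n : Space d) : StateMat d :=
  A0 g v * matAbs ((A0 g v)⁻¹ * AnV g v n)

/-- The path `ṽ(θ; v₁, v₂)`: the straight segment from `v₁` to `v₂`, which stays in the
(convex) set of physical states. -/
def path (θ : ℝ) (v₁ v₂ : State d) : State d := v₁ + θ • (v₂ - v₁)

/-- Mean-value stabilization matrix `σ_MV(v₁, v₂; n)` (entrywise integral). -/
def sigmaMV (g : PerfectGas) (v₁ v₂ : State d) (n : Space d) : StateMat d :=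
  Matrix.of fun i j => ∫ θ in (0 : ℝ)..1,
    (1 - θ) * (genAbs g (path θ v₁ v₂) n i j + genAbs g (path θ v₂ v₁) n i j)

/-- `A⁺_{n,Ã₀} = A_n⁺ Ã₀ = ½ (A_n + |A_n|) Ã₀`. -/
def APlus (g : PerfectGas) (v : State d) (n : Space d) : StateMat d :=
  (1 / 2 : ℝ) • (An g v n + matAbs (An g v n)) * A0 g v

/-- `A⁻_{n,Ã₀} = A_n⁻ Ã₀ = ½ (A_n - |A_n|) Ã₀`. -/
def AMinus (g : PerfectGas) (v : State d) (n : Space d) : StateMat d :=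
  (1 / 2 : ℝ) • (An g v n - matAbs (An g v n)) * A0 g v

/-! ### Non-curved meshes -/

/-- A finite family of non-singular closed simplices with disjoint interiors that partition the
(open) domain `Ω`. Hanging nodes are allowed. -/
structure Mesh (d : ℕ) (ι : Type) (Ω : Set (Space d)) where
  elem : ι → Affine.Simplex ℝ (Space d) d
  cover : ⋃ K, convexHull ℝ (Set.range (elem K).points) = closure Ω
  disj : Pairwise fun K L => Disjoint (interior (convexHull ℝ (Set.range (elem K).points)))
    (interior (convexHull ℝ (Set.range (elem L).points)))

variable {ι : Type} [Fintype ι] {Ω : Set (Space d)}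

namespace Mesh

/-- The closed element `K`. -/
def carrier (M : Mesh d ι Ω) (K : ι) : Set (Space d) :=
  convexHull ℝ (Set.range (M.elem K).points)

/-- The facet of `K` opposite to its `i`-th vertex. -/
def facet (M : Mesh d ι Ω) (K : ι) (i : Fin (d + 1)) : Set (Space d) :=
  convexHull ℝ ((M.elem K).points '' {i}ᶜ)

open Classical in
/-- Interior faces `ℰ_h^I`: the sets `∂K ∩ ∂L`, `K ≠ L`, of nonzero `(d-1)`-dimensional measure. -/
def interiorFaces (M : Mesh d ι Ω) : Finset (Set (Space d)) :=
  ((Finset.univ : Finset (ι × ι)).image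
      fun KL => if KL.1 = KL.2 then ∅ else frontier (M.carrier KL.1) ∩ frontier (M.carrier KL.2)
    ).filter fun F => (μHE[d - 1] : Measure (Space d)) F ≠ 0

open Classical in
/-- Boundary faces `ℰ_h^B`: the (flat) pieces of `∂K ∩ ∂Ω`, one for each facet of `K`, of nonzero
`(d-1)`-dimensional measure. -/
def boundaryFaces (M : Mesh d ι Ω) : Finset (Set (Space d)) :=
  ((Finset.univ : Finset (ι × Fin (d + 1))).image fun Ki => M.facet Ki.1 Ki.2 ∩ frontier Ω
    ).filter fun F => (μHE[d - 1] : Measure (Space d)) F ≠ 0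

open Classical in
/-- All faces `ℰ_h`. -/
def faces (M : Mesh d ι Ω) : Finset (Set (Space d)) := M.interiorFaces ∪ M.boundaryFaces

open Classical in
/-- The outward unit normal of the element `K` on a flat piece `F` of its boundary. -/
def normal (M : Mesh d ι Ω) (K : ι) (F : Set (Space d)) : Space d :=
  if h : ∃ n : Space d, ‖n‖ = 1 ∧ ∀ x ∈ F, ∀ y ∈ M.carrier K, inner ℝ n (y - x) ≤ 0
  then h.choose else 0

/-- `∑_K ∫_K`. -/
def volInt (M : Mesh d ι Ω) (f : ι → Space d → ℝ) : ℝ := ∑ K, ∫ x in M.carrier K, f K x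

open Classical in
/-- `∑_K ∑_{F ⊆ ∂K, F ∈ S} ∫_F` for a collection `S` of faces. With all faces this is the integral
over `∂𝒯_h` (interior faces are counted twice, boundary faces once), with the interior faces that
over `∂𝒯_h \ ∂Ω`, with the boundary faces that over `∂Ω`. -/
def faceInt (M : Mesh d ι Ω) (S : Finset (Set (Space d)))
    (f : ι → Set (Space d) → Space d → ℝ) : ℝ :=
  ∑ K, ∑ F ∈ S.filter (fun F => F ⊆ frontier (M.carrier K)),
    ∫ x in F, f K F x ∂(μHE[d - 1] : Measure (Space d))

end Mesh

/-! ### Finite element spaces -/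

/-- `f` is on the set `S` a polynomial of degree at most `k`. -/
def IsPolyOn (k : ℕ) (S : Set (Space d)) (f : Space d → ℝ) : Prop :=
  ∃ P : MvPolynomial (Fin d) ℝ, P.totalDegree ≤ k ∧ ∀ x ∈ S,
    f x = MvPolynomial.eval (fun i => x i) P

lemma IsPolyOn.add {k : ℕ} {S : Set (Space d)} {f₁ f₂ : Space d → ℝ} (h₁ : IsPolyOn k S f₁)
    (h₂ : IsPolyOn k S f₂) : IsPolyOn k S (fun x => f₁ x + f₂ x) := by
  obtain ⟨P, hP, hf⟩ := h₁
  obtain ⟨Q, hQ, hf'⟩ := h₂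
  exact ⟨P + Q, (MvPolynomial.totalDegree_add P Q).trans (max_le hP hQ),
    fun x hx => by simp only [map_add, hf x hx, hf' x hx]⟩

lemma IsPolyOn.smul {k : ℕ} {S : Set (Space d)} {f : Space d → ℝ} (c : ℝ) (h : IsPolyOn k S f) :
    IsPolyOn k S (fun x => c * f x) := by
  obtain ⟨P, hP, hf⟩ := h
  exact ⟨c • P, (MvPolynomial.totalDegree_smul_le c P).trans hP,
    fun x hx => by simp only [MvPolynomial.smul_eval, hf x hx]⟩

/-- Element-wise defined states; the values of `w K` matter on the closed element `K` only. -/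
abbrev ElemState (d : ℕ) (ι : Type) := ι → Space d → State d

/-- Element-wise defined `m × d` matrices. -/
abbrev ElemGrad (d : ℕ) (ι : Type) := ι → Space d → Grad d

/-- States defined face by face, hence with one value on either side of an interior face; the
values of `μ F` matter on the face `F` only. -/
abbrev Trace (d : ℕ) := Set (Space d) → Space d → State d

/-- The space `𝒱_h^k` (the parametrizations of the elements are affine, so that the degree can be
measured on `K` itself). -/
def spaceV (M : Mesh d ι Ω) (k : ℕ) : Set (ElemState d ι) :=
  {w | ∀ K i, IsPolyOn k (M.carrier K) fun x => w K x i}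

/-- The space `𝒬_h^k`. -/
def spaceQ (M : Mesh d ι Ω) (k : ℕ) : Set (ElemGrad d ι) :=
  {r | ∀ K i j, IsPolyOn k (M.carrier K) fun x => r K x i j}

/-- The space of traces that are polynomials of degree at most `k` on every face, and continuous
on the union of the faces in `E` (that is, single-valued where such faces meet). -/
def traceSpace (M : Mesh d ι Ω) (k : ℕ) (E : Set (Set (Space d))) : Submodule ℝ (Trace d) where
  carrier := {μ | (∀ F ∈ M.faces, ∀ i, IsPolyOn k F fun x => μ F x i) ∧
    ∀ F ∈ M.faces, ∀ F' ∈ M.faces, F ∈ E → F' ∈ E → ∀ x ∈ F ∩ F', μ F x = μ F' x}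
  add_mem' := fun {a b} ha hb => ⟨fun F hF i => (ha.1 F hF i).add (hb.1 F hF i),
    fun F hF F' hF' hE hE' x hx => congrArg₂ (· + ·) (ha.2 F hF F' hF' hE hE' x hx)
      (hb.2 F hF F' hF' hE hE' x hx)⟩
  zero_mem' := ⟨fun _ _ _ => ⟨0, by simp, by simp⟩, fun _ _ _ _ _ _ _ _ => rfl⟩
  smul_mem' := fun c a ha => ⟨fun F hF i => (ha.1 F hF i).smul c,
    fun F hF F' hF' hE hE' x hx => congrArg (c • ·) (ha.2 F hF F' hF' hE hE' x hx)⟩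

/-- `ℳ̃_h^k`: continuous on the whole skeleton. -/
def contTraces (M : Mesh d ι Ω) (k : ℕ) : Submodule ℝ (Trace d) := traceSpace M k Set.univ

/-- `ℳ̂_h^k`: no continuity between different faces. -/
def discTraces (M : Mesh d ι Ω) (k : ℕ) : Submodule ℝ (Trace d) := traceSpace M k ∅

/-- Gradient of an element-wise defined state. -/
def grad (w : Space d → State d) (x : Space d) : Grad d := Matrix.of fun i j =>
  fderiv ℝ (fun y => w y i) x (EuclideanSpace.single j 1)

/-- Row-wise divergence. -/
def divg (r : Space d → Grad d) (x : Space d) : State d := fun i =>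
  ∑ j, fderiv ℝ (fun y => r y i j) x (EuclideanSpace.single j 1)

/-- `tr(Aᵗ B)`. -/
def frob (A B : Grad d) : ℝ := (A.transpose * B).trace

open Classical in
/-- The `L²(K)` projection of a scalar function onto the polynomials of degree at most `k`,
as a polynomial. -/
def projScalar (M : Mesh d ι Ω) (k : ℕ) (K : ι) (f : Space d → ℝ) : MvPolynomial (Fin d) ℝ :=
  if h : ∃ P : MvPolynomial (Fin d) ℝ, P.totalDegree ≤ k ∧
      ∀ Q : MvPolynomial (Fin d) ℝ, Q.totalDegree ≤ k →
        ∫ x in M.carrier K, (f x - MvPolynomial.eval (fun i => x i) P) *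
          MvPolynomial.eval (fun i => x i) Q = 0
  then h.choose else 0

/-- The `L²` projection `Π` onto `𝒬_h^k`, which acts entry by entry and element by element. -/
def projQ (M : Mesh d ι Ω) (k : ℕ) (r : ElemGrad d ι) : ElemGrad d ι := fun K x =>
  Matrix.of fun i j => MvPolynomial.eval (fun l => x l) (projScalar M k K fun y => r K y i j)

/-! ### The hybridized DG discretization of the Navier-Stokes equations -/

/-- Inviscid numerical flux `f̂_h` on the face `F` of `K`, for a stabilization matrix
`σ(v̂_h, v_h; n)`. -/
def fluxHat (g : PerfectGas) (M : Mesh d ι Ω) (σ : State d → State d → Space d → StateMat d)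
    (v : ElemState d ι) (vhat : Trace d) (K : ι) (F : Set (Space d)) (x : Space d) : State d :=
  (1 / 2 : ℝ) • (inviscidFlux g (consVars g (vhat F x)) + inviscidFlux g (consVars g (v K x))).mulVec
      (fun j => M.normal K F j)
    + (1 / 2 : ℝ) • (σ (vhat F x) (v K x) (M.normal K F)).mulVec (v K x - vhat F x)

/-- The projection viscous numerical flux `ĝ_h = Π[G(v_h, q_h)] · n`. -/
def projViscousFlux {g : PerfectGas} (vis : Viscosity g d) (M : Mesh d ι Ω) (k : ℕ)
    (q : ElemGrad d ι) (v : ElemState d ι) (_vhat : Trace d)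
    (K : ι) (F : Set (Space d)) (x : Space d) : State d :=
  (projQ M k (fun L y => viscousFlux vis (v L y) (q L y)) K x).mulVec (fun j => M.normal K F j)

/-- Viscous numerical fluxes: operators `(q_h, v_h, v̂_h) ↦ ĝ_h`. -/
abbrev ViscousNumFlux (d : ℕ) (ι : Type) :=
  ElemGrad d ι → ElemState d ι → Trace d → ι → Set (Space d) → Space d → State d

/-- Boundary condition terms: operators `(v̂_h, v_h, q_h; v^{∂Ω}) ↦ b̂_h`. -/
abbrev BoundaryTerm (d : ℕ) (ι : Type) :=
  Trace d → ElemState d ι → ElemGrad d ι → (Space d → State d) → Trace d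

/-- `(q_h, v_h, v̂_h)` solves on `(0, t_f)` the entropy-variable hybridized DG discretization with
stabilization matrix `σ`, viscous numerical flux `gHat`, boundary condition term `bHat` with
boundary state `vBdry`, trace space `T` and initial condition `u₀`. -/
structure IsSolution {g : PerfectGas} (vis : Viscosity g d) (M : Mesh d ι Ω) (k : ℕ)
    (T : Submodule ℝ (Trace d)) (σ : State d → State d → Space d → StateMat d)
    (gHat : ViscousNumFlux d ι) (bHat : BoundaryTerm d ι) (vBdry : ℝ → Space d → State d)
    (u₀ : Space d → State d) (tf : ℝ)
    (q : ℝ → ElemGrad d ι) (v : ℝ → ElemState d ι) (vhat : ℝ → Trace d) : Prop where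
  mem_Q : ∀ t ∈ Set.Ioo 0 tf, q t ∈ spaceQ M k
  mem_V : ∀ t ∈ Set.Ico 0 tf, v t ∈ spaceV M k
  mem_T : ∀ t ∈ Set.Ioo 0 tf, vhat t ∈ T
  diff : ∀ t ∈ Set.Ioo 0 tf, ∀ K, ∀ x ∈ M.carrier K, DifferentiableAt ℝ (fun τ => v τ K x) t
  gradient_eq : ∀ t ∈ Set.Ioo 0 tf, ∀ r ∈ spaceQ M k,
    M.volInt (fun K x => frob (q t K x) (r K x))
      + M.volInt (fun K x => v t K x ⬝ᵥ divg (r K) x)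
      - M.faceInt M.faces (fun K F x =>
          vhat t F x ⬝ᵥ (r K x).mulVec (fun j => M.normal K F j)) = 0
  evolution_eq : ∀ t ∈ Set.Ioo 0 tf, ∀ w ∈ spaceV M k,
    M.volInt (fun K x => deriv (fun τ => consVars g (v τ K x)) t ⬝ᵥ w K x)
      - M.volInt (fun K x => frob (inviscidFlux g (consVars g (v t K x))
          + viscousFlux vis (v t K x) (q t K x)) (grad (w K) x))
      + M.faceInt M.faces (fun K F x =>
          (fluxHat g M σ (v t) (vhat t) K F x + gHat (q t) (v t) (vhat t) K F x) ⬝ᵥ w K x) = 0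
  trace_eq : ∀ t ∈ Set.Ioo 0 tf, ∀ μ ∈ T,
    M.faceInt M.interiorFaces (fun K F x =>
        (fluxHat g M σ (v t) (vhat t) K F x + gHat (q t) (v t) (vhat t) K F x) ⬝ᵥ μ F x)
      + M.faceInt M.boundaryFaces (fun _ F x =>
          bHat (vhat t) (v t) (q t) (vBdry t) F x ⬝ᵥ μ F x) = 0
  init_eq : ∀ w ∈ spaceV M k,
    M.volInt (fun K x => (v 0 K x - entropyVars g (u₀ x)) ⬝ᵥ w K x) = 0

/-- The discrete solution is physical: density and pressure are positive on all closed elements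
and faces. -/
def IsPhysical (g : PerfectGas) (M : Mesh d ι Ω) (v : ElemState d ι) (vhat : Trace d) : Prop :=
  (∀ K, ∀ x ∈ M.carrier K, v K x ∈ physV g) ∧ ∀ F ∈ M.faces, ∀ x ∈ F, vhat F x ∈ physV g

/-- The total generalized entropy `∫ H(u(v_h))`. -/
def totalEntropy (g : PerfectGas) (M : Mesh d ι Ω) (v : ElemState d ι) : ℝ :=
  M.volInt fun K x => genEntropy g (consVars g (v K x))

/-- The face term of the entropy balance for the mean-value stabilization matrix. -/
def meanValueFaceTerm (g : PerfectGas) (M : Mesh d ι Ω) (v : ElemState d ι) (vhat : Trace d) : ℝ :=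
  M.faceInt M.faces fun K F x => ∫ θ in (0 : ℝ)..1,
    (1 - θ) * ((v K x - vhat F x) ⬝ᵥ
      (APlus g (path θ (v K x) (vhat F x)) (M.normal K F)
        - AMinus g (path θ (vhat F x) (v K x)) (M.normal K F)).mulVec (v K x - vhat F x))

/-- The boundary term `ℬ_{∂Ω}`, for given numerical fluxes and boundary condition values. -/
def boundaryBalance (g : PerfectGas) (M : Mesh d ι Ω) (vhat : Trace d)
    (fHat gHat : ι → Set (Space d) → Space d → State d) (b : Trace d) : ℝ :=
  M.faceInt M.boundaryFaces (fun K F x =>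
      entropyFlux g (consVars g (vhat F x)) ⬝ᵥ fun j => M.normal K F j)
    - M.faceInt M.boundaryFaces (fun K F x => vhat F x ⬝ᵥ
        (inviscidFlux g (consVars g (vhat F x))).mulVec (fun j => M.normal K F j))
    + M.faceInt M.boundaryFaces (fun K F x =>
        vhat F x ⬝ᵥ (fHat K F x + gHat K F x - b F x))

end HDG

end

/-! The scheme is tested with its own solution, and every term that is not dissipative is shown to
live on faces. Since v = ∂H/∂u, testing the evolution equation with v_h turns its time term into
d/dt ∫H (`hasDerivAt_totalEntropy`). The potential ψ = vᵗF - 𝓕 = (γ-1)ρV satisfies ∂ψ/∂v = F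
(`hasDerivAt_potential`), so F(v_h) : ∇v_h is the divergence of ψ(v_h) on each element and
integrates to ψ_n(v_h) over its faces (`Mesh.integral_frob_inviscidFlux`). Testing the gradient
equation with Π G(v_h, q_h) and integrating by parts shows that ∫ q_hᵗ𝒦̃q_h + ∫ G : ∇v_h is the face
integral of (v_h - v̂_h)·ĝ_h. The projection may be dropped against q_h and ∇v_h, which are
polynomials of degree at most k (`volInt_frob_viscousFlux`).

Subtracting the trace equation tested with v̂_h leaves on each side of each face f̂_h·(v_h - v̂_h) -
ψ_n(v_h) + ψ_n(v̂_h), apart from -ψ_n(v̂_h) on all faces and v̂_h·(f̂_h + ĝ_h - b̂_h) on ∂Ω. The two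
normals of an interior face are opposite (`Mesh.normal_eq_neg`), so ψ_n(v̂_h) survives on ∂Ω only,
where it completes 𝓑.

The face expression is evaluated by `meanValue_identity`. The difference of ψ_n is the mean of
δ·F_n, δ = v_h - v̂_h, over the segment from v̂_h to v_h, so the central part of f̂_h contributes
the error of the trapezoidal rule. Its integral remainder contains Ã_n with weight 1-θ along the
segment run in both directions. The matrix σ_MV adds |Ã_n| with the same weights, and the halves
combine into A⁺ and -A⁻.

The rest is justification. Faces are plain sets and hanging nodes occur, so the divergence theorem
is proved for convex bodies whose boundary is tiled, up to null sets, by flat pieces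
(`FlatBoundary.integral_div`). That faces of a mesh are such tiles rests on
`hausdorff_inter_diff_interior_union`. Continuity of |A_n|, needed for integrability, follows from
the eigenvalues V_n, V_n ± c (`An_cube`, `matAbs_An`). Differentiation under the integral uses that
v_h is polynomial in space (`exists_differentiable_coeffs`). -/

noncomputable section
namespace HDG

/-! ### Graphs over coordinate hyperplanes -/

variable {m : ℕ}

/-- Insert the coordinate `s` at position `j`. -/
def insCoord (j : Fin (m + 1)) (s : ℝ) (y : Space m) : Space (m + 1) :=
  WithLp.toLp 2 (j.insertNth s y.ofLp : Fin (m + 1) → ℝ)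

/-- Drop the coordinate `j`. -/
def dropCoord (j : Fin (m + 1)) (x : Space (m + 1)) : Space m :=
  WithLp.toLp 2 (j.removeNth x.ofLp)

@[simp] lemma insCoord_same (j : Fin (m + 1)) (s : ℝ) (y : Space m) : insCoord j s y j = s := by
  simp [insCoord]

@[simp] lemma insCoord_succAbove (j : Fin (m + 1)) (s : ℝ) (y : Space m) (i : Fin m) :
    insCoord j s y (j.succAbove i) = y i := by
  simp [insCoord]

@[simp] lemma dropCoord_apply (j : Fin (m + 1)) (x : Space (m + 1)) (i : Fin m) :
    dropCoord j x i = x (j.succAbove i) := rfl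

@[simp] lemma dropCoord_insCoord (j : Fin (m + 1)) (s : ℝ) (y : Space m) :
    dropCoord j (insCoord j s y) = y := by
  ext i; simp

@[simp] lemma insCoord_dropCoord (j : Fin (m + 1)) (x : Space (m + 1)) :
    insCoord j (x j) (dropCoord j x) = x := by
  ext i
  refine Fin.succAboveCases j ?_ (fun i => ?_) i <;> simp

lemma continuous_insCoord (j : Fin (m + 1)) :
    Continuous fun p : ℝ × Space m => insCoord j p.1 p.2 := by
  refine (PiLp.continuous_toLp 2 _).comp (continuous_pi fun i => ?_)
  refine Fin.succAboveCases j ?_ (fun i => ?_) i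
  · simpa using continuous_fst
  · simp only [Fin.insertNth_apply_succAbove]
    fun_prop

lemma continuous_dropCoord (j : Fin (m + 1)) : Continuous (dropCoord j) := by
  refine (PiLp.continuous_toLp 2 _).comp (continuous_pi fun i => ?_)
  simp only [Fin.removeNth]
  fun_prop

/-- Dropping a coordinate as a linear map. -/
def dropCoordL (j : Fin (m + 1)) : Space (m + 1) →L[ℝ] Space m where
  toFun := dropCoord j
  map_add' _ _ := by ext; simp
  map_smul' _ _ := by ext; simp
  cont := continuous_dropCoord j

lemma lipschitz_dropCoord (j : Fin (m + 1)) : LipschitzWith 1 (dropCoord j) := by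
  refine LipschitzWith.of_dist_le_mul fun x y => ?_
  rw [NNReal.coe_one, one_mul, EuclideanSpace.dist_eq, EuclideanSpace.dist_eq]
  refine Real.sqrt_le_sqrt ?_
  rw [Fin.sum_univ_succAbove _ j]
  simp only [dropCoord_apply]
  linarith [sq_nonneg (dist (x j) (y j))]

lemma inner_eq_insert (j : Fin (m + 1)) (n x : Space (m + 1)) :
    inner ℝ n x = n j * x j + ∑ i, n (j.succAbove i) * x (j.succAbove i) := by
  rw [PiLp.inner_apply, Fin.sum_univ_succAbove _ j]
  simp [mul_comm]

lemma measurePreserving_insCoord (j : Fin (m + 1)) :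
    MeasurePreserving (fun p : ℝ × Space m => insCoord j p.1 p.2) (volume.prod volume) volume := by
  have h1 := (volume_preserving_piFinSuccAbove (fun _ : Fin (m + 1) => ℝ) j).symm
  have h2 := PiLp.volume_preserving_toLp (Fin (m + 1))
  have h3 : MeasurePreserving (Prod.map id (WithLp.ofLp : Space m → Fin m → ℝ))
      ((volume : Measure ℝ).prod volume) ((volume : Measure ℝ).prod volume) :=
    (MeasurePreserving.id volume).prod (PiLp.volume_preserving_ofLp (Fin m))
  exact (h2.comp h1).comp h3

lemma measurableEmbedding_insCoord (j : Fin (m + 1)) :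
    MeasurableEmbedding fun p : ℝ × Space m => insCoord j p.1 p.2 := by
  refine (Topology.IsClosedEmbedding.measurableEmbedding ?_)
  refine Topology.IsClosedEmbedding.of_continuous_injective_isClosedMap (continuous_insCoord j)
    (fun p p' h => ?_) fun s hs => ?_
  · have h1 := congrArg (fun x : Space (m + 1) => x j) h
    have h2 := congrArg (dropCoord j) h
    simp only [insCoord_same, dropCoord_insCoord] at h1 h2
    exact Prod.ext h1 h2
  · have : (fun p : ℝ × Space m => insCoord j p.1 p.2) '' s
        = (fun x : Space (m + 1) => (x j, dropCoord j x)) ⁻¹' s := by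
      ext x
      constructor
      · rintro ⟨p, hp, rfl⟩; simpa using hp
      · intro hx; exact ⟨_, hx, by simp⟩
    rw [this]
    have := continuous_dropCoord j
    exact hs.preimage (by fun_prop)

lemma integral_insCoord (j : Fin (m + 1)) (f : Space (m + 1) → ℝ) (hf : Integrable f) :
    ∫ x, f x = ∫ y, ∫ s, f (insCoord j s y) := by
  have h := measurePreserving_insCoord j
  rw [← h.integral_comp (measurableEmbedding_insCoord j)]
  exact integral_prod_symm _ (h.integrable_comp_emb (measurableEmbedding_insCoord j) |>.mpr hf)

/-- Linear parametrization of the hyperplane orthogonal to `n` over the `j`-th coordinate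
hyperplane. -/
def graphLin (j : Fin (m + 1)) (n : Space (m + 1)) : Space m →ₗ[ℝ] Space (m + 1) where
  toFun y := insCoord j (-(∑ i, n (j.succAbove i) * y i) / n j) y
  map_add' y y' := by
    ext i
    refine Fin.succAboveCases j ?_ (fun i => ?_) i
    · simp [mul_add, Finset.sum_add_distrib]; ring
    · simp
  map_smul' a y := by
    ext i
    refine Fin.succAboveCases j ?_ (fun i => ?_) i
    · simp only [insCoord_same, PiLp.smul_apply, smul_eq_mul, RingHom.id_apply]
      rw [← mul_div_assoc, mul_neg, Finset.mul_sum]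
      congr 2
      exact Finset.sum_congr rfl fun _ _ => by ring
    · simp

lemma graphLin_apply (j : Fin (m + 1)) (n : Space (m + 1)) (y : Space m) :
    graphLin j n y = insCoord j (-(∑ i, n (j.succAbove i) * y i) / n j) y := rfl

/-- Affine parametrization of the hyperplane `n · x = c`. -/
def graphMap (j : Fin (m + 1)) (n : Space (m + 1)) (c : ℝ) (y : Space m) : Space (m + 1) :=
  insCoord j ((c - ∑ i, n (j.succAbove i) * y i) / n j) y

lemma continuous_graphMap (j : Fin (m + 1)) (n : Space (m + 1)) (c : ℝ) :
    Continuous (graphMap j n c) := by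
  have h : Continuous fun y : Space m =>
      (((c - ∑ i, n (j.succAbove i) * y i) / n j, y) : ℝ × Space m) := by fun_prop
  exact (continuous_insCoord j).comp h

lemma graphMap_eq (j : Fin (m + 1)) (n : Space (m + 1)) (c : ℝ) (y : Space m) :
    graphMap j n c y = graphLin j n y + insCoord j (c / n j) 0 := by
  ext i
  refine Fin.succAboveCases j ?_ (fun i => ?_) i
  · simp [graphMap, graphLin_apply]; ring
  · simp [graphMap, graphLin_apply]

@[simp] lemma dropCoord_graphMap (j : Fin (m + 1)) (n : Space (m + 1)) (c : ℝ) (y : Space m) :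
    dropCoord j (graphMap j n c y) = y := by simp [graphMap]

lemma graphMap_dropCoord {j : Fin (m + 1)} {n : Space (m + 1)} (hn : n j ≠ 0) {c : ℝ}
    {x : Space (m + 1)} (hx : inner ℝ n x = c) : graphMap j n c (dropCoord j x) = x := by
  have : (c - ∑ i, n (j.succAbove i) * dropCoord j x i) / n j = x j := by
    rw [div_eq_iff hn, ← hx, inner_eq_insert j]; simp; ring
  rw [graphMap, this, insCoord_dropCoord]

lemma inner_graphMap {j : Fin (m + 1)} {n : Space (m + 1)} (hn : n j ≠ 0) (c : ℝ)
    (y : Space m) : inner ℝ n (graphMap j n c y) = c := by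
  rw [inner_eq_insert j]; simp [graphMap]; field_simp; ring

/-- The Gram matrix of the parametrization is 1 + aaᵗ with a_i = n_i / n_j over i ≠ j. Its
determinant is 1 + |a|² = 1 / n_j², because n is a unit vector. -/
lemma normDet_graphLin {j : Fin (m + 1)} {n : Space (m + 1)} (hn : n j ≠ 0) (h1 : ‖n‖ = 1) :
    (graphLin j n).normDet = |n j|⁻¹ := by
  have hsq := (graphLin j n).normDet_sq_eq_det_gram (EuclideanSpace.basisFun (Fin m) ℝ)
  have hg : Matrix.gram ℝ (fun i => graphLin j n (EuclideanSpace.basisFun (Fin m) ℝ i))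
      = 1 + Matrix.replicateCol Unit (fun i => n (j.succAbove i) / n j) *
          Matrix.replicateRow Unit (fun i => n (j.succAbove i) / n j) := by
    ext a b
    rw [Matrix.gram_apply, inner_eq_insert j]
    simp only [graphLin_apply, insCoord_same, insCoord_succAbove, EuclideanSpace.basisFun_apply,
      PiLp.single_apply, mul_ite, mul_one, mul_zero, Finset.sum_ite_eq',
      Finset.mem_univ, if_true, Matrix.add_apply, Matrix.one_apply, Matrix.mul_apply,
      Matrix.replicateCol_apply, Matrix.replicateRow_apply, Finset.univ_unique,
      Finset.sum_singleton]
    have : (if a = b then (1:ℝ) else 0) = if b = a then 1 else 0 := by simp [eq_comm]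
    rw [this]; ring
  have hnorm : n j ^ 2 + ∑ i, n (j.succAbove i) ^ 2 = 1 := by
    have := inner_eq_insert j n n
    rw [real_inner_self_eq_norm_sq, h1] at this
    simp only [pow_two] at this ⊢; linarith
  have hS : ∑ i, (n (j.succAbove i) / n j) * (n (j.succAbove i) / n j)
      = (∑ i, n (j.succAbove i) ^ 2) / n j ^ 2 := by
    rw [Finset.sum_div]; exact Finset.sum_congr rfl fun _ _ => by ring
  rw [hg, Matrix.det_one_add_replicateCol_mul_replicateRow, dotProduct, hS] at hsq
  have h2 : (graphLin j n).normDet ^ 2 = (|n j|⁻¹) ^ 2 := by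
    rw [inv_pow, sq_abs]
    have : (graphLin j n).normDet ^ 2 = 1 + (∑ i, n (j.succAbove i) ^ 2) / n j ^ 2 := hsq
    rw [this]; field_simp; linarith
  exact (pow_left_inj₀ (LinearMap.normDet_nonneg _) (by positivity) two_ne_zero).mp h2

lemma hausdorff_image_graphMap {j : Fin (m + 1)} {n : Space (m + 1)} (hn : n j ≠ 0)
    (h1 : ‖n‖ = 1) (c : ℝ) (S : Set (Space m)) :
    (μHE[m] : Measure (Space (m + 1))) (graphMap j n c '' S)
      = ENNReal.ofReal |n j|⁻¹ * volume S := by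
  have h := (graphLin j n).euclideanHausdorffMeasure_image_eq_normDet_mul_volume S
  rw [finrank_euclideanSpace_fin, normDet_graphLin hn h1] at h
  rw [← h]
  have : graphMap j n c '' S
      = IsometryEquiv.addRight (insCoord j (c / n j) 0) '' (graphLin j n '' S) := by
    rw [Set.image_image]
    exact Set.image_congr fun y _ => graphMap_eq j n c y
  rw [this, (IsometryEquiv.isometry _).euclideanHausdorffMeasure_image]

/-- The part of `μHE` on a hyperplane is a multiple of the image of Lebesgue measure. -/
lemma hausdorff_restrict_hyperplane {j : Fin (m + 1)} {n : Space (m + 1)} (hn : n j ≠ 0)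
    (h1 : ‖n‖ = 1) (c : ℝ) :
    (μHE[m] : Measure (Space (m + 1))).restrict {x | inner ℝ n x = c}
      = ENNReal.ofReal |n j|⁻¹ • Measure.map (graphMap j n c) volume := by
  have hm := (continuous_graphMap j n c).measurable
  ext A hA
  rw [Measure.restrict_apply hA, Measure.smul_apply, Measure.map_apply hm hA, smul_eq_mul,
    ← hausdorff_image_graphMap hn h1 c]
  congr 1
  ext x
  constructor
  · rintro ⟨hxA, hx⟩
    exact ⟨dropCoord j x, by simpa [graphMap_dropCoord hn hx] using hxA, graphMap_dropCoord hn hx⟩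
  · rintro ⟨y, hy, rfl⟩
    exact ⟨hy, inner_graphMap hn c y⟩

lemma measurableEmbedding_graphMap {j : Fin (m + 1)} {n : Space (m + 1)} (hn : n j ≠ 0) (c : ℝ) :
    MeasurableEmbedding (graphMap j n c) := by
  refine (Topology.IsClosedEmbedding.of_continuous_injective_isClosedMap
    (continuous_graphMap j n c) (fun y y' h => ?_) fun s hs => ?_).measurableEmbedding
  · simpa using congrArg (dropCoord j) h
  · have : graphMap j n c '' s = {x | inner ℝ n x = c} ∩ dropCoord j ⁻¹' s := by
      ext x
      constructor
      · rintro ⟨p, hp, rfl⟩; exact ⟨inner_graphMap hn c p, by simpa using hp⟩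
      · rintro ⟨hx, hx'⟩; exact ⟨_, hx', graphMap_dropCoord hn hx⟩
    rw [this]
    exact (isClosed_eq (by fun_prop) continuous_const).inter (hs.preimage (continuous_dropCoord j))

lemma preimage_graphMap {j : Fin (m + 1)} {n : Space (m + 1)} (hn : n j ≠ 0) {c : ℝ}
    {F : Set (Space (m + 1))} (hF : ∀ x ∈ F, inner ℝ n x = c) :
    graphMap j n c ⁻¹' F = dropCoord j '' F := by
  ext y
  constructor
  · intro hy; exact ⟨_, hy, by simp⟩
  · rintro ⟨x, hx, rfl⟩
    simpa [graphMap_dropCoord hn (hF x hx)] using hx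

/-- Surface integrals over a flat piece as integrals over its projection. -/
lemma setIntegral_flat {j : Fin (m + 1)} {n : Space (m + 1)} (hn : n j ≠ 0) (h1 : ‖n‖ = 1)
    {c : ℝ} {F : Set (Space (m + 1))} (hFm : MeasurableSet F) (hF : ∀ x ∈ F, inner ℝ n x = c)
    (f : Space (m + 1) → ℝ) :
    ∫ x in F, f x ∂(μHE[m] : Measure (Space (m + 1)))
      = |n j|⁻¹ * ∫ y in dropCoord j '' F, f (graphMap j n c y) := by
  have hsub : F ⊆ {x | inner ℝ n x = c} := hF
  have hr : (μHE[m] : Measure (Space (m + 1))).restrict F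
      = ENNReal.ofReal |n j|⁻¹ • (Measure.map (graphMap j n c) volume).restrict F := by
    rw [← Measure.restrict_smul, ← hausdorff_restrict_hyperplane hn h1 c,
      Measure.restrict_restrict hFm, Set.inter_eq_left.mpr hsub]
  rw [hr, integral_smul_measure, (measurableEmbedding_graphMap hn c).setIntegral_map,
    preimage_graphMap hn hF, ENNReal.toReal_ofReal (by positivity), smul_eq_mul]

lemma hausdorff_flat {j : Fin (m + 1)} {n : Space (m + 1)} (hn : n j ≠ 0) (h1 : ‖n‖ = 1)
    {c : ℝ} {F : Set (Space (m + 1))} (hF : ∀ x ∈ F, inner ℝ n x = c) :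
    (μHE[m] : Measure (Space (m + 1))) F = ENNReal.ofReal |n j|⁻¹ * volume (dropCoord j '' F) := by
  rw [← hausdorff_image_graphMap hn h1 c, Set.image_image]
  congr 1
  conv_lhs => rw [← Set.image_id F]
  exact Set.image_congr fun x hx => (graphMap_dropCoord hn (hF x hx)).symm

lemma hausdorff_flat_lt_top {n : Space (m + 1)} (h1 : ‖n‖ = 1)
    {c : ℝ} {F : Set (Space (m + 1))} (hFc : IsCompact F) (hF : ∀ x ∈ F, inner ℝ n x = c) :
    (μHE[m] : Measure (Space (m + 1))) F < ⊤ := by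
  obtain ⟨j, hj⟩ : ∃ j, n j ≠ 0 := by
    by_contra! h
    have : n = 0 := by ext j; simpa using h j
    simp [this] at h1
  rw [hausdorff_flat hj h1 hF]
  exact ENNReal.mul_lt_top ENNReal.ofReal_lt_top
    (hFc.image (continuous_dropCoord j)).measure_lt_top

/-- Projections of `μHE`-null sets are null. -/
lemma volume_dropCoord_null (j : Fin (m + 1)) {N : Set (Space (m + 1))}
    (hN : (μHE[m] : Measure (Space (m + 1))) N = 0) : volume (dropCoord j '' N) = 0 := by
  rw [← EuclideanSpace.euclideanHausdorffMeasure_eq_volume]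
  rw [Measure.euclideanHausdorffMeasure_def, Measure.smul_apply] at hN ⊢
  -- The Lipschitz estimate is available for `μH`. The factor between `μHE` and `μH` is nonzero, so
  -- both have the same null sets.
  have hN' : (μH[m] : Measure (Space (m + 1))) N = 0 := by
    have h0 := Measure.addHaarScalarFactor_volume_hausdorffMeasure_ne_zero m
    simpa [h0, ENNReal.smul_def] using hN
  have := (lipschitz_dropCoord j).hausdorffMeasure_image_le (d := (m : ℝ)) (by positivity) N
  rw [hN'] at this
  simp at this
  simp [this]

end HDG

end

noncomputable section
namespace HDG

/-! ### The divergence theorem on convex bodies with flat boundary pieces -/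

section Gauss
variable {m : ℕ}

/-- A finite family of compact pieces `F` of hyperplanes `n F · x = c F` that support `K`; the
pieces cover the boundary of `K` and overlap in null sets only. -/
structure FlatBoundary (K : Set (Space (m + 1))) (S : Finset (Set (Space (m + 1))))
    (n : Set (Space (m + 1)) → Space (m + 1)) (c : Set (Space (m + 1)) → ℝ) : Prop where
  subset : ∀ F ∈ S, F ⊆ frontier K
  compact : ∀ F ∈ S, IsCompact F
  unit : ∀ F ∈ S, ‖n F‖ = 1
  flat : ∀ F ∈ S, ∀ x ∈ F, inner ℝ (n F) x = c F
  support : ∀ F ∈ S, F.Nonempty → ∀ y ∈ K, inner ℝ (n F) y ≤ c F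
  cover : (μHE[m] : Measure (Space (m + 1))) (frontier K \ ⋃ F ∈ S, F) = 0
  overlap : ∀ F ∈ S, ∀ F' ∈ S, F ≠ F' → (μHE[m] : Measure (Space (m + 1))) (F ∩ F') = 0

/-- A small move from z in the direction n stays in K and strictly increases the linear functional.
-/
lemma inner_lt_of_mem_interior {E : Type*} [NormedAddCommGroup E] [InnerProductSpace ℝ E]
    {K : Set E} {n z : E} {c : ℝ} (hn : n ≠ 0)
    (h : ∀ y ∈ K, inner ℝ n y ≤ c) (hz : z ∈ interior K) : inner ℝ n z < c := by
  have hc : Filter.Tendsto (fun ε : ℝ => z + ε • n) (nhdsWithin 0 (Set.Ioi 0)) (nhds z) := by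
    have : Continuous fun ε : ℝ => z + ε • n := by fun_prop
    simpa using (this.tendsto 0).mono_left nhdsWithin_le_nhds
  obtain ⟨ε, hε, hpos⟩ := ((hc.eventually (mem_interior_iff_mem_nhds.mp hz)).and
    self_mem_nhdsWithin).exists
  have := h _ hε
  rw [inner_add_right, inner_smul_right, real_inner_self_eq_norm_sq] at this
  have : 0 < ε * ‖n‖ ^ 2 := mul_pos hpos (by positivity)
  linarith

lemma inner_insCoord_sub (j : Fin (m + 1)) (n : Space (m + 1)) (s s' : ℝ) (y : Space m) :
    inner ℝ n (insCoord j s y) = inner ℝ n (insCoord j s' y) + n j * (s - s') := by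
  rw [inner_eq_insert j, inner_eq_insert j]; simp; ring

/-- Here s₁ is an end of the chord of K over y and s₀ a parameter of an interior point. The
condition on the sign of n_j (s₁ - s₀) keeps the faces that look towards this end. By `hcov` some
face contains the endpoint, and by `hov` only one, so the sum has a single nonzero term. -/
lemma FlatBoundary.sum_endpoint {K : Set (Space (m + 1))} {S : Finset (Set (Space (m + 1)))}
    {n : Set (Space (m + 1)) → Space (m + 1)} {c : Set (Space (m + 1)) → ℝ}
    (h : FlatBoundary K S n c) (hKc : IsClosed K) (j : Fin (m + 1)) {y : Space m} {s₀ s₁ : ℝ}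
    (h₀ : insCoord j s₀ y ∈ interior K) (h₁ : insCoord j s₁ y ∈ frontier K)
    (hs : s₁ ≠ s₀) (hext : ∀ s, insCoord j s y ∈ K → (s - s₁) * (s₁ - s₀) ≤ 0)
    (hcov : y ∉ dropCoord j '' (frontier K \ ⋃ F ∈ S, F))
    (hov : ∀ F ∈ S, ∀ F' ∈ S, F ≠ F' → y ∉ dropCoord j '' (F ∩ F'))
    (f : Space (m + 1) → ℝ) :
    ∑ F ∈ S, (dropCoord j '' F).indicator (fun y =>
      if 0 < n F j * (s₁ - s₀) then f (graphMap j (n F) (c F) y) else 0) y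
      = f (insCoord j s₁ y) := by
  classical
  have hne : ∀ F ∈ S, n F ≠ 0 := fun F hF h0 => by simpa [h0] using h.unit F hF
  obtain ⟨F₁, hF₁, hx₁⟩ : ∃ F ∈ S, insCoord j s₁ y ∈ F := by
    by_contra! hc
    refine hcov ⟨insCoord j s₁ y, ⟨h₁, ?_⟩, dropCoord_insCoord j s₁ y⟩
    simpa using hc
  have key : ∀ F ∈ S, insCoord j s₁ y ∈ F → 0 < n F j * (s₁ - s₀) := by
    intro F hF hx
    have hlt := inner_lt_of_mem_interior (hne F hF) (h.support F hF ⟨insCoord j s₁ y, hx⟩) h₀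
    rw [← h.flat F hF _ hx, inner_insCoord_sub j _ s₁ s₀] at hlt
    linarith
  rw [Finset.sum_eq_single_of_mem F₁ hF₁]
  · have hy₁ : y ∈ dropCoord j '' F₁ := ⟨_, hx₁, dropCoord_insCoord j s₁ y⟩
    rw [Set.indicator_of_mem hy₁, if_pos (key F₁ hF₁ hx₁)]
    have hn0 : n F₁ j ≠ 0 := left_ne_zero_of_mul (key F₁ hF₁ hx₁).ne'
    have := graphMap_dropCoord hn0 (h.flat F₁ hF₁ _ hx₁)
    rw [dropCoord_insCoord] at this
    rw [this]
  · intro F hF hFne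
    by_cases hy : y ∈ dropCoord j '' F
    swap
    · exact Set.indicator_of_notMem hy _
    rw [Set.indicator_of_mem hy, if_neg]
    intro hpos
    obtain ⟨x, hx, rfl⟩ := hy
    have hxK : insCoord j (x j) (dropCoord j x) ∈ frontier K := by
      rw [insCoord_dropCoord]; exact h.subset F hF hx
    have hsupp := h.support F hF ⟨x, hx⟩
    have hle : ∀ y ∈ closure K, inner ℝ (n F) y ≤ c F := fun y hy =>
      closure_minimal (s := K) (t := {y | inner ℝ (n F) y ≤ c F}) hsupp
        (isClosed_le (by fun_prop) continuous_const) hy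
    have e1 := hle _ (frontier_subset_closure h₁)
    have e2 := h.flat F hF x hx
    rw [← insCoord_dropCoord j x] at e2
    rw [inner_insCoord_sub j _ s₁ (x j), e2] at e1
    -- The half-space of F contains the endpoint, which together with the sign of n_j places x at or
    -- beyond s₁ as seen from s₀. Being in K, x cannot lie beyond.
    have hxs : x j = s₁ := by
      have e7 := hext (x j) (hKc.frontier_subset hxK)
      have e8 : (s₁ - x j) * (s₁ - s₀) ≤ 0 := by
        by_contra! hc
        have := mul_pos hc hpos
        have h2 : (n F j * (s₁ - x j)) * (s₁ - s₀) ^ 2 ≤ 0 :=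
          mul_nonpos_of_nonpos_of_nonneg (by linarith) (sq_nonneg _)
        nlinarith
      have e9 : (s₁ - x j) * (s₁ - s₀) = 0 := by linarith
      rcases mul_eq_zero.mp e9 with e | e
      · linarith
      · exact absurd (by linarith) hs
    refine hov F hF F₁ hF₁ hFne ⟨x, ⟨hx, ?_⟩, rfl⟩
    rw [← hxs, insCoord_dropCoord] at hx₁
    exact hx₁


/-- `F ↦ ± f` on the projection of `F`, the density of `∫_F f n_j`. -/
lemma FlatBoundary.setIntegral_eq {K : Set (Space (m + 1))} {S : Finset (Set (Space (m + 1)))}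
    {n : Set (Space (m + 1)) → Space (m + 1)} {c : Set (Space (m + 1)) → ℝ}
    (h : FlatBoundary K S n c) (j : Fin (m + 1)) {f : Space (m + 1) → ℝ}
    {F : Set (Space (m + 1))} (hF : F ∈ S) (hf : ContinuousOn f F) :
    Integrable ((dropCoord j '' F).indicator
      (fun y => SignType.sign (n F j) * f (graphMap j (n F) (c F) y))) ∧
    ∫ x in F, f x * n F j ∂(μHE[m] : Measure (Space (m + 1)))
      = ∫ y, (dropCoord j '' F).indicator
        (fun y => SignType.sign (n F j) * f (graphMap j (n F) (c F) y)) y := by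
  have hc : IsCompact (dropCoord j '' F) := (h.compact F hF).image (continuous_dropCoord j)
  -- For a face parallel to the axis j both sides vanish: the sign is 0, and `graphMap`, which
  -- divides by n_j, plays no role.
  by_cases hn : n F j = 0
  · simp [hn]
  constructor
  · rw [integrable_indicator_iff hc.measurableSet]
    refine ContinuousOn.integrableOn_compact hc (continuousOn_const.mul ?_)
    refine hf.comp (continuous_graphMap _ _ _).continuousOn ?_
    rintro _ ⟨x, hx, rfl⟩
    rwa [graphMap_dropCoord hn (h.flat F hF x hx)]
  · rw [setIntegral_flat hn (h.unit F hF) (h.compact F hF).measurableSet (h.flat F hF),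
      integral_indicator hc.measurableSet, ← integral_const_mul]
    congr 1
    funext y
    rcases lt_or_gt_of_ne hn with h0 | h0
    · rw [sign_neg h0, abs_of_neg h0]; simp; field_simp
    · rw [sign_pos h0, abs_of_pos h0]; simp; field_simp

/-- Fubini along the lines in direction j. A generic line misses K or meets it in a segment [a, b],
where the fundamental theorem of calculus gives f(b) - f(a). The faces over y reproduce exactly
these two values by `FlatBoundary.sum_endpoint`. -/
lemma FlatBoundary.integral_partial {K : Set (Space (m + 1))} {S : Finset (Set (Space (m + 1)))}
    {n : Set (Space (m + 1)) → Space (m + 1)} {c : Set (Space (m + 1)) → ℝ}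
    (h : FlatBoundary K S n c) (hK : IsCompact K) (hconv : Convex ℝ K)
    (hint : (interior K).Nonempty) (j : Fin (m + 1)) {f f' : Space (m + 1) → ℝ}
    (hf : ContinuousOn f K) (hf' : ContinuousOn f' K)
    (hderiv : ∀ x ∈ K, HasDerivAt (fun s => f (insCoord j s (dropCoord j x))) (f' x) (x j)) :
    ∫ x in K, f' x = ∑ F ∈ S, ∫ x in F, f x * n F j ∂(μHE[m] : Measure (Space (m + 1))) := by
  classical
  have hKc := hK.isClosed
  have hsubK : ∀ F ∈ S, F ⊆ K := fun F hF => (h.subset F hF).trans hKc.frontier_subset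
  have hface := fun F (hF : F ∈ S) => h.setIntegral_eq j hF (hf.mono (hsubK F hF))
  rw [Finset.sum_congr rfl fun F hF => (hface F hF).2,
    ← integral_finsetSum _ fun F hF => (hface F hF).1, ← integral_indicator hK.measurableSet,
    integral_insCoord j _ ((integrable_indicator_iff hK.measurableSet).mpr
      (hf'.integrableOn_compact hK))]
  refine integral_congr_ae ?_
  set U : Set (Space m) := dropCoord j '' interior K with hU
  have hUopen : IsOpen U := by
    refine ((dropCoordL j).isOpenMap ?_) _ isOpen_interior
    exact fun y => ⟨insCoord j 0 y, dropCoord_insCoord j 0 y⟩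
  have hUconv : Convex ℝ U := hconv.interior.linear_image (dropCoordL j).toLinearMap
  -- Three null sets of lines are discarded: those that may graze K without entering its interior,
  -- those through uncovered boundary points, and those through the overlap of two faces. The first
  -- is null because U is convex.
  have n1 : ∀ᵐ y, y ∉ frontier U := by
    exact measure_eq_zero_iff_ae_notMem.mp (hUconv.addHaar_frontier volume)
  have n2 : ∀ᵐ y, y ∉ dropCoord j '' (frontier K \ ⋃ F ∈ S, F) := by
    exact measure_eq_zero_iff_ae_notMem.mp (volume_dropCoord_null j h.cover)
  have n3 : ∀ᵐ y, ∀ F ∈ S, ∀ F' ∈ S, F ≠ F' → y ∉ dropCoord j '' (F ∩ F') := by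
    rw [Filter.eventually_all_finset]; intro F hF
    rw [Filter.eventually_all_finset]; intro F' hF'
    by_cases hFF : F = F'
    · simp [hFF]
    · have := volume_dropCoord_null j (h.overlap F hF F' hF' hFF)
      have h4 : ∀ᵐ y, y ∉ dropCoord j '' (F ∩ F') := 
        measure_eq_zero_iff_ae_notMem.mp this
      exact h4.mono fun y hy _ => hy
  filter_upwards [n1, n2, n3] with y hy1 hy2 hy3
  have hline : Continuous fun s => insCoord j s y :=
    (continuous_insCoord j).comp (by fun_prop : Continuous fun s : ℝ => (s, y))
  by_cases hyU : y ∈ U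
  swap
  · -- the line misses `K`
    have hyK : y ∉ dropCoord j '' K := by
      intro hy
      have h1 : K ⊆ closure (interior K) := by
        rw [hconv.closure_interior_eq_closure_of_nonempty_interior hint]; exact subset_closure
      have h2 : y ∈ closure U :=
        (image_closure_subset_closure_image (continuous_dropCoord j)) (Set.image_mono h1 hy)
      exact hy1 ⟨h2, by rwa [hUopen.interior_eq]⟩
    rw [Finset.sum_eq_zero fun F hF => ?_]
    · refine (integral_congr_ae (Filter.Eventually.of_forall fun s => ?_)).trans
        (integral_zero ℝ ℝ)
      exact Set.indicator_of_notMem (fun hs => hyK ⟨_, hs, by simp⟩) _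
    · exact Set.indicator_of_notMem (fun hs => hyK (Set.image_mono (hsubK F hF) hs)) _
  obtain ⟨z, hz, hzy⟩ := hyU
  set P : Set ℝ := (fun s => insCoord j s y) ⁻¹' K with hP
  have hPc : IsCompact P := by
    refine (hK.image (f := fun x : Space (m + 1) => x j) (by fun_prop)).of_isClosed_subset
      (hKc.preimage hline) fun s hs => ⟨_, hs, by simp⟩
  have hz' : insCoord j (z j) y ∈ interior K := by rwa [← hzy, insCoord_dropCoord]
  have hzP : z j ∈ P := by
    change insCoord j (z j) y ∈ K
    exact interior_subset hz'
  have hPconv : Convex ℝ P := by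
    intro s hs s' hs' a b ha hb hab
    have := hconv hs hs' ha hb hab
    have e : a • insCoord j s y + b • insCoord j s' y = insCoord j (a • s + b • s') y := by
      ext i
      refine Fin.succAboveCases j ?_ (fun i => ?_) i
      · simp
      · simp [← add_mul, hab]
    rwa [e] at this
  have hPI := eq_Icc_of_connected_compact (hPconv.isConnected ⟨_, hzP⟩) hPc
  set a := sInf P with ha
  set b := sSup P with hb
  have hint_nhds : ∀ s, insCoord j s y ∈ interior K → a < s ∧ s < b := by
    intro s hs
    have : P ∈ nhds s := (hline.tendsto s).eventually (mem_interior_iff_mem_nhds.mp hs)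
    rw [hPI] at this
    simpa using Icc_mem_nhds_iff.mp this
  obtain ⟨haz, hzb⟩ := hint_nhds _ hz'
  have hab : a ≤ b := (haz.trans hzb).le
  have hmem : ∀ s, insCoord j s y ∈ K ↔ a ≤ s ∧ s ≤ b := fun s => by
    rw [← Set.mem_Icc, ← hPI]; rfl
  have hfront : ∀ s, insCoord j s y ∈ K → ¬ (a < s ∧ s < b) →
      insCoord j s y ∈ frontier K := fun s hs hns =>
    ⟨subset_closure hs, fun hi => hns (hint_nhds s hi)⟩
  have hb' := h.sum_endpoint hKc j hz' (hfront b ((hmem b).mpr ⟨hab, le_rfl⟩) (by simp)) hzb.ne'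
    (fun s hs => mul_nonpos_of_nonpos_of_nonneg (by linarith [((hmem s).mp hs).2])
      (by linarith)) hy2 hy3 f
  have ha' := h.sum_endpoint hKc j hz' (hfront a ((hmem a).mpr ⟨le_rfl, hab⟩) (by simp)) haz.ne
    (fun s hs => mul_nonpos_of_nonneg_of_nonpos (by linarith [((hmem s).mp hs).1])
      (by linarith)) hy2 hy3 f
  have hL : ∫ s, K.indicator f' (insCoord j s y)
      = f (insCoord j b y) - f (insCoord j a y) := by
    have e1 : (fun s => K.indicator f' (insCoord j s y))
        = (Set.Icc a b).indicator fun s => f' (insCoord j s y) := by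
      rw [← hPI]; rfl
    rw [e1, integral_indicator measurableSet_Icc, integral_Icc_eq_integral_Ioc,
      ← intervalIntegral.integral_of_le hab]
    have hmaps : Set.MapsTo (fun s => insCoord j s y) (Set.uIcc a b) K := by
      intro s hs; rw [Set.uIcc_of_le hab] at hs; exact (hmem s).mpr hs
    refine intervalIntegral.integral_eq_sub_of_hasDerivAt (f := fun s => f (insCoord j s y))
      (fun s hs => ?_) (hf'.comp hline.continuousOn hmaps).intervalIntegrable
    simpa using hderiv _ (hmaps hs)
  rw [hL, ← hb', ← ha', ← Finset.sum_sub_distrib]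
  refine Finset.sum_congr rfl fun F hF => ?_
  by_cases hyF : y ∈ dropCoord j '' F
  swap
  · simp only [Set.indicator_of_notMem hyF, sub_zero]
  · simp only [Set.indicator_of_mem hyF]
    have p1 : 0 < b - z j := by linarith
    have p2 : a - z j < 0 := by linarith
    -- A face with n_j > 0 counts at the upper end only, one with n_j < 0 at the lower end only, one
    -- with n_j = 0 nowhere.
    rcases lt_trichotomy (n F j) 0 with h0 | h0 | h0
    · rw [sign_neg h0, if_neg (not_lt.mpr (mul_nonpos_of_nonpos_of_nonneg h0.le p1.le)),
        if_pos (mul_pos_of_neg_of_neg h0 p2)]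
      simp
    · simp [h0]
    · rw [sign_pos h0, if_pos (mul_pos h0 p1),
        if_neg (not_lt.mpr (mul_nonpos_of_nonneg_of_nonpos h0.le p2.le))]
      simp

/-- Divergence theorem. -/
theorem FlatBoundary.integral_div {K : Set (Space (m + 1))} {S : Finset (Set (Space (m + 1)))}
    {n : Set (Space (m + 1)) → Space (m + 1)} {c : Set (Space (m + 1)) → ℝ}
    (h : FlatBoundary K S n c) (hK : IsCompact K) (hconv : Convex ℝ K)
    (hint : (interior K).Nonempty) {f f' : Fin (m + 1) → Space (m + 1) → ℝ}
    (hf : ∀ j, ContinuousOn (f j) K) (hf' : ∀ j, ContinuousOn (f' j) K)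
    (hderiv : ∀ j, ∀ x ∈ K,
      HasDerivAt (fun s => f j (insCoord j s (dropCoord j x))) (f' j x) (x j)) :
    ∫ x in K, ∑ j, f' j x
      = ∑ F ∈ S, ∫ x in F, ∑ j, f j x * n F j ∂(μHE[m] : Measure (Space (m + 1))) := by
  rw [integral_finsetSum _ fun j _ => (hf' j).integrableOn_compact hK]
  simp_rw [fun j => h.integral_partial hK hconv hint j (hf j) (hf' j) (hderiv j)]
  rw [Finset.sum_comm]
  refine Finset.sum_congr rfl fun F hF => ?_
  rw [integral_finsetSum]
  intro j _
  have hsub : F ⊆ K := (h.subset F hF).trans hK.isClosed.frontier_subset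
  exact (((hf j).mono hsub).mul continuousOn_const).integrableOn_of_subset_isCompact
    (h.compact F hF) (h.compact F hF).measurableSet subset_rfl
    (hausdorff_flat_lt_top (h.unit F hF) (h.compact F hF) (h.flat F hF)).ne

end Gauss
end HDG

end

noncomputable section
namespace HDG

/-! ### Adjacent convex bodies and simplices -/

section Geometry
variable {m : ℕ}

/-- A cone argument: if K contains a neighbourhood of x within the hyperplane and a point z strictly
below it, then K contains the cone with apex z over that neighbourhood. The map p ↦ (p - t z) / (1 -
t) projects from z onto the hyperplane, is continuous near x and fixes x. -/
lemma eventually_mem_of_halfspace {E : Type*} [NormedAddCommGroup E] [InnerProductSpace ℝ E]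
    {K : Set E} (hK : Convex ℝ K) {n x z : E} {c : ℝ} (hz : z ∈ K) (hzc : inner ℝ n z < c)
    (hxc : inner ℝ n x = c) (hx : ∀ᶠ p in nhds x, inner ℝ n p = c → p ∈ K) :
    ∀ᶠ p in nhds x, inner ℝ n p ≤ c → p ∈ K := by
  have hpos : 0 < c - inner ℝ n z := sub_pos.mpr hzc
  set t : E → ℝ := fun p => (c - inner ℝ n p) / (c - inner ℝ n z) with ht
  have htc : Continuous t := by
    have : Continuous fun p : E => inner ℝ n p := by fun_prop
    exact (continuous_const.sub this).div_const _
  have ht0 : t x = 0 := by simp [ht, hxc]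
  have hcont : Filter.Tendsto (fun p => (1 - t p)⁻¹ • (p - t p • z)) (nhds x) (nhds x) := by
    have : ContinuousAt (fun p => (1 - t p)⁻¹ • (p - t p • z)) x := by
      have h1 : ContinuousAt t x := htc.continuousAt
      refine ContinuousAt.smul (ContinuousAt.inv₀ (by fun_prop) (by simp [ht0])) (by fun_prop)
    simpa [ContinuousAt, ht0] using this
  have ht1 : ∀ᶠ p in nhds x, t p < 1 :=
    htc.continuousAt.eventually_lt continuousAt_const (by simp [ht0])
  filter_upwards [hcont.eventually hx, ht1] with p hp h1 hpc
  have h1' : 1 - t p ≠ 0 := by linarith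
  have ht' : t p * (c - inner ℝ n z) = c - inner ℝ n p := div_mul_cancel₀ _ hpos.ne'
  have hmem := hp (by
    rw [inner_smul_right, inner_sub_right, inner_smul_right]
    field_simp
    linarith)
  have h0 : 0 ≤ t p := div_nonneg (by linarith) hpos.le
  have := hK hz hmem h0 (by linarith : 0 ≤ 1 - t p) (by ring)
  rwa [smul_smul, mul_inv_cancel₀ h1', one_smul, add_sub_cancel] at this

lemma exists_coord_ne_zero {n : Space m} (h1 : ‖n‖ = 1) : ∃ j, n j ≠ 0 := by
  by_contra! h
  have : n = 0 := by ext j; simpa using h j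
  simp [this] at h1

/-- A supporting unit normal for a convex set that misses the interior of a convex body. -/
lemma exists_unit_normal {K C : Set (Space m)} (hK : Convex ℝ K) (hint : (interior K).Nonempty)
    (hC : Convex ℝ C) (hne : C.Nonempty) (hdisj : Disjoint (interior K) C) :
    ∃ n : Space m, ‖n‖ = 1 ∧ ∀ x ∈ C, ∀ y ∈ K, inner ℝ n (y - x) ≤ 0 := by
  obtain ⟨f, u, hf1, hf2⟩ := geometric_hahn_banach_open hK.interior isOpen_interior hC hdisj
  set w := (InnerProductSpace.toDual ℝ (Space m)).symm f with hw
  have hfw : ∀ x, f x = inner ℝ w x := fun x => by simp [hw]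
  obtain ⟨z, hz⟩ := hint
  obtain ⟨x₀, hx₀⟩ := hne
  have hw0 : w ≠ 0 := by
    intro h0
    have h2 := (hf1 z hz).trans_le (hf2 x₀ hx₀)
    simp [hfw, h0] at h2
  refine ⟨‖w‖⁻¹ • w, by rw [norm_smul, norm_inv, norm_norm, inv_mul_cancel₀ (by simpa)], ?_⟩
  intro x hx y hy
  have hle : ∀ y ∈ closure (interior K), inner ℝ w y ≤ u := fun y hy =>
    closure_minimal (t := {y | inner ℝ w y ≤ u}) (fun y hy => by
      have := (hf1 y hy).le; rwa [hfw] at this) (isClosed_le (by fun_prop) continuous_const) hy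
  rw [hK.closure_interior_eq_closure_of_nonempty_interior ⟨z, hz⟩] at hle
  have h1 := hle y (subset_closure hy)
  have h2 := hf2 x hx
  rw [hfw] at h2
  rw [inner_smul_left, inner_sub_right]
  exact mul_nonpos_of_nonneg_of_nonpos (by simp) (by linarith)

lemma disjoint_interior_of_disjoint_interiors {X : Type*} [TopologicalSpace X] {K U : Set X}
    (hcl : K ⊆ closure (interior K)) (hU : IsOpen U) (hdisj : Disjoint U (interior K)) :
    Disjoint U K :=
  (hdisj.closure_right hU).mono_right hcl

/-- Two convex bodies with disjoint interiors fill a neighbourhood of almost every common point. -/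
lemma hausdorff_inter_diff_interior_union {K L : Set (Space (m + 1))} (hKc : Convex ℝ K) (hLc : Convex ℝ L) (hKi : (interior K).Nonempty)
    (hLi : (interior L).Nonempty) (hdisj : Disjoint (interior K) (interior L)) :
    (μHE[m] : Measure (Space (m + 1))) ((K ∩ L) \ interior (K ∪ L)) = 0 := by
  rcases (K ∩ L).eq_empty_or_nonempty with he | hne
  · simp [he]
  obtain ⟨x₁, hx₁⟩ := hne
  have hLcl : L ⊆ closure (interior L) := by
    rw [hLc.closure_interior_eq_closure_of_nonempty_interior hLi]; exact subset_closure
  have hd : Disjoint (interior K) L :=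
    disjoint_interior_of_disjoint_interiors hLcl isOpen_interior hdisj
  obtain ⟨n, hn1, hn⟩ := exists_unit_normal hKc hKi hLc ⟨x₁, hx₁.2⟩ hd
  have hn0 : n ≠ 0 := fun h => by simp [h] at hn1
  set c := inner ℝ n x₁ with hc
  have hKle : ∀ y ∈ K, inner ℝ n y ≤ c := fun y hy => by
    have := hn x₁ hx₁.2 y hy; rw [inner_sub_right] at this; linarith
  have hLge : ∀ y ∈ L, c ≤ inner ℝ n y := fun y hy => by
    have := hn y hy x₁ hx₁.1; rw [inner_sub_right] at this; linarith
  have hflat : ∀ x ∈ K ∩ L, inner ℝ n x = c := fun x hx =>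
    le_antisymm (hKle x hx.1) (hLge x hx.2)
  obtain ⟨j, hj⟩ := exists_coord_ne_zero hn1
  have hPc : Convex ℝ (dropCoord j '' (K ∩ L)) :=
    (hKc.inter hLc).linear_image (dropCoordL j).toLinearMap
  -- The set K ∩ L lies in the separating hyperplane. Over an interior point of its shadow it
  -- contains a neighbourhood within the hyperplane, and cones from interior points of K and of L
  -- fill both sides. Exceptional points therefore project into the frontier of a convex set, which
  -- is null.
  have hsub : (K ∩ L) \ interior (K ∪ L)
      ⊆ (K ∩ L) ∩ dropCoord j ⁻¹' frontier (dropCoord j '' (K ∩ L)) := by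
    rintro x ⟨hx, hxi⟩
    refine ⟨hx, ?_⟩
    by_contra hfr
    apply hxi
    have hyi : dropCoord j x ∈ interior (dropCoord j '' (K ∩ L)) := by
      by_contra h; exact hfr ⟨subset_closure ⟨x, hx, rfl⟩, h⟩
    have hev : ∀ᶠ p in nhds x, inner ℝ n p = c → p ∈ K ∩ L := by
      have := (continuous_dropCoord j).continuousAt.eventually
        (mem_interior_iff_mem_nhds.mp hyi)
      filter_upwards [this] with p hp hpc
      obtain ⟨q, hq, hqp⟩ := hp
      have h2 := graphMap_dropCoord hj (hflat q hq)
      rw [hqp, graphMap_dropCoord hj hpc] at h2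
      rwa [h2]
    obtain ⟨z, hz⟩ := hKi
    obtain ⟨w, hw⟩ := hLi
    have e1 := eventually_mem_of_halfspace hKc (interior_subset hz)
      (inner_lt_of_mem_interior hn0 hKle hz) (hflat x hx)
      (hev.mono fun p hp h => (hp h).1)
    have e2 := eventually_mem_of_halfspace (n := -n) (c := -c) hLc (interior_subset hw)
      (inner_lt_of_mem_interior (neg_ne_zero.mpr hn0)
        (fun y hy => by rw [inner_neg_left]; linarith [hLge y hy]) hw)
      (by rw [inner_neg_left, hflat x hx])
      (hev.mono fun p hp h => (hp (by rw [inner_neg_left] at h; linarith)).2)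
    refine mem_interior_iff_mem_nhds.mpr ?_
    filter_upwards [e1, e2] with p h1 h2
    rcases le_total (inner ℝ n p) c with h | h
    · exact Or.inl (h1 h)
    · exact Or.inr (h2 (by rw [inner_neg_left]; linarith))
  refine measure_mono_null hsub ?_
  rw [hausdorff_flat hj hn1 fun x hx => hflat x hx.1]
  refine mul_eq_zero_of_right _ (measure_mono_null ?_ (hPc.addHaar_frontier volume))
  rintro _ ⟨x, hx, rfl⟩
  exact hx.2

/-! #### Simplices -/

section Simplex
variable (s : Affine.Simplex ℝ (Space m) m)

/-- The vertices of a full-dimensional simplex as an affine basis. -/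
def simplexBasis : AffineBasis (Fin (m + 1)) ℝ (Space m) where
  toFun := s.points
  ind' := s.independent
  tot' := by
    rw [s.independent.affineSpan_eq_top_iff_card_eq_finrank_add_one]
    simp

lemma simplex_eq : convexHull ℝ (Set.range s.points) = {x | ∀ i, 0 ≤ (simplexBasis s).coord i x} :=
  (simplexBasis s).convexHull_eq_nonneg_coord

lemma interior_simplex :
    interior (convexHull ℝ (Set.range s.points)) = {x | ∀ i, 0 < (simplexBasis s).coord i x} :=
  (simplexBasis s).interior_convexHull

lemma isCompact_simplex : IsCompact (convexHull ℝ (Set.range s.points)) :=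
  (Set.finite_range s.points).isCompact_convexHull (𝕜 := ℝ)

lemma interior_simplex_nonempty : (interior (convexHull ℝ (Set.range s.points))).Nonempty :=
  ⟨_, (simplexBasis s).centroid_mem_interior_convexHull⟩

lemma mem_convexHull_image_of_coord (A : Finset (Fin (m + 1))) {x : Space m}
    (hx : x ∈ convexHull ℝ (Set.range s.points))
    (hA : ∀ k ∉ A, (simplexBasis s).coord k x = 0) : x ∈ convexHull ℝ (s.points '' A) := by
  rw [simplex_eq] at hx
  have h1 : ∑ k ∈ A, (simplexBasis s).coord k x = 1 := by
    rw [← (simplexBasis s).sum_coord_apply_eq_one x]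
    exact Finset.sum_subset (Finset.subset_univ _) fun k _ hk => hA k hk
  have h2 : ∑ k ∈ A, (simplexBasis s).coord k x • s.points k = x := by
    conv_rhs => rw [← (simplexBasis s).linear_combination_coord_eq_self x]
    exact Finset.sum_subset (Finset.subset_univ _) fun k _ hk => by rw [hA k hk, zero_smul]
  rw [← h2]
  refine (convex_convexHull ℝ _).sum_mem (fun k _ => hx k) h1 fun k hk => ?_
  exact subset_convexHull ℝ _ ⟨k, hk, rfl⟩

lemma simplex_facet_eq (i : Fin (m + 1)) : convexHull ℝ (s.points '' {i}ᶜ)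
    = {x ∈ convexHull ℝ (Set.range s.points) | (simplexBasis s).coord i x = 0} := by
  apply Set.Subset.antisymm
  · refine convexHull_min ?_ ?_
    · rintro _ ⟨k, hk, rfl⟩
      exact ⟨subset_convexHull ℝ _ ⟨k, rfl⟩, (simplexBasis s).coord_apply_ne (Ne.symm hk)⟩
    · refine (convex_convexHull ℝ _).inter ?_
      exact (convex_singleton (0 : ℝ)).affine_preimage ((simplexBasis s).coord i)
  · rintro x ⟨hx, hxi⟩
    have h := mem_convexHull_image_of_coord s ({i}ᶜ : Finset (Fin (m + 1))) hx fun k hk => by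
      rwa [show k = i by simpa using hk]
    simpa using h

lemma frontier_simplex : frontier (convexHull ℝ (Set.range s.points))
    = ⋃ i, convexHull ℝ (s.points '' {i}ᶜ) := by
  ext x
  rw [(isCompact_simplex s).isClosed.frontier_eq, Set.mem_sdiff, interior_simplex, Set.mem_iUnion]
  simp only [simplex_facet_eq, Set.mem_ofPred_eq, not_forall, not_lt]
  constructor
  · rintro ⟨hx, i, hi⟩
    refine ⟨i, hx, le_antisymm hi ?_⟩
    rw [simplex_eq] at hx; exact hx i
  · rintro ⟨i, hx, hi⟩
    exact ⟨hx, i, hi.le⟩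

end Simplex

/-- Two vertices are missing from the intersection, so it lies in the hull of m points, whose affine
dimension is at most m - 1. -/
lemma hausdorff_facet_inter (s : Affine.Simplex ℝ (Space (m + 1)) (m + 1)) {i j : Fin (m + 2)}
    (hij : i ≠ j) : (μHE[m] : Measure (Space (m + 1)))
      (convexHull ℝ (s.points '' {i}ᶜ) ∩ convexHull ℝ (s.points '' {j}ᶜ)) = 0 := by
  set C := convexHull ℝ (s.points '' {i}ᶜ) ∩ convexHull ℝ (s.points '' {j}ᶜ) with hC
  rcases C.eq_empty_or_nonempty with he | hne
  · simp [he]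
  set A : Finset (Fin (m + 2)) := {i, j}ᶜ with hA
  have hsub : C ⊆ convexHull ℝ (s.points '' A) := by
    rintro x ⟨hxi, hxj⟩
    rw [simplex_facet_eq] at hxi hxj
    refine mem_convexHull_image_of_coord s A hxi.1 fun k hk => ?_
    simp only [hA, Finset.mem_compl, Finset.mem_insert, Finset.mem_singleton, not_not] at hk
    rcases hk with rfl | rfl
    · exact hxi.2
    · exact hxj.2
  have hcard : A.card = m := by
    rw [hA, Finset.card_compl, Finset.card_pair hij]; simp
  -- For m = 0 the two facets are distinct points and their intersection is empty; this case must go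
  -- before m - 1 is used as a natural number.
  have hm : 0 < m := by
    rw [← hcard, Finset.card_pos]
    by_contra h
    rw [Finset.not_nonempty_iff_eq_empty] at h
    rw [h] at hsub
    simpa using hsub hne.some_mem
  have hlt : dimH C < m := by
    classical
    refine (dimH_mono hsub).trans_lt ?_
    rw [Real.Convex.dimH_eq_finrank_vectorSpan (convex_convexHull ℝ _) (hne.mono hsub),
      ← direction_affineSpan, affineSpan_convexHull, direction_affineSpan]
    have := finrank_vectorSpan_image_finset_le ℝ s.points A
      (show A.card = (m - 1) + 1 by omega)
    rw [Finset.coe_image] at this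
    exact_mod_cast (by omega : Module.finrank ℝ (vectorSpan ℝ (s.points '' A)) < m)
  rw [Measure.euclideanHausdorffMeasure_def, Measure.smul_apply]
  have := hausdorffMeasure_of_dimH_lt (d := (m : NNReal)) (s := C) (by simpa using hlt)
  simp at this
  simp [this]

end Geometry
end HDG

end

noncomputable section
namespace HDG

/-! ### Faces of a mesh -/

set_option linter.unusedSectionVars false

namespace Mesh
variable {m : ℕ} {ι : Type} [Fintype ι] {Ω : Set (Space (m + 1))} (M : Mesh (m + 1) ι Ω)

lemma isCompact_carrier (K : ι) : IsCompact (M.carrier K) := isCompact_simplex _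

lemma convex_carrier (K : ι) : Convex ℝ (M.carrier K) := convex_convexHull ℝ _

lemma interior_carrier_nonempty (K : ι) : (interior (M.carrier K)).Nonempty :=
  interior_simplex_nonempty _

lemma frontier_subset_carrier (K : ι) : frontier (M.carrier K) ⊆ M.carrier K :=
  (M.isCompact_carrier K).isClosed.frontier_subset

lemma carrier_subset_closure_interior (K : ι) : M.carrier K ⊆ closure (interior (M.carrier K)) := by
  rw [(M.convex_carrier K).closure_interior_eq_closure_of_nonempty_interior
    (M.interior_carrier_nonempty K)]
  exact subset_closure

lemma disjoint_interior_carrier {K L : ι} (h : K ≠ L) :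
    Disjoint (interior (M.carrier K)) (M.carrier L) :=
  disjoint_interior_of_disjoint_interiors (M.carrier_subset_closure_interior L) isOpen_interior
    (M.disj h)

/-- A common point cannot be interior to either element, since each is the closure of its interior
and the interiors are disjoint. Interior faces are therefore intersections of closed elements, in
particular convex. -/
lemma frontier_inter_frontier {K L : ι} (h : K ≠ L) :
    frontier (M.carrier K) ∩ frontier (M.carrier L) = M.carrier K ∩ M.carrier L := by
  refine (Set.inter_subset_inter (M.frontier_subset_carrier K)
    (M.frontier_subset_carrier L)).antisymm fun x hx => ⟨⟨subset_closure hx.1, fun hi => ?_⟩,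
      subset_closure hx.2, fun hi => ?_⟩
  · exact (M.disjoint_interior_carrier h).ne_of_mem hi hx.2 rfl
  · exact (M.disjoint_interior_carrier h.symm).ne_of_mem hi hx.1 rfl

lemma hausdorff_inter_diff {K L : ι} (h : K ≠ L) : (μHE[m] : Measure (Space (m + 1)))
    ((M.carrier K ∩ M.carrier L) \ interior (M.carrier K ∪ M.carrier L)) = 0 :=
  hausdorff_inter_diff_interior_union (M.convex_carrier K) (M.convex_carrier L)
    (M.interior_carrier_nonempty K) (M.interior_carrier_nonempty L) (M.disj h)

/-- Almost every point of K ∩ L has a neighbourhood inside K ∪ L. A third element through such a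
point would have interior points in K or in L. -/
lemma hausdorff_inter_inter {K L N : ι} (hKL : K ≠ L) (hKN : K ≠ N) (hLN : L ≠ N) :
    (μHE[m] : Measure (Space (m + 1))) (M.carrier K ∩ M.carrier L ∩ M.carrier N) = 0 := by
  refine measure_mono_null ?_ (M.hausdorff_inter_diff hKL)
  rintro x ⟨hx, hxN⟩
  refine ⟨hx, fun hi => ?_⟩
  obtain ⟨y, hyi, hyN⟩ := mem_closure_iff.mp (M.carrier_subset_closure_interior N hxN) _
    isOpen_interior hi
  rcases interior_subset hyi with hy | hy
  · exact (M.disjoint_interior_carrier hKN.symm).ne_of_mem hyN hy rfl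
  · exact (M.disjoint_interior_carrier hLN.symm).ne_of_mem hyN hy rfl

lemma carrier_subset_closure (K : ι) : M.carrier K ⊆ closure Ω := by
  rw [← M.cover]; exact Set.subset_iUnion (fun K => M.carrier K) K

/-- Almost every point of K ∩ L is interior to K ∪ L ⊆ closure Ω, and the interior of closure Ω is Ω
by `hΩ`. Such a point is not on the frontier. -/
lemma hausdorff_inter_frontier (hΩ : interior (closure Ω) = Ω) {K L : ι} (hKL : K ≠ L) :
    (μHE[m] : Measure (Space (m + 1))) (M.carrier K ∩ M.carrier L ∩ frontier Ω) = 0 := by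
  refine measure_mono_null ?_ (M.hausdorff_inter_diff hKL)
  rintro x ⟨hx, hxΩ⟩
  refine ⟨hx, fun hi => hxΩ.2 ?_⟩
  have := interior_mono (Set.union_subset (M.carrier_subset_closure K)
    (M.carrier_subset_closure L)) hi
  rw [hΩ] at this
  rwa [← hΩ, isOpen_interior.interior_eq, hΩ]

lemma mem_interiorFaces {F : Set (Space (m + 1))} : F ∈ M.interiorFaces ↔
    (μHE[m] : Measure (Space (m + 1))) F ≠ 0 ∧
      ∃ K L, K ≠ L ∧ F = M.carrier K ∩ M.carrier L := by
  classical
  simp only [interiorFaces, Finset.mem_filter, Finset.mem_image, Finset.mem_univ, true_and,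
    Prod.exists]
  constructor
  · rintro ⟨⟨K, L, rfl⟩, h⟩
    change (μHE[m] : Measure (Space (m + 1))) _ ≠ 0 at h
    refine ⟨h, K, L, ?_⟩
    by_cases hKL : K = L
    · simp [hKL] at h
    · exact ⟨hKL, by rw [if_neg hKL, M.frontier_inter_frontier hKL]⟩
  · rintro ⟨h, K, L, hKL, rfl⟩
    exact ⟨⟨K, L, by rw [if_neg hKL, M.frontier_inter_frontier hKL]⟩, h⟩

lemma mem_boundaryFaces {F : Set (Space (m + 1))} : F ∈ M.boundaryFaces ↔
    (μHE[m] : Measure (Space (m + 1))) F ≠ 0 ∧ ∃ K i, F = M.facet K i ∩ frontier Ω := by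
  classical
  simp only [boundaryFaces, Finset.mem_filter, Finset.mem_image, Finset.mem_univ, true_and,
    Prod.exists]
  constructor
  · rintro ⟨⟨K, i, rfl⟩, h⟩
    exact ⟨h, K, i, rfl⟩
  · rintro ⟨h, K, i, rfl⟩
    exact ⟨⟨K, i, rfl⟩, h⟩

lemma facet_subset_frontier (K : ι) (i : Fin (m + 2)) : M.facet K i ⊆ frontier (M.carrier K) := by
  rw [carrier, frontier_simplex]; exact Set.subset_iUnion_of_subset i subset_rfl

lemma isCompact_facet (K : ι) (i : Fin (m + 2)) : IsCompact (M.facet K i) :=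
  ((Set.toFinite _).image _).isCompact_convexHull (𝕜 := ℝ)

/-- An interior face has exactly two neighbours, because triple intersections are null. In `faceInt`
it is thus counted exactly twice, even with hanging nodes. -/
lemma subset_frontier_iff {F : Set (Space (m + 1))}
    (hF : (μHE[m] : Measure (Space (m + 1))) F ≠ 0) {K L : ι} (hKL : K ≠ L)
    (hFKL : F = M.carrier K ∩ M.carrier L) (N : ι) :
    F ⊆ frontier (M.carrier N) ↔ N = K ∨ N = L := by
  constructor
  · intro h
    by_contra! hN
    refine hF (measure_mono_null (by exact fun x hx => ⟨hFKL ▸ hx, M.frontier_subset_carrier N (h hx)⟩)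
      (M.hausdorff_inter_inter hKL hN.1.symm hN.2.symm))
  · rw [hFKL, ← M.frontier_inter_frontier hKL]
    rintro (rfl | rfl)
    · exact Set.inter_subset_left
    · exact Set.inter_subset_right

/-- A face shared by two elements and contained in ∂Ω would be null, so in `faceInt` a boundary face
is counted once. -/
lemma eq_of_facet_subset (hΩ : interior (closure Ω) = Ω) {F : Set (Space (m + 1))}
    (hF : (μHE[m] : Measure (Space (m + 1))) F ≠ 0) {K N : ι} {i : Fin (m + 2)}
    (hFK : F = M.facet K i ∩ frontier Ω) (h : F ⊆ frontier (M.carrier N)) : N = K := by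
  by_contra hNK
  refine hF (measure_mono_null ?_ (M.hausdorff_inter_frontier hΩ hNK))
  intro x hx
  have hx' := hFK ▸ hx
  exact ⟨⟨M.frontier_subset_carrier N (h hx),
    M.frontier_subset_carrier K (M.facet_subset_frontier K i hx'.1)⟩, hx'.2⟩

lemma disjoint_faces (hΩ : interior (closure Ω) = Ω) :
    Disjoint M.interiorFaces M.boundaryFaces := by
  rw [Finset.disjoint_left]
  intro F hI hB
  obtain ⟨h0, K, L, hKL, rfl⟩ := M.mem_interiorFaces.mp hI
  obtain ⟨-, N, i, hN⟩ := M.mem_boundaryFaces.mp hB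
  refine h0 (measure_mono_null ?_ (M.hausdorff_inter_frontier hΩ hKL))
  intro x hx
  exact ⟨hx, by rw [hN] at hx; exact hx.2⟩

lemma mem_faces {F : Set (Space (m + 1))} :
    F ∈ M.faces ↔ F ∈ M.interiorFaces ∨ F ∈ M.boundaryFaces := by
  classical
  exact Finset.mem_union

lemma isCompact_face {F : Set (Space (m + 1))} (hF : F ∈ M.faces) : IsCompact F := by
  rcases M.mem_faces.mp hF with h | h
  · obtain ⟨-, K, L, -, rfl⟩ := M.mem_interiorFaces.mp h
    exact (M.isCompact_carrier K).inter (M.isCompact_carrier L)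
  · obtain ⟨-, K, i, rfl⟩ := M.mem_boundaryFaces.mp h
    exact (M.isCompact_facet K i).inter_right isClosed_frontier

lemma hausdorff_face_ne_zero {F : Set (Space (m + 1))} (hF : F ∈ M.faces) :
    (μHE[m] : Measure (Space (m + 1))) F ≠ 0 := by
  rcases M.mem_faces.mp hF with h | h
  · exact (M.mem_interiorFaces.mp h).1
  · exact (M.mem_boundaryFaces.mp h).1

lemma face_nonempty {F : Set (Space (m + 1))} (hF : F ∈ M.faces) : F.Nonempty :=
  nonempty_of_measure_ne_zero (M.hausdorff_face_ne_zero hF)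

/-- The default value 0 of `normal` never occurs. An interior face is convex and is separated from
the interior of K by Hahn–Banach. A boundary face need not be convex, so the facet that contains it
is separated instead. -/
lemma normal_spec (hΩ : interior (closure Ω) = Ω) {F : Set (Space (m + 1))} (hF : F ∈ M.faces)
    {K : ι} (hFK : F ⊆ frontier (M.carrier K)) :
    ‖M.normal K F‖ = 1 ∧ ∀ x ∈ F, ∀ y ∈ M.carrier K, inner ℝ (M.normal K F) (y - x) ≤ 0 := by
  have hex : ∃ n : Space (m + 1), ‖n‖ = 1 ∧
      ∀ x ∈ F, ∀ y ∈ M.carrier K, inner ℝ n (y - x) ≤ 0 := by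
    have hne := M.face_nonempty hF
    have hdisj : ∀ C ⊆ frontier (M.carrier K), Disjoint (interior (M.carrier K)) C := fun C hC =>
      (disjoint_interior_frontier).mono_right hC
    rcases M.mem_faces.mp hF with h | h
    · obtain ⟨-, A, B, hAB, rfl⟩ := M.mem_interiorFaces.mp h
      exact exists_unit_normal (M.convex_carrier K) (M.interior_carrier_nonempty K)
        ((M.convex_carrier A).inter (M.convex_carrier B)) hne (hdisj _ hFK)
    · obtain ⟨h0, A, i, hFA⟩ := M.mem_boundaryFaces.mp h
      obtain rfl := M.eq_of_facet_subset hΩ h0 hFA hFK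
      have hsub : F ⊆ M.facet K i := hFA ▸ Set.inter_subset_left
      obtain ⟨n, h1, h2⟩ := exists_unit_normal (M.convex_carrier K)
        (M.interior_carrier_nonempty K) (convex_convexHull ℝ _) (hne.mono hsub)
        (hdisj _ (M.facet_subset_frontier K i))
      exact ⟨n, h1, fun x hx => h2 x (hsub hx)⟩
  rw [normal, dif_pos hex]
  exact hex.choose_spec

/-- Every face lies in a hyperplane orthogonal to the normal. -/
lemma inner_normal_eq (hΩ : interior (closure Ω) = Ω) {F : Set (Space (m + 1))} (hF : F ∈ M.faces)
    {K : ι} (hFK : F ⊆ frontier (M.carrier K)) {x y : Space (m + 1)} (hx : x ∈ F) (hy : y ∈ F) :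
    inner ℝ (M.normal K F) x = inner ℝ (M.normal K F) y := by
  have h := (M.normal_spec hΩ hF hFK).2
  have h1 := h x hx y (M.frontier_subset_carrier K (hFK hy))
  have h2 := h y hy x (M.frontier_subset_carrier K (hFK hx))
  rw [inner_sub_right] at h1 h2
  linarith

lemma hausdorff_face_lt_top (hΩ : interior (closure Ω) = Ω) {F : Set (Space (m + 1))}
    (hF : F ∈ M.faces) {K : ι} (hFK : F ⊆ frontier (M.carrier K)) :
    (μHE[m] : Measure (Space (m + 1))) F < ⊤ :=
  hausdorff_flat_lt_top (M.normal_spec hΩ hF hFK).1 (M.isCompact_face hF)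
    fun _ hx => M.inner_normal_eq hΩ hF hFK hx (M.face_nonempty hF).some_mem

open Classical in
/-- The faces on the boundary of an element. -/
def elemFaces (K : ι) : Finset (Set (Space (m + 1))) :=
  M.faces.filter fun F => F ⊆ frontier (M.carrier K)

lemma mem_elemFaces {K : ι} {F : Set (Space (m + 1))} :
    F ∈ M.elemFaces K ↔ F ∈ M.faces ∧ F ⊆ frontier (M.carrier K) := by
  simp [elemFaces]

open Classical in
/-- The faces on the boundary of an element make up its boundary. -/
lemma flatBoundary (hΩ : interior (closure Ω) = Ω) (K : ι) :
    FlatBoundary (M.carrier K) (M.elemFaces K) (M.normal K)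
      (fun F => if h : F.Nonempty then inner ℝ (M.normal K F) h.some else 0) where
  subset F hF := (M.mem_elemFaces.mp hF).2
  compact F hF := M.isCompact_face (M.mem_elemFaces.mp hF).1
  unit F hF := (M.normal_spec hΩ (M.mem_elemFaces.mp hF).1 (M.mem_elemFaces.mp hF).2).1
  flat F hF x hx := by
    obtain ⟨h1, h2⟩ := M.mem_elemFaces.mp hF
    rw [dif_pos ⟨x, hx⟩]
    exact M.inner_normal_eq hΩ h1 h2 hx (Set.Nonempty.some_mem _)
  support F hF hne y hy := by
    obtain ⟨h1, h2⟩ := M.mem_elemFaces.mp hF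
    have := (M.normal_spec hΩ h1 h2).2 _ hne.some_mem y hy
    rw [inner_sub_right] at this
    rw [dif_pos hne]
    linarith
  cover := by
    -- A boundary point of K lies on ∂Ω, hence on a piece facet ∩ ∂Ω, or belongs to another element.
    -- If it is on no face, the corresponding piece was left out of the faces, which happens only
    -- for null pieces; there are finitely many of them.
    have hsub : frontier (M.carrier K) \ ⋃ F ∈ M.elemFaces K, F ⊆
        (⋃ i, if (μHE[m] : Measure (Space (m + 1))) (M.facet K i ∩ frontier Ω) = 0
          then M.facet K i ∩ frontier Ω else ∅) ∪
        ⋃ L, if (μHE[m] : Measure (Space (m + 1))) (M.carrier K ∩ M.carrier L) = 0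
          then M.carrier K ∩ M.carrier L else ∅ := by
      rintro x ⟨hx, hxF⟩
      have hnot : ∀ F, F ∈ M.faces → F ⊆ frontier (M.carrier K) → x ∉ F := fun F h1 h2 h3 =>
        hxF (Set.mem_biUnion (M.mem_elemFaces.mpr ⟨h1, h2⟩) h3)
      have hxK := M.frontier_subset_carrier K hx
      by_cases hxΩ : x ∈ frontier Ω
      · left
        have hx' := hx
        rw [carrier, frontier_simplex] at hx'
        obtain ⟨i, hi⟩ := Set.mem_iUnion.mp hx'
        refine Set.mem_iUnion.mpr ⟨i, ?_⟩
        by_cases h0 : (μHE[m] : Measure (Space (m + 1))) (M.facet K i ∩ frontier Ω) = 0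
        · rw [if_pos h0]; exact ⟨hi, hxΩ⟩
        · exact absurd ⟨hi, hxΩ⟩ (hnot _ (M.mem_faces.mpr (Or.inr
            (M.mem_boundaryFaces.mpr ⟨h0, K, i, rfl⟩)))
            (Set.inter_subset_left.trans (M.facet_subset_frontier K i)))
      · right
        have hxi : x ∈ interior (closure Ω) := by
          have h1 : x ∈ closure Ω := M.carrier_subset_closure K hxK
          have h2 : x ∈ interior Ω := by by_contra h; exact hxΩ ⟨h1, h⟩
          exact interior_mono subset_closure h2
        -- If no other element contained x, closedness would leave K as the only element near x, and
        -- x would be interior to K.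
        obtain ⟨L, hLK, hxL⟩ : ∃ L, L ≠ K ∧ x ∈ M.carrier L := by
          by_contra! hc
          apply hx.2
          have hcl : IsClosed (⋃ L ∈ {L | L ≠ K}, M.carrier L) :=
            (Set.toFinite _).isClosed_biUnion fun L _ => (M.isCompact_carrier L).isClosed
          have hxc : x ∉ ⋃ L ∈ {L | L ≠ K}, M.carrier L := by simpa using hc
          refine mem_interior_iff_mem_nhds.mpr ?_
          filter_upwards [hcl.isOpen_compl.mem_nhds hxc, mem_interior_iff_mem_nhds.mp hxi]
            with y hy1 hy2
          rw [← M.cover] at hy2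
          obtain ⟨L, hL⟩ := Set.mem_iUnion.mp hy2
          by_cases hLK : L = K
          · rw [← hLK]; exact hL
          · exact absurd (Set.mem_biUnion (s := {L | L ≠ K}) (t := M.carrier) hLK hL) hy1
        refine Set.mem_iUnion.mpr ⟨L, ?_⟩
        by_cases h0 : (μHE[m] : Measure (Space (m + 1))) (M.carrier K ∩ M.carrier L) = 0
        · rw [if_pos h0]; exact ⟨hxK, hxL⟩
        · exact absurd ⟨hxK, hxL⟩ (hnot _ (M.mem_faces.mpr (Or.inl
            (M.mem_interiorFaces.mpr ⟨h0, K, L, hLK.symm, rfl⟩)))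
            ((M.subset_frontier_iff h0 hLK.symm rfl K).mpr (Or.inl rfl)))
    refine measure_mono_null hsub (measure_union_null (measure_iUnion_null fun i => ?_)
      (measure_iUnion_null fun L => ?_)) <;> split_ifs with h <;> simp [h]
  overlap F hF F' hF' hne := by
    obtain ⟨h1, h2⟩ := M.mem_elemFaces.mp hF
    obtain ⟨h1', h2'⟩ := M.mem_elemFaces.mp hF'
    have hint : ∀ {F}, F ∈ M.interiorFaces → F ⊆ frontier (M.carrier K) →
        ∃ L, K ≠ L ∧ F = M.carrier K ∩ M.carrier L := by
      intro F hF hFK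
      obtain ⟨h0, A, B, hAB, hFAB⟩ := M.mem_interiorFaces.mp hF
      rcases (M.subset_frontier_iff h0 hAB hFAB K).mp hFK with rfl | rfl
      · exact ⟨B, hAB, hFAB⟩
      · exact ⟨A, hAB.symm, by rw [hFAB, Set.inter_comm]⟩
    have hbd : ∀ {F}, F ∈ M.boundaryFaces → F ⊆ frontier (M.carrier K) →
        ∃ i, F = M.facet K i ∩ frontier Ω := by
      intro F hF hFK
      obtain ⟨h0, A, i, hFA⟩ := M.mem_boundaryFaces.mp hF
      obtain rfl := M.eq_of_facet_subset hΩ h0 hFA hFK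
      exact ⟨i, hFA⟩
    rcases M.mem_faces.mp h1 with hI | hB <;> rcases M.mem_faces.mp h1' with hI' | hB'
    · obtain ⟨L, hL, rfl⟩ := hint hI h2
      obtain ⟨L', hL', rfl⟩ := hint hI' h2'
      have hLL : L ≠ L' := fun h => hne (by rw [h])
      exact measure_mono_null (by exact fun x hx => ⟨hx.1, hx.2.2⟩) (M.hausdorff_inter_inter hL hL' hLL)
    · obtain ⟨L, hL, rfl⟩ := hint hI h2
      obtain ⟨i, rfl⟩ := hbd hB' h2'
      exact measure_mono_null (by exact fun x hx => ⟨hx.1, hx.2.2⟩) (M.hausdorff_inter_frontier hΩ hL)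
    · obtain ⟨L, hL, rfl⟩ := hint hI' h2'
      obtain ⟨i, rfl⟩ := hbd hB h2
      exact measure_mono_null (by exact fun x hx => ⟨hx.2, hx.1.2⟩) (M.hausdorff_inter_frontier hΩ hL)
    · obtain ⟨i, rfl⟩ := hbd hB h2
      obtain ⟨i', rfl⟩ := hbd hB' h2'
      have hii : i ≠ i' := fun h => hne (by rw [h])
      exact measure_mono_null (by exact fun x hx => ⟨hx.1.1, hx.2.1⟩)
        (hausdorff_facet_inter (M.elem K) hii)

/-- The two normals on an interior face are opposite. -/
lemma normal_eq_neg (hΩ : interior (closure Ω) = Ω) {K L : ι} (hKL : K ≠ L)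
    (h0 : (μHE[m] : Measure (Space (m + 1))) (M.carrier K ∩ M.carrier L) ≠ 0) :
    M.normal L (M.carrier K ∩ M.carrier L) = -M.normal K (M.carrier K ∩ M.carrier L) := by
  set F := M.carrier K ∩ M.carrier L with hFdef
  have hF : F ∈ M.faces := M.mem_faces.mpr (Or.inl (M.mem_interiorFaces.mpr ⟨h0, K, L, hKL, rfl⟩))
  have hn := M.normal_spec hΩ hF ((M.subset_frontier_iff h0 hKL rfl K).mpr (Or.inl rfl))
  have hn' := M.normal_spec hΩ hF ((M.subset_frontier_iff h0 hKL rfl L).mpr (Or.inr rfl))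
  set n := M.normal K F
  set n' := M.normal L F
  obtain ⟨x, hx, hxi⟩ : ∃ x ∈ F, x ∈ interior (M.carrier K ∪ M.carrier L) := by
    by_contra! hc
    exact h0 (measure_mono_null (by exact fun x hx => ⟨hx, hc x hx⟩) (M.hausdorff_inter_diff hKL))
  -- A small step from x along n + n' lands in K or in L. The supporting inequality of that element
  -- gives 1 + n·n' ≤ 0 in either case, which forces |n + n'|² ≤ 0.
  have hinner : inner ℝ n n' ≤ -1 := by
    have hc : Filter.Tendsto (fun ε : ℝ => x + ε • (n + n')) (nhdsWithin 0 (Set.Ioi 0))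
        (nhds x) := by
      have : Continuous fun ε : ℝ => x + ε • (n + n') := by fun_prop
      simpa using (this.tendsto 0).mono_left nhdsWithin_le_nhds
    obtain ⟨ε, hε, hpos⟩ := ((hc.eventually (mem_interior_iff_mem_nhds.mp hxi)).and
      self_mem_nhdsWithin).exists
    have hpos' : (0 : ℝ) < ε := hpos
    rcases hε with h | h
    · have := hn.2 x hx _ h
      rw [add_sub_cancel_left, inner_smul_right, inner_add_right, real_inner_self_eq_norm_sq,
        hn.1] at this
      have := nonpos_of_mul_nonpos_right this hpos'
      linarith
    · have := hn'.2 x hx _ h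
      rw [add_sub_cancel_left, inner_smul_right, inner_add_right, real_inner_self_eq_norm_sq,
        hn'.1, real_inner_comm] at this
      have := nonpos_of_mul_nonpos_right this hpos'
      linarith
  have hsq : ‖n + n'‖ ^ 2 ≤ 0 := by
    rw [norm_add_sq_real, hn.1, hn'.1]; linarith
  have : n + n' = 0 := by
    rw [← norm_eq_zero]; exact pow_eq_zero_iff two_ne_zero |>.mp (le_antisymm hsq (sq_nonneg _))
  exact eq_neg_of_add_eq_zero_right this

end Mesh
end HDG

end

noncomputable section
namespace HDG

/-! ### Entropy variables -/

section EntropyVariables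
variable {d : ℕ} (g : PerfectGas)

lemma dotProduct_vars (a b : State d) :
    a ⬝ᵥ b = fstVar a * fstVar b + (∑ j, midVar a j * midVar b j) + lastVar a * lastVar b := by
  rw [dotProduct, Fin.sum_univ_succ, Fin.sum_univ_castSucc, ← add_assoc]
  rfl

/-- Density as a function of the entropy variables. -/
def rhoV (v : State d) : ℝ :=
  Real.exp (-(g.γ - fstVar v + (∑ j, midVar v j ^ 2) / (2 * lastVar v) + g.s₀
    + Real.log (-lastVar v / (g.γ - 1))) / (g.γ - 1))

/-- Velocity as a function of the entropy variables. -/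
def velV (v : State d) (j : Fin d) : ℝ := -midVar v j / lastVar v

/-- Pressure as a function of the entropy variables. -/
def presV (v : State d) : ℝ := -((g.γ - 1) * rhoV g v / lastVar v)

lemma gamma_pos : 0 < g.γ - 1 := sub_pos.mpr g.one_lt_γ

lemma rhoV_pos (v : State d) : 0 < rhoV g v := Real.exp_pos _

lemma presV_pos {v : State d} (hv : lastVar v < 0) : 0 < presV g v := by
  rw [presV, ← div_neg]
  exact div_pos (mul_pos (gamma_pos g) (rhoV_pos g v)) (by linarith)

lemma fstVar_consVars (v : State d) : fstVar (consVars g v) = rhoV g v := rfl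

lemma midVar_consVars (v : State d) (j : Fin d) :
    midVar (consVars g v) j = rhoV g v * velV v j := by
  simp only [consVars, midVar_mkState]; rfl

lemma lastVar_consVars {v : State d} (hv : lastVar v < 0) : lastVar (consVars g v)
    = presV g v / (g.γ - 1) + rhoV g v * (∑ j, velV v j ^ 2) / 2 := by
  have h : lastVar (consVars g v) = rhoV g v / (-lastVar v / (g.γ - 1)) / (g.γ - 1)
    + rhoV g v * (∑ j, velV v j ^ 2) / 2 := by simp only [consVars, lastVar_mkState]; rfl
  rw [h, presV]
  have := (gamma_pos g).ne'
  have := hv.ne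
  field_simp

lemma velocity_consVars (v : State d) (j : Fin d) : velocity (consVars g v) j = velV v j := by
  rw [velocity, midVar_consVars, fstVar_consVars, mul_div_cancel_left₀ _ (rhoV_pos g v).ne']

lemma pressure_consVars {v : State d} (hv : lastVar v < 0) :
    pressure g (consVars g v) = presV g v := by
  rw [pressure, lastVar_consVars g hv, fstVar_consVars]
  simp only [velocity_consVars]
  have := (gamma_pos g).ne'
  field_simp
  ring

lemma consVars_mem_physU {v : State d} (hv : lastVar v < 0) : consVars g v ∈ physU g :=
  ⟨rhoV_pos g v, by rw [pressure_consVars g hv]; exact presV_pos g hv⟩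

lemma thermoEntropy_consVars {v : State d} (hv : lastVar v < 0) :
    thermoEntropy g (consVars g v)
      = g.γ - fstVar v + (∑ j, midVar v j ^ 2) / (2 * lastVar v) := by
  have hb : 0 < -lastVar v / (g.γ - 1) := div_pos (by linarith) (gamma_pos g)
  have hp : presV g v = rhoV g v / (-lastVar v / (g.γ - 1)) := by
    rw [presV]; have := (gamma_pos g).ne'; have := hv.ne; field_simp
  rw [thermoEntropy, pressure_consVars g hv, fstVar_consVars,
    Real.log_div (presV_pos g hv).ne' (Real.rpow_pos_of_pos (rhoV_pos g v) _).ne',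
    Real.log_rpow (rhoV_pos g v), hp, Real.log_div (rhoV_pos g v).ne' hb.ne', rhoV, Real.log_exp]
  have := (gamma_pos g).ne'
  field_simp
  ring

/-- `v(u(v)) = v`. -/
lemma entropyVars_consVars {v : State d} (hv : lastVar v < 0) :
    entropyVars g (consVars g v) = v := by
  have hγ := (gamma_pos g).ne'
  have hv' := hv.ne
  have hρ := (rhoV_pos g v).ne'
  have hp := (presV_pos g hv).ne'
  suffices h : fstVar (entropyVars g (consVars g v)) = fstVar v ∧
      midVar (entropyVars g (consVars g v)) = midVar v ∧
      lastVar (entropyVars g (consVars g v)) = lastVar v by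
    rw [← mkState_vars (entropyVars g (consVars g v)), h.1, h.2.1, h.2.2, mkState_vars]
  refine ⟨?_, ?_, ?_⟩
  · rw [entropyVars, fstVar_smul, fstVar_mkState, thermoEntropy_consVars g hv,
      pressure_consVars g hv, lastVar_consVars g hv]
    have hsum : ∑ j, velV v j ^ 2 = (∑ j, midVar v j ^ 2) / lastVar v ^ 2 := by
      rw [Finset.sum_div]
      exact Finset.sum_congr rfl fun j _ => by rw [velV]; field_simp
    rw [hsum, presV]
    field_simp
    ring
  · funext j
    rw [entropyVars, midVar_smul, midVar_mkState, pressure_consVars g hv, fstVar_consVars,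
      velocity_consVars, presV, velV]
    field_simp
  · rw [entropyVars, lastVar_smul, lastVar_mkState, pressure_consVars g hv, fstVar_consVars, presV]
    field_simp

/-- The only constraint is the sign of v_m = -(γ-1)ρ/p, since the remaining entries are
unrestricted. The physical set is an open half-space, hence convex, so the segments between physical
states stay physical. -/
lemma physV_eq : (physV g : Set (State d)) = {v | lastVar v < 0} := by
  ext v
  constructor
  · rintro ⟨u, ⟨hρ, hp⟩, rfl⟩
    simp only [Set.mem_ofPred_eq, entropyVars, lastVar_smul, lastVar_mkState]
    have : 0 < fstVar u / pressure g u := div_pos hρ hp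
    rw [neg_div]
    nlinarith [gamma_pos g]
  · intro hv
    exact ⟨_, consVars_mem_physU g hv, entropyVars_consVars g hv⟩

lemma mem_physV {v : State d} : v ∈ physV g ↔ lastVar v < 0 := by rw [physV_eq]; rfl

lemma isOpen_physV : IsOpen (physV g : Set (State d)) := by
  rw [physV_eq]
  exact isOpen_lt (continuous_apply _) continuous_const

lemma convex_physV : Convex ℝ (physV g : Set (State d)) := by
  rw [physV_eq]
  exact convex_halfSpace_lt (IsLinearMap.mk (fun _ _ => rfl) fun _ _ => rfl) 0

lemma path_mem_physV {v w : State d} (hv : v ∈ physV g) (hw : w ∈ physV g) {θ : ℝ}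
    (hθ : θ ∈ Set.Icc (0 : ℝ) 1) : path θ v w ∈ physV g :=
  (convex_physV g).add_smul_sub_mem hv hw hθ

lemma consVars_mem {v : State d} (hv : v ∈ physV g) : consVars g v ∈ physU g :=
  consVars_mem_physU g ((mem_physV g).mp hv)

/-! #### Legendre duality -/

/-- The Legendre transform of H is (γ-1)ρ. Its derivative in v is u (`hasDerivAt_rhoV`), from which
∂H/∂u = v is recovered in `hasDerivAt_genEntropy`. -/
lemma dotProduct_consVars {u : State d} (hu : u ∈ physU g) :
    entropyVars g u ⬝ᵥ u = genEntropy g u + (g.γ - 1) * fstVar u := by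
  obtain ⟨hρ, hp⟩ := hu
  have hγ := (gamma_pos g).ne'
  have hE : lastVar u = pressure g u / (g.γ - 1)
      + fstVar u * (∑ j, velocity u j ^ 2) / 2 := by
    rw [pressure]; field_simp; ring
  have hmid : ∑ j, midVar (entropyVars g u) j * midVar u j
      = (g.γ - 1) * fstVar u ^ 2 / pressure g u * ∑ j, velocity u j ^ 2 := by
    rw [Finset.mul_sum]
    refine Finset.sum_congr rfl fun j _ => ?_
    simp only [entropyVars, midVar_smul, midVar_mkState, velocity]
    field_simp
  rw [dotProduct_vars, hmid]
  simp only [entropyVars, fstVar_smul, fstVar_mkState, lastVar_smul, lastVar_mkState, genEntropy]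
  rw [hE]
  field_simp
  ring

lemma inviscidFlux_col (u : State d) (j : Fin d) : (fun i => inviscidFlux g u i j)
    = mkState (fstVar u * velocity u j)
      (fun l => fstVar u * velocity u l * velocity u j + if l = j then pressure g u else 0)
      (velocity u j * (lastVar u + pressure g u)) := rfl

/-- The flux column splits into convection and pressure work: F_j = V_j u + p (0, e_j, V_j). -/
lemma dotProduct_inviscidFlux_col {u : State d} (hu : fstVar u ≠ 0) (w : State d) (j : Fin d) :
    w ⬝ᵥ (fun i => inviscidFlux g u i j) = velocity u j * (w ⬝ᵥ u)
      + pressure g u * (midVar w j + lastVar w * velocity u j) := by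
  have hm : ∀ l, fstVar u * velocity u l = midVar u l := fun l => by
    rw [velocity]; field_simp
  have hm' := hm j
  rw [inviscidFlux_col, dotProduct_vars, dotProduct_vars]
  simp only [fstVar_mkState, midVar_mkState, lastVar_mkState, mul_add, Finset.sum_add_distrib,
    mul_ite, mul_zero, Finset.sum_ite_eq', Finset.mem_univ, if_true, Finset.mul_sum, hm]
  have : ∑ x, midVar w x * (midVar u x * velocity u j)
      = ∑ x, velocity u j * (midVar w x * midVar u x) :=
    Finset.sum_congr rfl fun _ _ => by ring
  rw [this, ← hm']
  ring

/-- `vᵗ F_j - 𝓕_j = (γ - 1) ρ V_j`. -/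
lemma entropyVars_dotProduct_flux {u : State d} (hu : u ∈ physU g) (j : Fin d) :
    entropyVars g u ⬝ᵥ (fun i => inviscidFlux g u i j)
      = entropyFlux g u j + (g.γ - 1) * midVar u j := by
  have hp := hu.2.ne'
  have hρ := hu.1.ne'
  -- The pressure term drops out because the entropy variables satisfy v_j + v_m V_j = 0.
  rw [dotProduct_inviscidFlux_col g hρ, dotProduct_consVars g hu, entropyFlux]
  have hm : midVar u j = fstVar u * velocity u j := by
    rw [velocity]; field_simp
  rw [hm]
  simp only [entropyVars, midVar_smul, midVar_mkState, lastVar_smul, lastVar_mkState]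
  field_simp
  ring

/-! #### Derivatives along curves -/

section Curve
variable {v : ℝ → State d} {h : State d} {t : ℝ}

lemma hasDerivAt_fstVar (hv : HasDerivAt v h t) :
    HasDerivAt (fun τ => fstVar (v τ)) (fstVar h) t := (hasDerivAt_pi.mp hv) _

lemma hasDerivAt_midVar (hv : HasDerivAt v h t) (j : Fin d) :
    HasDerivAt (fun τ => midVar (v τ) j) (midVar h j) t := (hasDerivAt_pi.mp hv) _

lemma hasDerivAt_lastVar (hv : HasDerivAt v h t) :
    HasDerivAt (fun τ => lastVar (v τ)) (lastVar h) t := (hasDerivAt_pi.mp hv) _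

/-- `(γ - 1) ∂ρ/∂v = u`. -/
lemma hasDerivAt_rhoV (hv : HasDerivAt v h t) (hneg : lastVar (v t) < 0) :
    HasDerivAt (fun τ => rhoV g (v τ)) ((consVars g (v t) ⬝ᵥ h) / (g.γ - 1)) t := by
  have hγ := (gamma_pos g).ne'
  have hl := hneg.ne
  have h1 := hasDerivAt_fstVar hv
  have h2 : HasDerivAt (fun τ => ∑ j, midVar (v τ) j ^ 2)
      (∑ j, 2 * midVar (v t) j * midVar h j) t := by
    refine HasDerivAt.fun_sum fun j _ => ?_
    refine ((hasDerivAt_midVar hv j).fun_pow 2).congr_deriv ?_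
    simp
  have h3 := hasDerivAt_lastVar hv
  have hlog : HasDerivAt (fun τ => Real.log (-lastVar (v τ) / (g.γ - 1)))
      ((-lastVar h / (g.γ - 1)) / (-lastVar (v t) / (g.γ - 1))) t :=
    (h3.neg.div_const _).log (div_ne_zero (neg_ne_zero.mpr hl) hγ)
  have key := (((((h1.const_sub g.γ).add (h2.div (h3.const_mul 2)
    (mul_ne_zero two_ne_zero hl))).add_const g.s₀).add hlog).neg.div_const (g.γ - 1)).exp
  refine key.congr_deriv ?_
  have hs1 : ∑ j, 2 * midVar (v t) j * midVar h j = 2 * ∑ j, midVar (v t) j * midVar h j := by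
    rw [Finset.mul_sum]; exact Finset.sum_congr rfl fun _ _ => by ring
  have hs2 : ∑ j, rhoV g (v t) * velV (v t) j * midVar h j
      = -(rhoV g (v t) / lastVar (v t)) * ∑ j, midVar (v t) j * midVar h j := by
    rw [Finset.mul_sum]; exact Finset.sum_congr rfl fun _ _ => by rw [velV]; field_simp
  have hs3 : ∑ j, velV (v t) j ^ 2 = (∑ j, midVar (v t) j ^ 2) / lastVar (v t) ^ 2 := by
    rw [Finset.sum_div]
    exact Finset.sum_congr rfl fun j _ => by rw [velV]; field_simp
  rw [dotProduct_vars, fstVar_consVars, lastVar_consVars g hneg]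
  simp only [midVar_consVars]
  rw [hs1, hs2, hs3, presV]
  change rhoV g (v t) * _ = _
  field_simp
  ring

lemma hasDerivAt_velV (hv : HasDerivAt v h t) (hneg : lastVar (v t) < 0) (j : Fin d) :
    HasDerivAt (fun τ => velV (v τ) j)
      (-(midVar h j + velV (v t) j * lastVar h) / lastVar (v t)) t := by
  have hl := hneg.ne
  refine ((hasDerivAt_midVar hv j).neg.div (hasDerivAt_lastVar hv) hl).congr_deriv ?_
  rw [velV]; simp only [Pi.neg_apply]
  field_simp
  ring

/-- `∂ψ_j/∂v = F_j` for the potential `ψ_j = (γ - 1) ρ V_j`. -/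
lemma hasDerivAt_potential (hv : HasDerivAt v h t) (hneg : lastVar (v t) < 0) (j : Fin d) :
    HasDerivAt (fun τ => (g.γ - 1) * midVar (consVars g (v τ)) j)
      (h ⬝ᵥ fun i => inviscidFlux g (consVars g (v t)) i j) t := by
  have hγ := (gamma_pos g).ne'
  have hl := hneg.ne
  simp only [midVar_consVars]
  refine (((hasDerivAt_rhoV g hv hneg).mul (hasDerivAt_velV hv hneg j)).const_mul
    (g.γ - 1)).congr_deriv ?_
  -- Differentiating ρ gives the convective part V_j (u·h). Differentiating V_j gives the pressure
  -- part, since -(γ-1)ρ/v_m = p.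
  rw [dotProduct_inviscidFlux_col g (u := consVars g (v t)) (rhoV_pos g (v t)).ne', velocity_consVars,
    pressure_consVars g hneg, dotProduct_comm h, presV]
  field_simp

end Curve

/-! #### Smoothness -/

lemma contDiffAt_rhoV {v : State d} (hv : lastVar v < 0) : ContDiffAt ℝ 2 (rhoV g) v := by
  have hγ := (gamma_pos g).ne'
  have hl : v (Fin.last (d + 1)) ≠ 0 := hv.ne
  unfold rhoV fstVar midVar lastVar
  have h1 : ContDiffAt ℝ 2 (fun v : State d => Real.log (-v (Fin.last (d + 1)) / (g.γ - 1))) v :=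
    ContDiffAt.log (by fun_prop) (div_ne_zero (neg_ne_zero.mpr hl) hγ)
  have h2 : ContDiffAt ℝ 2 (fun v : State d => (∑ j : Fin d, v j.castSucc.succ ^ 2)
      / (2 * v (Fin.last (d + 1)))) v :=
    ContDiffAt.div (by fun_prop) (by fun_prop) (mul_ne_zero two_ne_zero hl)
  fun_prop

lemma contDiffAt_velV {v : State d} (hv : lastVar v < 0) (j : Fin d) :
    ContDiffAt ℝ 2 (fun v : State d => velV v j) v := by
  have hl : v (Fin.last (d + 1)) ≠ 0 := hv.ne
  unfold velV midVar lastVar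
  exact ContDiffAt.div (by fun_prop) (by fun_prop) hl

lemma contDiffAt_mkState {E : Type*} [NormedAddCommGroup E] [NormedSpace ℝ E] {n : WithTop ℕ∞}
    {x : E} {a b : E → ℝ} {w : E → Fin d → ℝ} (ha : ContDiffAt ℝ n a x)
    (hw : ∀ j, ContDiffAt ℝ n (fun y => w y j) x) (hb : ContDiffAt ℝ n b x) :
    ContDiffAt ℝ n (fun y => mkState (a y) (w y) (b y)) x := by
  refine contDiffAt_pi.mpr fun i => ?_
  refine Fin.cases (by simpa [mkState] using ha) (fun i => ?_) i
  refine Fin.lastCases ?_ (fun i => ?_) i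
  · simpa [mkState] using hb
  · simpa [mkState] using hw i

lemma consVars_eq {v : State d} (hv : lastVar v < 0) : consVars g v = mkState (rhoV g v)
    (fun j => rhoV g v * velV v j)
    (presV g v / (g.γ - 1) + rhoV g v * (∑ j, velV v j ^ 2) / 2) := by
  rw [← mkState_vars (consVars g v), fstVar_consVars, lastVar_consVars g hv]
  congr 1
  funext j
  exact midVar_consVars g v j

lemma eventually_lastVar_neg {v : State d} (hv : lastVar v < 0) :
    ∀ᶠ w in nhds v, lastVar w < 0 :=
  (isOpen_lt (continuous_apply (Fin.last (d + 1))) continuous_const).mem_nhds hv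

lemma contDiffAt_consVars {v : State d} (hv : lastVar v < 0) :
    ContDiffAt ℝ 2 (consVars g) v := by
  have h1 := contDiffAt_rhoV g hv
  have h2 := contDiffAt_velV hv
  have hl : v (Fin.last (d + 1)) ≠ 0 := hv.ne
  have h3 : ContDiffAt ℝ 2 (fun v : State d => presV g v) v := by
    unfold presV lastVar
    exact (ContDiffAt.div (contDiffAt_const.mul h1) (by fun_prop) hl).neg
  refine (contDiffAt_mkState h1 (fun j => h1.mul (h2 j)) ?_).congr_of_eventuallyEq
    ((eventually_lastVar_neg hv).mono fun w hw => consVars_eq g hw)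
  exact (h3.div_const _).add
    ((h1.mul (ContDiffAt.sum fun j _ => (h2 j).pow 2)).div_const _)

end EntropyVariables
end HDG

end

noncomputable section
namespace HDG

/-! ### Jacobians -/

section Jacobians
variable {d : ℕ} (g : PerfectGas)

lemma sum_apply_single {E F : Type*} [Fintype E] [DecidableEq E] [NormedAddCommGroup F]
    [NormedSpace ℝ F] (L : (E → ℝ) →L[ℝ] F) (h : E → ℝ) :
    ∑ s, h s • L (Pi.single s 1) = L h := by
  conv_rhs => rw [pi_eq_sum_univ' h]
  rw [map_sum]
  refine Finset.sum_congr rfl fun s _ => ?_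
  rw [← map_smul]

lemma differentiableAt_consVars {v : State d} (hv : v ∈ physV g) :
    DifferentiableAt ℝ (consVars g) v :=
  (contDiffAt_consVars g ((mem_physV g).mp hv)).differentiableAt two_ne_zero

lemma fderiv_component {E : Type*} [NormedAddCommGroup E] [NormedSpace ℝ E] {ι : Type*}
    [Fintype ι] {f : E → ι → ℝ} {x : E} (hf : DifferentiableAt ℝ f x) (l : ι) (h : E) :
    fderiv ℝ (fun y => f y l) x h = fderiv ℝ f x h l := by
  rw [fderiv_pi (differentiableAt_pi.mp hf)]
  rfl

lemma A0_mulVec {v : State d} (hv : v ∈ physV g) (h : State d) :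
    (A0 g v).mulVec h = fderiv ℝ (consVars g) v h := by
  have hd := differentiableAt_consVars g hv
  ext l
  rw [← fderiv_component hd, ← sum_apply_single]
  simp [Matrix.mulVec, dotProduct, A0, mul_comm]

lemma hasDerivAt_consVars {v : ℝ → State d} {h : State d} {t : ℝ} (hv : HasDerivAt v h t)
    (hp : v t ∈ physV g) :
    HasDerivAt (fun τ => consVars g (v τ)) ((A0 g (v t)).mulVec h) t := by
  rw [A0_mulVec g hp]
  exact (differentiableAt_consVars g hp).hasFDerivAt.comp_hasDerivAt t hv

lemma hasDerivAt_dotProduct {n : Type*} [Fintype n] {a b : ℝ → n → ℝ} {a' b' : n → ℝ} {t : ℝ}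
    (ha : HasDerivAt a a' t) (hb : HasDerivAt b b' t) :
    HasDerivAt (fun τ => a τ ⬝ᵥ b τ) (a' ⬝ᵥ b t + a t ⬝ᵥ b') t := by
  unfold dotProduct
  rw [← Finset.sum_add_distrib]
  exact HasDerivAt.fun_sum fun i _ => (hasDerivAt_pi.mp ha i).mul (hasDerivAt_pi.mp hb i)

/-- `∂H/∂u = v`. -/
lemma hasDerivAt_genEntropy {v : ℝ → State d} {h : State d} {t : ℝ} (hv : HasDerivAt v h t)
    (hp : v t ∈ physV g) : HasDerivAt (fun τ => genEntropy g (consVars g (v τ)))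
      (v t ⬝ᵥ (A0 g (v t)).mulVec h) t := by
  have hu := hasDerivAt_consVars g hv hp
  -- In the derivative of H = v·u - (γ-1)ρ the term h·u from the product rule cancels against the
  -- derivative of (γ-1)ρ, and v·∂u remains.
  have key := (hasDerivAt_dotProduct hv hu).sub
    ((hasDerivAt_rhoV g hv ((mem_physV g).mp hp)).const_mul (g.γ - 1))
  have hev : (fun τ => genEntropy g (consVars g (v τ))) =ᶠ[nhds t]
      (fun τ => v τ ⬝ᵥ consVars g (v τ)) - fun τ => (g.γ - 1) * rhoV g (v τ) := by
    filter_upwards [hv.continuousAt.eventually ((isOpen_physV g).mem_nhds hp)] with τ hτ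
    have h1 := dotProduct_consVars g (consVars_mem g hτ)
    rw [entropyVars_consVars g ((mem_physV g).mp hτ), fstVar_consVars] at h1
    simp only [Pi.sub_apply]
    linarith
  refine (key.congr_of_eventuallyEq hev).congr_deriv ?_
  have hγ := (gamma_pos g).ne'
  rw [dotProduct_comm h]
  field_simp
  ring

lemma continuousAt_fderiv_apply {E F : Type*} [NormedAddCommGroup E] [NormedSpace ℝ E]
    [NormedAddCommGroup F] [NormedSpace ℝ F] {f : E → F} {x : E} (hf : ContDiffAt ℝ 2 f x) (h : E) :
    ContinuousAt (fun y => fderiv ℝ f y h) x :=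
  ((hf.fderiv_right (m := 1) (by norm_num)).continuousAt).clm_apply continuousAt_const

lemma continuousOn_A0 (l s : Fin (d + 2)) : ContinuousOn (fun v => A0 g v l s) (physV g) := by
  intro v hv
  refine (continuousAt_fderiv_apply ?_ _).continuousWithinAt
  exact contDiffAt_pi.mp (contDiffAt_consVars g ((mem_physV g).mp hv)) l

lemma continuousOn_consVars : ContinuousOn (consVars g : State d → State d) (physV g) :=
  fun _ hv => (differentiableAt_consVars g hv).continuousAt.continuousWithinAt

/-! #### Functions of the conservation variables -/

section Cons
variable {u : State d}

lemma contDiffAt_velocity (hu : fstVar u ≠ 0) (j : Fin d) :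
    ContDiffAt ℝ 2 (fun u : State d => velocity u j) u := by
  have h : u 0 ≠ 0 := hu
  unfold velocity midVar fstVar
  exact ContDiffAt.div (by fun_prop) (by fun_prop) h

lemma contDiffAt_pressure (hu : fstVar u ≠ 0) :
    ContDiffAt ℝ 2 (fun u : State d => pressure g u) u := by
  have h := contDiffAt_velocity hu
  have hs : ContDiffAt ℝ 2 (fun u : State d => ∑ j, velocity u j ^ 2) u :=
    ContDiffAt.sum fun j _ => (h j).pow 2
  unfold pressure lastVar fstVar
  fun_prop

lemma contDiffAt_temperature (hu : fstVar u ≠ 0) :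
    ContDiffAt ℝ 2 (fun u : State d => temperature g u) u := by
  have h := contDiffAt_pressure g hu
  have h0 : u 0 ≠ 0 := hu
  unfold temperature fstVar
  exact h.div (by fun_prop) (mul_ne_zero (mul_ne_zero (gamma_pos g).ne' g.cv_pos.ne') h0)

lemma contDiffAt_inviscidFlux (hu : fstVar u ≠ 0) (i : Fin (d + 2)) (j : Fin d) :
    ContDiffAt ℝ 2 (fun u : State d => inviscidFlux g u i j) u := by
  have hv := contDiffAt_velocity hu
  have hp := contDiffAt_pressure g hu
  have hf : ContDiffAt ℝ 2 (fun u : State d => fstVar u) u := by unfold fstVar; fun_prop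
  have hl : ContDiffAt ℝ 2 (fun u : State d => lastVar u) u := by unfold lastVar; fun_prop
  refine contDiffAt_pi.mp (contDiffAt_mkState (hf.mul (hv j)) (fun l => ?_)
    ((hv j).mul (hl.add hp))) i
  split_ifs
  · exact ((hf.mul (hv l)).mul (hv j)).add hp
  · exact ((hf.mul (hv l)).mul (hv j)).add contDiffAt_const

end Cons

lemma continuousOn_inviscidFlux (i : Fin (d + 2)) (j : Fin d) :
    ContinuousOn (fun v => inviscidFlux g (consVars g v) i j) (physV g) := by
  refine ContinuousOn.comp (g := fun u => inviscidFlux g u i j) (t := physU g) ?_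
    (continuousOn_consVars g) fun v hv => consVars_mem g hv
  exact fun u hu => (contDiffAt_inviscidFlux g hu.1.ne' i j).continuousAt.continuousWithinAt

lemma continuousOn_An (n : Space d) (i l : Fin (d + 2)) :
    ContinuousOn (fun v => An g v n i l) (physV g) := by
  simp only [An, Matrix.of_apply]
  refine continuousOn_finsetSum _ fun j _ => ContinuousOn.mul ?_ continuousOn_const
  refine ContinuousOn.comp (g := fun u => fderiv ℝ (fun w => inviscidFlux g w i j) u
    (Pi.single l 1)) (t := physU g) ?_ (continuousOn_consVars g) fun v hv => consVars_mem g hv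
  exact fun u hu =>
    (continuousAt_fderiv_apply (contDiffAt_inviscidFlux g hu.1.ne' i j) _).continuousWithinAt

/-- The derivative of the normal flux along a curve of conservation variables. -/
lemma hasDerivAt_normalFlux {u : ℝ → State d} {h : State d} {t : ℝ} {v : State d} (n : Space d)
    (hu : HasDerivAt u h t) (hp : fstVar (u t) ≠ 0) (hv : consVars g v = u t) :
    HasDerivAt (fun τ => (inviscidFlux g (u τ)).mulVec (fun j => n j)) ((An g v n).mulVec h) t := by
  refine hasDerivAt_pi.mpr fun i => ?_
  have h1 : ∀ j, HasDerivAt (fun τ => inviscidFlux g (u τ) i j)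
      (fderiv ℝ (fun w => inviscidFlux g w i j) (u t) h) t := fun j =>
    ((contDiffAt_inviscidFlux g hp i j).differentiableAt two_ne_zero).hasFDerivAt.comp_hasDerivAt
      t hu
  have h2 := HasDerivAt.fun_sum (u := Finset.univ) fun j _ => (h1 j).mul_const (n j)
  refine h2.congr_deriv ?_
  simp only [Matrix.mulVec, dotProduct, An, Matrix.of_apply, hv, Finset.sum_mul]
  rw [Finset.sum_comm]
  refine Finset.sum_congr rfl fun j _ => ?_
  rw [← sum_apply_single, Finset.sum_mul]
  exact Finset.sum_congr rfl fun s _ => by simp; ring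

lemma entropyVars_differentiableAt {u : State d} (hu : u ∈ physU g) :
    DifferentiableAt ℝ (entropyVars g) u := by
  have hρ := hu.1.ne'
  have hp := hu.2.ne'
  have hv := contDiffAt_velocity hρ
  have hpr := contDiffAt_pressure g hρ
  have hf : ContDiffAt ℝ 2 (fun u : State d => fstVar u) u := by unfold fstVar; fun_prop
  have hl : ContDiffAt ℝ 2 (fun u : State d => lastVar u) u := by unfold lastVar; fun_prop
  have hs : ContDiffAt ℝ 2 (fun u : State d => thermoEntropy g u) u := by
    unfold thermoEntropy
    exact (ContDiffAt.log (hpr.div (hf.rpow_const_of_ne hρ) (Real.rpow_pos_of_pos hu.1 _).ne')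
      (div_ne_zero hp (Real.rpow_pos_of_pos hu.1 _).ne')).sub contDiffAt_const
  have h : ContDiffAt ℝ 2 (entropyVars g : State d → State d) u := by
    unfold entropyVars
    refine ContDiffAt.const_smul (𝕜 := ℝ) (F := State d) (g.γ - 1)
      (contDiffAt_mkState ?_ (fun j => ?_) ?_)
    · exact ((hs.neg.div_const _).add contDiffAt_const).sub (hl.div hpr hp)
    · exact (hf.mul (hv j)).div hpr hp
    · exact hf.neg.div hpr hp
  exact h.differentiableAt two_ne_zero

/-- By the chain rule applied to v(u(v)) = v, the derivative of `entropyVars` is a left inverse of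
Ã₀. -/
lemma isUnit_det_A0 {v : State d} (hv : v ∈ physV g) : IsUnit (A0 g v).det := by
  rw [← Matrix.isUnit_iff_isUnit_det, ← Matrix.mulVec_injective_iff_isUnit]
  intro h h' hh
  simp only [A0_mulVec g hv] at hh
  have h1 := HasFDerivAt.comp v (entropyVars_differentiableAt g (consVars_mem g hv)).hasFDerivAt
    (differentiableAt_consVars g hv).hasFDerivAt
  have h2 : HasFDerivAt (fun w => entropyVars g (consVars g w)) (ContinuousLinearMap.id ℝ (State d)) v := by
    refine (hasFDerivAt_id (𝕜 := ℝ) v).congr_of_eventuallyEq ?_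
    filter_upwards [(isOpen_physV g).mem_nhds hv] with w hw
    exact entropyVars_consVars g ((mem_physV g).mp hw)
  have h3 := h1.unique h2
  have h4 := congrArg (fun L : State d →L[ℝ] State d => L h) h3
  have h5 := congrArg (fun L : State d →L[ℝ] State d => L h') h3
  simp only [ContinuousLinearMap.comp_apply, ContinuousLinearMap.id_apply] at h4 h5
  rw [← h4, ← h5, hh]

/-! #### Viscous terms -/

section Viscous
variable {g} (vis : Viscosity g d)

lemma continuousOn_velocityGrad (D : Grad d) (i j : Fin d) :
    ContinuousOn (fun u => velocityGrad u D i j) (physU g) := fun _ hu =>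
  (continuousAt_fderiv_apply (contDiffAt_velocity hu.1.ne' i) _).continuousWithinAt

lemma continuousOn_stress (D : Grad d) (i j : Fin d) :
    ContinuousOn (fun u => stress vis u D i j) (physU g) := by
  have h := continuousOn_velocityGrad (g := g) D
  have h1 := vis.μ_cont
  have h2 := vis.β_cont
  have hs : ContinuousOn (fun u => ∑ k, velocityGrad u D k k) (physU g) :=
    continuousOn_finsetSum _ fun k _ => h k k
  unfold stress
  exact (h1.mul (((h i j).add (h j i)).sub ((continuousOn_const.mul hs).mul
    continuousOn_const))).add ((h2.mul hs).mul continuousOn_const)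

lemma continuousOn_viscMat (j k : Fin d) (i s : Fin (d + 2)) :
    ContinuousOn (fun v => viscMat vis (consVars g v) j k i s) (physV g) := by
  refine ContinuousOn.comp (g := fun u => viscMat vis u j k i s) (t := physU g) ?_
    (continuousOn_consVars g) fun v hv => consVars_mem g hv
  have hs := fun l => continuousOn_stress vis (Matrix.single s k 1) l j
  have hT : ContinuousOn (fun u => heatFlux vis u (Matrix.single s k 1) j) (physU g) := by
    unfold heatFlux conductivity temperatureGrad
    refine (((continuousOn_const.mul vis.μ_cont).div_const _).mul fun u hu => ?_).neg
    exact (continuousAt_fderiv_apply (contDiffAt_temperature g hu.1.ne') _).continuousWithinAt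
  have hE : ContinuousOn (fun u => (∑ l, velocity u l * stress vis u (Matrix.single s k 1) l j)
      - heatFlux vis u (Matrix.single s k 1) j) (physU g) := by
    refine (continuousOn_finsetSum _ fun l _ => ContinuousOn.mul (fun u hu => ?_) (hs l)).sub hT
    exact (contDiffAt_velocity hu.1.ne' l).continuousAt.continuousWithinAt
  simp only [viscMat, viscousFluxCons, Matrix.of_apply, neg_neg]
  refine Fin.cases ?_ (fun i => ?_) i
  · simpa [mkState] using continuousOn_const
  · refine Fin.lastCases ?_ (fun i => ?_) i
    · simpa [mkState] using hE
    · simpa [mkState] using hs i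

/-- `q : G = - qᵗ 𝒦̃ q`. -/
lemma frob_viscousFlux (v : State d) (q : Grad d) :
    frob q (viscousFlux vis v q) = -viscForm vis v q := by
  have h1 : frob q (viscousFlux vis v q) = ∑ i, ∑ j, q i j * viscousFlux vis v q i j := by
    rw [frob, Matrix.trace, Finset.sum_comm]
    simp [Matrix.mul_apply]
  rw [h1, viscForm, ← Finset.sum_neg_distrib]
  refine Finset.sum_congr rfl fun i _ => ?_
  rw [← Finset.sum_neg_distrib]
  refine Finset.sum_congr rfl fun j _ => ?_
  rw [viscousFlux, Matrix.of_apply, mul_neg, Finset.mul_sum, Finset.sum_comm]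
  congr 1
  refine Finset.sum_congr rfl fun k _ => ?_
  rw [Finset.sum_comm, Finset.mul_sum]
  refine Finset.sum_congr rfl fun s _ => ?_
  rw [viscMatV, Matrix.mul_apply]
  simp only [Finset.mul_sum, Finset.sum_mul, mul_assoc]

end Viscous

end Jacobians
end HDG

end

noncomputable section
namespace HDG

/-! ### Absolute values of the flux Jacobians -/

section Abs

lemma aeval_conj {n : Type*} [Fintype n] [DecidableEq n] {P : Matrix n n ℝ} (hP : IsUnit P.det)
    (A : Matrix n n ℝ) (p : Polynomial ℝ) :
    Polynomial.aeval (P⁻¹ * A * P) p = P⁻¹ * Polynomial.aeval A p * P := by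
  have hPP : P⁻¹ * P = 1 := Matrix.nonsing_inv_mul P hP
  have hPP' : P * P⁻¹ = 1 := Matrix.mul_nonsing_inv P hP
  induction p using Polynomial.induction_on' with
  | add p q hp hq => rw [map_add, hp, hq, map_add, mul_add, add_mul]
  | monomial k a =>
    have hpow : (P⁻¹ * A * P) ^ k = P⁻¹ * A ^ k * P := by
      induction k with
      | zero => simp [hPP]
      | succ k ih =>
        rw [pow_succ, ih, pow_succ]
        calc P⁻¹ * A ^ k * P * (P⁻¹ * A * P) = P⁻¹ * A ^ k * (P * P⁻¹) * A * P := by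
              simp only [mul_assoc]
          _ = _ := by rw [hPP', mul_one]; simp only [mul_assoc]
    rw [Polynomial.aeval_monomial, Polynomial.aeval_monomial, hpow,
      Algebra.algebraMap_eq_smul_one]
    simp

/-- The interpolating polynomial depends on the characteristic polynomial only, which similarity
preserves, and polynomials commute with conjugation. Diagonalizability is not needed. -/
lemma matAbs_conj {n : Type*} [Fintype n] [DecidableEq n] {P : Matrix n n ℝ}
    (hP : IsUnit P.det) (A : Matrix n n ℝ) :
    matAbs (P⁻¹ * A * P) = P⁻¹ * matAbs A * P := by
  have hchar : (P⁻¹ * A * P).charpoly = A.charpoly := by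
    rw [Matrix.charpoly_mul_comm, ← mul_assoc, Matrix.mul_nonsing_inv P hP, one_mul]
  rw [matAbs, hchar, aeval_conj hP, matAbs]

/-- The absolute value of a matrix whose eigenvalues are among `a - c`, `a` and `a + c`. -/
lemma matAbs_eq_of_cube {n : Type*} [Fintype n] [DecidableEq n] (A : Matrix n n ℝ) {a c : ℝ}
    (hc : 0 < c) (h : (A - a • 1) ^ 3 = c ^ 2 • (A - a • 1)) :
    matAbs A = |a| • 1 + ((|a + c| - |a - c|) / (2 * c)) • (A - a • 1)
      + (((|a + c| + |a - c|) / 2 - |a|) / c ^ 2) • (A - a • 1) ^ 2 := by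
  classical
  -- The quadratic r interpolates the absolute value at the three nodes a, a + c, a - c.
  open Polynomial in
  set r : ℝ[X] := C |a| + C ((|a + c| - |a - c|) / (2 * c)) * (X - C a)
      + C (((|a + c| + |a - c|) / 2 - |a|) / c ^ 2) * (X - C a) ^ 2 with hr
  have hXA : Polynomial.aeval A (Polynomial.X - Polynomial.C a) = A - a • 1 := by
    simp [Algebra.algebraMap_eq_smul_one]
  have hra : Polynomial.aeval A r = |a| • 1 + ((|a + c| - |a - c|) / (2 * c)) • (A - a • 1)
      + (((|a + c| + |a - c|) / 2 - |a|) / c ^ 2) • (A - a • 1) ^ 2 := by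
    rw [hr, map_add, map_add, map_mul, map_mul, map_pow, hXA]
    simp [Algebra.algebraMap_eq_smul_one]
  rw [← hra]
  set p : Polynomial ℝ := Lagrange.interpolate A.charpoly.roots.toFinset id fun x => |x| with hp
  change Polynomial.aeval A p = Polynomial.aeval A r
  rw [← sub_eq_zero, ← map_sub, ← minpoly.dvd_iff]
  -- The hypothesis says that w annihilates A. Its roots are simple because c > 0, so those of the
  -- minimal polynomial are as well.
  open Polynomial in
  set w : ℝ[X] := (X - C a) * ((X - C (a + c)) * (X - C (a - c))) with hw
  have hwA : minpoly ℝ A ∣ w := by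
    rw [minpoly.dvd_iff]
    have : w = (Polynomial.X - Polynomial.C a) ^ 3
        - Polynomial.C (c ^ 2) * (Polynomial.X - Polynomial.C a) := by
      rw [hw]; simp only [map_add, map_sub, map_pow]; ring
    rw [this, map_sub, map_mul, map_pow, hXA, h]
    simp [Algebra.algebraMap_eq_smul_one, _root_.smul_pow]
  have hroots : ∀ x, w.IsRoot x → r.eval x = |x| := by
    intro x hx
    simp only [hw, Polynomial.IsRoot, Polynomial.eval_mul, Polynomial.eval_sub,
      Polynomial.eval_X, Polynomial.eval_C, mul_eq_zero, sub_eq_zero] at hx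
    rcases hx with rfl | rfl | rfl <;>
      simp only [hr, Polynomial.eval_add, Polynomial.eval_mul, Polynomial.eval_sub,
        Polynomial.eval_X, Polynomial.eval_C, Polynomial.eval_pow]
    · simp
    · rw [add_sub_cancel_left]; field_simp; ring
    · rw [sub_sub_cancel_left]; field_simp; ring
  have hw0 : w ≠ 0 := by
    rw [hw]
    exact mul_ne_zero (Polynomial.X_sub_C_ne_zero _) (mul_ne_zero (Polynomial.X_sub_C_ne_zero _)
      (Polynomial.X_sub_C_ne_zero _))
  have hsplit : w.Splits := by
    rw [hw]
    exact (Polynomial.Splits.X_sub_C _).mul ((Polynomial.Splits.X_sub_C _).mul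
      (Polynomial.Splits.X_sub_C _))
  have hwroots : w.roots = {a, a + c, a - c} := by
    rw [hw, Polynomial.roots_mul hw0, Polynomial.roots_mul (right_ne_zero_of_mul hw0)]
    simp only [Polynomial.roots_X_sub_C]
    rfl
  have hnodup : w.roots.Nodup := by
    rw [hwroots]
    simp only [Multiset.insert_eq_cons, Multiset.nodup_cons, Multiset.mem_cons,
      Multiset.mem_singleton, Multiset.nodup_singleton, and_true, not_or]
    refine ⟨⟨?_, ?_⟩, ?_⟩ <;> intro h <;> linarith
  have hm := minpoly.monic (Matrix.isIntegral (R := ℝ) A)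
  have hmsplit : (minpoly ℝ A).Splits := hsplit.of_dvd hw0 hwA
  have hmle : (minpoly ℝ A).roots ≤ w.roots := Polynomial.roots.le_of_dvd hw0 hwA
  -- The minimal polynomial is a product of distinct linear factors, so it divides p - r as soon as
  -- p and r agree at its roots. There both equal |x|. Some of the three values may fail to be
  -- eigenvalues of A, so p and r need not coincide.
  rw [hmsplit.eq_prod_roots_of_monic hm]
  by_cases h0 : p - r = 0
  · rw [h0]; exact dvd_zero _
  rw [Multiset.prod_X_sub_C_dvd_iff_le_roots h0,
    Multiset.le_iff_subset (Multiset.nodup_of_le hmle hnodup)]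
  intro x hx
  rw [Polynomial.mem_roots h0, Polynomial.IsRoot, Polynomial.eval_sub, sub_eq_zero,
    hroots x (Polynomial.isRoot_of_mem_roots (Multiset.mem_of_le hmle hx))]
  have hx' : x ∈ A.charpoly.roots.toFinset := by
    rw [Multiset.mem_toFinset, Polynomial.mem_roots A.charpoly_monic.ne_zero]
    exact (Polynomial.isRoot_of_mem_roots hx).dvd (Matrix.minpoly_dvd_charpoly A)
  exact Lagrange.eval_interpolate_at_node (v := id) _ (Function.injective_id.injOn) hx'

end Abs

/-! ### Spectrum of the Euler flux Jacobian, computed in primitive variables. -/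

section FluxJacobian
variable {d : ℕ} (g : PerfectGas)

/-- The matrix Ã₀⁻¹Ã_n = Ã₀⁻¹A_nÃ₀ is similar to A_n, so `matAbs_conj` moves the absolute value onto
A_n. -/
lemma genAbs_eq {v : State d} (hv : v ∈ physV g) (n : Space d) :
    genAbs g v n = matAbs (An g v n) * A0 g v := by
  have hP := isUnit_det_A0 g hv
  rw [genAbs, AnV, ← mul_assoc, matAbs_conj hP, ← mul_assoc, ← mul_assoc,
    Matrix.mul_nonsing_inv _ hP, one_mul]

/-- The conservation variables with given density, velocity and pressure. -/
def primCons (ρ : ℝ) (V : Fin d → ℝ) (p : ℝ) : State d :=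
  mkState ρ (fun j => ρ * V j) (p / (g.γ - 1) + ρ * (∑ j, V j ^ 2) / 2)

/-- The derivative of `primCons`. -/
def primTangent (ρ : ℝ) (V : Fin d → ℝ) (r : ℝ) (w : Fin d → ℝ) (s : ℝ) : State d :=
  mkState r (fun j => r * V j + ρ * w j)
    (s / (g.γ - 1) + r * (∑ j, V j ^ 2) / 2 + ρ * ∑ j, V j * w j)

lemma primCons_self {u : State d} (hu : fstVar u ≠ 0) :
    primCons g (fstVar u) (velocity u) (pressure g u) = u := by
  have hγ := (gamma_pos g).ne'
  conv_rhs => rw [← mkState_vars u]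
  rw [primCons]
  congr 1
  · funext j; rw [velocity]; field_simp
  · rw [pressure]; field_simp; ring

/-- The passage from primitive to conservative tangent vectors is onto, so a matrix identity may be
checked on vectors of the form `primTangent`, where A_n has a simple shape. -/
lemma exists_primTangent {ρ : ℝ} (hρ : ρ ≠ 0) (V : Fin d → ℝ) (h : State d) :
    ∃ r w s, primTangent g ρ V r w s = h := by
  have hγ := (gamma_pos g).ne'
  refine ⟨fstVar h, fun j => (midVar h j - fstVar h * V j) / ρ, (g.γ - 1) * (lastVar h
    - fstVar h * (∑ j, V j ^ 2) / 2
    - ρ * ∑ j, V j * ((midVar h j - fstVar h * V j) / ρ)), ?_⟩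
  conv_rhs => rw [← mkState_vars h]
  rw [primTangent]
  congr 1
  · funext j; field_simp; ring
  · field_simp; ring

lemma hasDerivAt_mkState {a b : ℝ → ℝ} {w : ℝ → Fin d → ℝ} {a' b' : ℝ} {w' : Fin d → ℝ} {t : ℝ}
    (ha : HasDerivAt a a' t) (hw : ∀ j, HasDerivAt (fun τ => w τ j) (w' j) t)
    (hb : HasDerivAt b b' t) :
    HasDerivAt (fun τ => mkState (a τ) (w τ) (b τ)) (mkState a' w' b') t := by
  refine hasDerivAt_pi.mpr fun i => ?_
  refine Fin.cases (by simpa [mkState] using ha) (fun i => ?_) i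
  refine Fin.lastCases ?_ (fun i => ?_) i
  · simpa [mkState] using hb
  · simpa [mkState] using hw i

lemma hasDerivAt_affine (a b : ℝ) : HasDerivAt (fun τ : ℝ => a + τ * b) b 0 := by
  simpa using ((hasDerivAt_id (0 : ℝ)).mul_const b).const_add a

lemma normalFlux_eq (u : State d) (n : Fin d → ℝ) : (inviscidFlux g u).mulVec n
    = mkState (fstVar u * ∑ j, velocity u j * n j)
      (fun l => fstVar u * velocity u l * (∑ j, velocity u j * n j) + pressure g u * n l)
      ((∑ j, velocity u j * n j) * (lastVar u + pressure g u)) := by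
  rw [← mkState_vars ((inviscidFlux g u).mulVec n)]
  have h : ∀ i, (inviscidFlux g u).mulVec n i = ∑ j, (fun i => inviscidFlux g u i j) i * n j :=
    fun i => rfl
  have h1 : ∀ j, fstVar (fun i => inviscidFlux g u i j) = fstVar u * velocity u j := fun j => by
    rw [inviscidFlux_col, fstVar_mkState]
  have h2 : ∀ j l, midVar (fun i => inviscidFlux g u i j) l = fstVar u * velocity u l * velocity u j
      + if l = j then pressure g u else 0 := fun j l => by
    rw [inviscidFlux_col, midVar_mkState]
  have h3 : ∀ j, lastVar (fun i => inviscidFlux g u i j)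
      = velocity u j * (lastVar u + pressure g u) := fun j => by
    rw [inviscidFlux_col, lastVar_mkState]
  simp only [fstVar, midVar, lastVar] at h1 h2 h3
  congr 1
  · rw [fstVar, h, Finset.mul_sum]
    exact Finset.sum_congr rfl fun j _ => (congrArg (· * n j) (h1 j)).trans (mul_assoc _ _ _)
  · funext l
    rw [midVar, h, Finset.mul_sum]
    simp only [h2, add_mul, Finset.sum_add_distrib, ite_mul, zero_mul, Finset.sum_ite_eq,
      Finset.mem_univ, if_true]
    congr 1
    exact Finset.sum_congr rfl fun j _ => by rw [mul_assoc]; rfl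
  · rw [lastVar, h, Finset.sum_mul]
    exact Finset.sum_congr rfl fun j _ => (congrArg (· * n j) (h3 j)).trans (by
      simp only [lastVar]; ring)

/-- The flux Jacobian in primitive variables. -/
lemma An_mulVec_primTangent {v : State d} {u : State d} (hu : fstVar u ≠ 0)
    (hv : consVars g v = u) (n : Space d) (r : ℝ) (w : Fin d → ℝ) (s : ℝ) :
    (An g v n).mulVec (primTangent g (fstVar u) (velocity u) r w s)
      = primTangent g (fstVar u) (velocity u)
        ((∑ j, velocity u j * n j) * r + fstVar u * ∑ j, w j * n j)
        (fun l => (∑ j, velocity u j * n j) * w l + n l * s / fstVar u)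
        ((∑ j, velocity u j * n j) * s + g.γ * pressure g u * ∑ j, w j * n j) := by
  have hγ := (gamma_pos g).ne'
  set ρ := fstVar u with hρ
  set V := velocity u with hV
  set p := pressure g u with hp
  -- The normal flux is differentiated along a straight line in primitive variables, once through
  -- A_n and once from the explicit formula of the flux; uniqueness of the derivative gives the
  -- claim.
  set R : ℝ → ℝ := fun τ => ρ + τ * r with hR
  set W : ℝ → Fin d → ℝ := fun τ j => V j + τ * w j with hW
  set Q : ℝ → ℝ := fun τ => p + τ * s with hQ
  have dR : HasDerivAt R r 0 := hasDerivAt_affine _ _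
  have dW : ∀ j, HasDerivAt (fun τ => W τ j) (w j) 0 := fun j => hasDerivAt_affine _ _
  have dQ : HasDerivAt Q s 0 := hasDerivAt_affine _ _
  have R0 : R 0 = ρ := by simp [hR]
  have W0 : ∀ j, W 0 j = V j := fun j => by simp [hW]
  have Q0 : Q 0 = p := by simp [hQ]
  have dS : HasDerivAt (fun τ => ∑ j, W τ j ^ 2) (2 * ∑ j, V j * w j) 0 := by
    have := HasDerivAt.fun_sum (u := Finset.univ) fun j _ => (dW j).fun_pow 2
    refine this.congr_deriv ?_
    rw [Finset.mul_sum]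
    exact Finset.sum_congr rfl fun j _ => by rw [W0]; simp; ring
  have dN : HasDerivAt (fun τ => ∑ j, W τ j * n j) (∑ j, w j * n j) 0 :=
    HasDerivAt.fun_sum fun j _ => (dW j).mul_const (n j)
  have dE : HasDerivAt (fun τ => Q τ / (g.γ - 1) + R τ * (∑ j, W τ j ^ 2) / 2)
      (s / (g.γ - 1) + r * (∑ j, V j ^ 2) / 2 + ρ * ∑ j, V j * w j) 0 := by
    refine ((dQ.div_const _).add ((dR.mul dS).div_const 2)).congr_deriv ?_
    simp only [R0, W0]; ring
  have du : HasDerivAt (fun τ => primCons g (R τ) (W τ) (Q τ)) (primTangent g ρ V r w s) 0 := by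
    refine hasDerivAt_mkState dR (fun j => ?_) dE
    refine (dR.mul (dW j)).congr_deriv ?_
    rw [R0, W0]
  have hu0 : primCons g (R 0) (W 0) (Q 0) = u := by
    rw [R0, show W 0 = V from funext W0, Q0]; exact primCons_self g hu
  have h1 := hasDerivAt_normalFlux g (v := v) n du (by rw [hu0]; exact hu) (by rw [hu0, hv])
  have hev : ∀ᶠ τ in nhds (0 : ℝ), R τ ≠ 0 :=
    dR.continuousAt.eventually_ne (by rw [R0]; exact hu)
  have dM : HasDerivAt (fun τ => (mkState (R τ * ∑ j, W τ j * n j)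
      (fun l => R τ * W τ l * (∑ j, W τ j * n j) + Q τ * n l)
      ((∑ j, W τ j * n j) * ((Q τ / (g.γ - 1) + R τ * (∑ j, W τ j ^ 2) / 2) + Q τ)) : State d)) _ 0 :=
    hasDerivAt_mkState (dR.mul dN)
      (fun l => ((dR.mul (dW l)).mul dN).add (dQ.mul_const (n l))) (dN.mul (dE.add dQ))
  have h2 := dM.congr_of_eventuallyEq (f₁ := fun τ =>
    (inviscidFlux g (primCons g (R τ) (W τ) (Q τ))).mulVec fun j => n j) (by
      filter_upwards [hev] with τ hτ
      have e1 : velocity (primCons g (R τ) (W τ) (Q τ)) = W τ := by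
        funext j
        simp only [velocity, primCons, midVar_mkState, fstVar_mkState]
        field_simp
      have e2 : pressure g (primCons g (R τ) (W τ) (Q τ)) = Q τ := by
        rw [pressure, e1]
        simp only [primCons, fstVar_mkState, lastVar_mkState]
        field_simp; ring
      rw [normalFlux_eq, e1, e2]
      simp only [primCons, fstVar_mkState, lastVar_mkState])
  rw [h1.unique h2, primTangent]
  simp only [Pi.mul_apply, R0, W0, Q0]
  have hs : ∑ j, V j * ((∑ j, V j * n j) * w j + n j * s / ρ)
      = (∑ j, V j * n j) * (∑ j, V j * w j) + s / ρ * ∑ j, V j * n j := by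
    rw [Finset.mul_sum, Finset.mul_sum, ← Finset.sum_add_distrib]
    exact Finset.sum_congr rfl fun j _ => by ring
  rw [hs]
  congr 1
  · ring
  · funext l; field_simp; ring
  · field_simp; ring

lemma primTangent_smul (ρ : ℝ) (V : Fin d → ℝ) (r : ℝ) (w : Fin d → ℝ) (s a : ℝ) :
    primTangent g ρ V (a * r) (fun j => a * w j) (a * s) = a • primTangent g ρ V r w s := by
  rw [← mkState_vars (a • primTangent g ρ V r w s), fstVar_smul, lastVar_smul]
  simp only [primTangent, fstVar_mkState, lastVar_mkState]
  congr 1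
  · funext j; simp; ring
  · have : ∑ j, V j * (a * w j) = a * ∑ j, V j * w j := by
      rw [Finset.mul_sum]; exact Finset.sum_congr rfl fun _ _ => by ring
    rw [this]; ring

lemma primTangent_sub (ρ : ℝ) (V : Fin d → ℝ) (r r' : ℝ) (w w' : Fin d → ℝ) (s s' : ℝ) :
    primTangent g ρ V r w s - primTangent g ρ V r' w' s'
      = primTangent g ρ V (r - r') (fun j => w j - w' j) (s - s') := by
  set a := primTangent g ρ V r w s with ha
  set b := primTangent g ρ V r' w' s' with hb
  rw [← mkState_vars (a - b), show fstVar (a - b) = fstVar a - fstVar b from rfl,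
    show lastVar (a - b) = lastVar a - lastVar b from rfl,
    show midVar (a - b) = fun j => midVar a j - midVar b j from rfl, ha, hb]
  simp only [primTangent, fstVar_mkState, lastVar_mkState, midVar_mkState]
  congr 1
  · funext j; ring
  · simp only [mul_sub, Finset.sum_sub_distrib]; ring

/-- Normal velocity. -/
def normalVel (u : State d) (n : Space d) : ℝ := ∑ j, velocity u j * n j

/-- Speed of sound. -/
def soundSpeed (u : State d) : ℝ := Real.sqrt (g.γ * pressure g u / fstVar u)

lemma soundSpeed_pos {u : State d} (hu : u ∈ physU g) : 0 < soundSpeed g u :=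
  Real.sqrt_pos.mpr (div_pos (mul_pos (by linarith [g.one_lt_γ]) hu.2) hu.1)

/-- The eigenvalues of the flux Jacobian are `V_n` and `V_n ± c`. -/
lemma An_cube {v : State d} (hv : v ∈ physV g) {n : Space d} (hn : ‖n‖ = 1) :
    (An g v n - normalVel (consVars g v) n • 1) ^ 3
      = soundSpeed g (consVars g v) ^ 2 • (An g v n - normalVel (consVars g v) n • 1) := by
  set u := consVars g v with hu
  have hphys : u ∈ physU g := consVars_mem g hv
  have hρ : fstVar u ≠ 0 := hphys.1.ne'
  have hc : soundSpeed g u ^ 2 = g.γ * pressure g u / fstVar u :=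
    Real.sq_sqrt (div_pos (mul_pos (by linarith [g.one_lt_γ]) hphys.2) hphys.1).le
  have hnn : ∑ j, n j * n j = 1 := by
    have := real_inner_self_eq_norm_sq n
    rw [hn, PiLp.inner_apply] at this
    simpa [pow_two] using this
  set B := An g v n - normalVel u n • 1 with hB
  -- In primitive variables B = A_n - V_n maps (r, w, s) to (ρ w_n, s n/ρ, γ p w_n). Two further
  -- applications multiply the result by γp/ρ = c², because |n| = 1.
  have hBP : ∀ r w s, B.mulVec (primTangent g (fstVar u) (velocity u) r w s)
      = primTangent g (fstVar u) (velocity u) (fstVar u * ∑ j, w j * n j)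
        (fun l => n l * s / fstVar u) (g.γ * pressure g u * ∑ j, w j * n j) := by
    intro r w s
    rw [hB, Matrix.sub_mulVec, An_mulVec_primTangent g hρ hu.symm, Matrix.smul_mulVec,
      Matrix.one_mulVec, ← primTangent_smul, primTangent_sub, normalVel]
    congr 1
    · ring
    · funext l; ring
    · ring
  refine Matrix.ext_of_mulVec_single fun i => ?_
  obtain ⟨r, w, s, h⟩ := exists_primTangent g hρ (velocity u) (Pi.single i 1)
  have hs : ∀ a : ℝ, ∑ j, n j * a / fstVar u * n j = a / fstVar u := fun a => by
    have : ∑ j, n j * a / fstVar u * n j = a / fstVar u * ∑ j, n j * n j := by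
      rw [Finset.mul_sum]; exact Finset.sum_congr rfl fun _ _ => by ring
    rw [this, hnn, mul_one]
  rw [← h, pow_succ, pow_two, ← Matrix.mulVec_mulVec, ← Matrix.mulVec_mulVec, hBP, hBP, hBP,
    Matrix.smul_mulVec, hBP, ← primTangent_smul, hc, hs, hs]
  congr 1
  · field_simp
  · funext l; field_simp
  · field_simp

lemma matAbs_An {v : State d} (hv : v ∈ physV g) {n : Space d} (hn : ‖n‖ = 1) :
    matAbs (An g v n) = |normalVel (consVars g v) n| • 1
      + ((|normalVel (consVars g v) n + soundSpeed g (consVars g v)|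
        - |normalVel (consVars g v) n - soundSpeed g (consVars g v)|)
          / (2 * soundSpeed g (consVars g v))) • (An g v n - normalVel (consVars g v) n • 1)
      + (((|normalVel (consVars g v) n + soundSpeed g (consVars g v)|
        + |normalVel (consVars g v) n - soundSpeed g (consVars g v)|) / 2
          - |normalVel (consVars g v) n|) / soundSpeed g (consVars g v) ^ 2)
            • (An g v n - normalVel (consVars g v) n • 1) ^ 2 :=
  matAbs_eq_of_cube _ (soundSpeed_pos g (consVars_mem g hv)) (An_cube g hv hn)

/-- Continuity is not visible in the definition of `matAbs`, whose interpolation nodes merge when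
eigenvalues do. The formula in `matAbs_An` has continuous coefficients, as c > 0 on physical states.
-/
lemma continuousOn_matAbs_An {n : Space d} (hn : ‖n‖ = 1) :
    ContinuousOn (fun v => matAbs (An g v n)) (physV g) := by
  have hA : ContinuousOn (fun v => An g v n) (physV g) :=
    continuousOn_pi.mpr fun i => continuousOn_pi.mpr fun l => continuousOn_An g n i l
  have hV : ContinuousOn (fun v : State d => normalVel (consVars g v) n) (physV g) := by
    refine ContinuousOn.comp (g := fun u => normalVel u n) (t := physU g) ?_
      (continuousOn_consVars g) fun v hv => consVars_mem g hv
    refine continuousOn_finsetSum _ fun j _ => ContinuousOn.mul (fun u hu => ?_) continuousOn_const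
    exact (contDiffAt_velocity hu.1.ne' j).continuousAt.continuousWithinAt
  have hc : ContinuousOn (fun v : State d => soundSpeed g (consVars g v)) (physV g) := by
    refine ContinuousOn.comp (g := fun u => soundSpeed g u) (t := physU g) ?_
      (continuousOn_consVars g) fun v hv => consVars_mem g hv
    refine Real.continuous_sqrt.comp_continuousOn (ContinuousOn.div (continuousOn_const.mul
      fun u hu => ?_) (continuous_apply _).continuousOn fun u hu => hu.1.ne')
    exact (contDiffAt_pressure g hu.1.ne').continuousAt.continuousWithinAt
  have hc0 : ∀ v ∈ (physV g : Set (State d)), soundSpeed g (consVars g v) ≠ 0 := fun v hv =>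
    (soundSpeed_pos g (consVars_mem g hv)).ne'
  have hB : ContinuousOn (fun v => An g v n - normalVel (consVars g v) n • (1 : StateMat d))
      (physV g) := hA.sub (hV.smul continuousOn_const)
  refine ContinuousOn.congr ?_ fun v hv => matAbs_An g hv hn
  refine ((hV.abs.smul continuousOn_const).add (ContinuousOn.smul (ContinuousOn.div
    ((hV.add hc).abs.sub (hV.sub hc).abs) (continuousOn_const.mul hc)
    fun v hv => mul_ne_zero two_ne_zero (hc0 v hv)) hB)).add (ContinuousOn.smul (ContinuousOn.div
    ((((hV.add hc).abs.add (hV.sub hc).abs).div_const 2).sub hV.abs) (hc.pow 2)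
    fun v hv => pow_ne_zero 2 (hc0 v hv)) (hB.pow 2))

lemma continuousOn_An_matrix (n : Space d) : ContinuousOn (fun v => An g v n) (physV g) :=
  continuousOn_pi.mpr fun i => continuousOn_pi.mpr fun l => continuousOn_An g n i l

lemma continuousOn_A0_matrix :
    ContinuousOn (A0 g : State d → StateMat d) (physV g) :=
  continuousOn_pi.mpr fun i => continuousOn_pi.mpr fun l => continuousOn_A0 g i l

lemma continuousOn_genAbs {n : Space d} (hn : ‖n‖ = 1) :
    ContinuousOn (fun v => genAbs g v n) (physV g) :=
  ((continuousOn_matAbs_An g hn).mul (continuousOn_A0_matrix g)).congr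
    fun _ hv => genAbs_eq g hv n

lemma continuousOn_AnV (n : Space d) : ContinuousOn (fun v => AnV g v n) (physV g) :=
  (continuousOn_An_matrix g n).mul (continuousOn_A0_matrix g)

lemma APlus_eq {v : State d} (hv : v ∈ physV g) (n : Space d) :
    APlus g v n = (1 / 2 : ℝ) • (AnV g v n + genAbs g v n) := by
  rw [APlus, genAbs_eq g hv, AnV, Matrix.smul_mul, add_mul]

lemma AMinus_eq {v : State d} (hv : v ∈ physV g) (n : Space d) :
    AMinus g v n = (1 / 2 : ℝ) • (AnV g v n - genAbs g v n) := by
  rw [AMinus, genAbs_eq g hv, AnV, Matrix.smul_mul, sub_mul]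

end FluxJacobian
end HDG

end

noncomputable section
namespace HDG

/-! ### The mean-value stabilization -/

section MeanValue
variable {d : ℕ} (g : PerfectGas)

/-- The normal component of the potential `vᵗ F - 𝓕`. -/
def normalPotential (v : State d) (n : Space d) : ℝ :=
  ∑ j, (g.γ - 1) * midVar (consVars g v) j * n j

lemma normalPotential_eq {v : State d} (hv : v ∈ physV g) (n : Space d) :
    normalPotential g v n = v ⬝ᵥ (inviscidFlux g (consVars g v)).mulVec (fun j => n j)
      - entropyFlux g (consVars g v) ⬝ᵥ fun j => n j := by
  have h := fun j => entropyVars_dotProduct_flux g (consVars_mem g hv) j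
  rw [entropyVars_consVars g ((mem_physV g).mp hv)] at h
  have h2 : v ⬝ᵥ (inviscidFlux g (consVars g v)).mulVec (fun j => n j)
      = ∑ j, (v ⬝ᵥ fun i => inviscidFlux g (consVars g v) i j) * n j := by
    simp only [dotProduct, Matrix.mulVec, Finset.mul_sum, Finset.sum_mul]
    rw [Finset.sum_comm]
    exact Finset.sum_congr rfl fun _ _ => Finset.sum_congr rfl fun _ _ => by ring
  rw [h2, dotProduct, ← Finset.sum_sub_distrib]
  exact Finset.sum_congr rfl fun j _ => by rw [h]; ring

lemma hasDerivAt_normalPotential {v : ℝ → State d} {h : State d} {t : ℝ} (hv : HasDerivAt v h t)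
    (hp : v t ∈ physV g) (n : Space d) : HasDerivAt (fun τ => normalPotential g (v τ) n)
      (h ⬝ᵥ (inviscidFlux g (consVars g (v t))).mulVec fun j => n j) t := by
  have := HasDerivAt.fun_sum (u := Finset.univ) fun j (_ : j ∈ Finset.univ) =>
    (hasDerivAt_potential g hv ((mem_physV g).mp hp) j).mul_const (n j)
  refine this.congr_deriv ?_
  simp only [dotProduct, Matrix.mulVec, Finset.mul_sum, Finset.sum_mul]
  rw [Finset.sum_comm]
  exact Finset.sum_congr rfl fun _ _ => Finset.sum_congr rfl fun _ _ => by ring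

lemma hasDerivAt_path (v w : State d) (θ : ℝ) : HasDerivAt (fun θ => path θ v w) (w - v) θ := by
  unfold path
  simpa using ((hasDerivAt_id θ).smul_const (w - v)).const_add v

lemma path_symm (v w : State d) (θ : ℝ) : path θ v w = path (1 - θ) w v := by
  unfold path; module

lemma continuous_quadForm (δ : State d) :
    Continuous fun A : StateMat d => δ ⬝ᵥ A.mulVec δ := by
  simp only [dotProduct, Matrix.mulVec]
  fun_prop

lemma continuousOn_path_comp {E : Type*} [TopologicalSpace E] {f : State d → E}
    (hf : ContinuousOn f (physV g)) {v w : State d} (hv : v ∈ physV g) (hw : w ∈ physV g) :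
    ContinuousOn (fun θ => f (path θ v w)) (Set.uIcc 0 1) := by
  refine hf.comp (fun θ _ => (hasDerivAt_path v w θ).continuousAt.continuousWithinAt) ?_
  intro θ hθ
  rw [Set.uIcc_of_le zero_le_one] at hθ
  exact path_mem_physV g hv hw hθ

/-- The trapezoidal rule for the potential, with remainder in integral form. -/
lemma trapezoid_potential {v w : State d} (hv : v ∈ physV g) (hw : w ∈ physV g) (n : Space d) :
    ((1 / 2 : ℝ) • (inviscidFlux g (consVars g w) + inviscidFlux g (consVars g v)).mulVec
      (fun j => n j)) ⬝ᵥ (v - w) - (normalPotential g v n - normalPotential g w n)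
      = (1 / 2) * ∫ θ in (0 : ℝ)..1, (1 - θ) * ((v - w) ⬝ᵥ (AnV g (path θ v w) n).mulVec (v - w)
        - (v - w) ⬝ᵥ (AnV g (path θ w v) n).mulVec (v - w)) := by
  set δ := v - w with hδ
  set φ : ℝ → ℝ := fun θ =>
    δ ⬝ᵥ (inviscidFlux g (consVars g (path θ w v))).mulVec (fun j => n j) with hφ
  set φ' : ℝ → ℝ := fun θ => δ ⬝ᵥ (AnV g (path θ w v) n).mulVec δ with hφ'
  have hpath : ∀ θ ∈ Set.uIcc (0 : ℝ) 1, path θ w v ∈ physV g := fun θ hθ => by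
    rw [Set.uIcc_of_le zero_le_one] at hθ
    exact path_mem_physV g hw hv hθ
  have dφ : ∀ θ ∈ Set.uIcc (0 : ℝ) 1, HasDerivAt φ (φ' θ) θ := by
    intro θ hθ
    have h1 := hasDerivAt_consVars g (hasDerivAt_path w v θ) (hpath θ hθ)
    have h2 := hasDerivAt_normalFlux g n h1 (consVars_mem g (hpath θ hθ)).1.ne' rfl
    have h3 := hasDerivAt_dotProduct (hasDerivAt_const θ δ) h2
    refine h3.congr_deriv ?_
    simp only [zero_dotProduct, zero_add, hφ', AnV, Matrix.mulVec_mulVec, hδ]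
  have cφ' : ContinuousOn φ' (Set.uIcc 0 1) :=
    continuousOn_path_comp g ((continuous_quadForm δ).comp_continuousOn (continuousOn_AnV g n))
      hw hv
  have cφ : ContinuousOn φ (Set.uIcc 0 1) := fun θ hθ =>
    (dφ θ hθ).continuousAt.continuousWithinAt
  have iφ := cφ.intervalIntegrable (μ := volume)
  have iφ' := cφ'.intervalIntegrable (μ := volume)
  have i1 : IntervalIntegrable (fun θ => (1 - θ) * φ' θ) volume 0 1 :=
    ((Continuous.continuousOn (by fun_prop)).mul cφ').intervalIntegrable
  have i2 : IntervalIntegrable (fun θ => θ * φ' θ) volume 0 1 :=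
    ((Continuous.continuousOn (by fun_prop)).mul cφ').intervalIntegrable
  have e0 : ∫ θ in (0 : ℝ)..1, φ θ = normalPotential g v n - normalPotential g w n := by
    have h := intervalIntegral.integral_eq_sub_of_hasDerivAt (a := 0) (b := 1)
      (f := fun θ => normalPotential g (path θ w v) n) (f' := φ)
      (fun θ hθ => hasDerivAt_normalPotential g (hasDerivAt_path w v θ) (hpath θ hθ) n) iφ
    simpa [path] using h
  -- Integrating (θφ)' and ((1-θ)φ)' and subtracting gives the trapezoidal value (φ(0) + φ(1))/2
  -- minus ∫φ as half of ∫θφ' - ∫(1-θ)φ'.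
  have e1 : ∫ θ in (0 : ℝ)..1, (θ * φ' θ + φ θ) = φ 1 := by
    have h := intervalIntegral.integral_eq_sub_of_hasDerivAt (a := 0) (b := 1)
      (f := fun θ => θ * φ θ) (f' := fun θ => θ * φ' θ + φ θ)
      (fun θ hθ => ((hasDerivAt_id θ).mul (dφ θ hθ)).congr_deriv (by simp; ring)) (i2.add iφ)
    simpa using h
  have e2 : ∫ θ in (0 : ℝ)..1, ((1 - θ) * φ' θ - φ θ) = -φ 0 := by
    have h := intervalIntegral.integral_eq_sub_of_hasDerivAt (a := 0) (b := 1)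
      (f := fun θ => (1 - θ) * φ θ) (f' := fun θ => (1 - θ) * φ' θ - φ θ)
      (fun θ hθ => (((hasDerivAt_id θ).const_sub 1).mul (dφ θ hθ)).congr_deriv (by simp; ring))
      (i1.sub iφ)
    simpa using h
  rw [intervalIntegral.integral_add i2 iφ, e0] at e1
  rw [intervalIntegral.integral_sub i1 iφ, e0] at e2
  -- Running the segment backwards exchanges the weights θ and 1-θ.
  have e3 : ∫ θ in (0 : ℝ)..1, (1 - θ) * (δ ⬝ᵥ (AnV g (path θ v w) n).mulVec δ)
      = ∫ θ in (0 : ℝ)..1, θ * φ' θ := by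
    have h := intervalIntegral.integral_comp_sub_left (a := 0) (b := 1) (fun θ => θ * φ' θ) 1
    simp only [sub_self, sub_zero] at h
    rw [← h]
    refine intervalIntegral.integral_congr fun θ _ => ?_
    simp only [hφ', ← path_symm v w θ]
  have i3 : IntervalIntegrable (fun θ => (1 - θ) * (δ ⬝ᵥ (AnV g (path θ v w) n).mulVec δ))
      volume 0 1 :=
    ((Continuous.continuousOn (by fun_prop)).mul (continuousOn_path_comp g
      ((continuous_quadForm δ).comp_continuousOn (continuousOn_AnV g n)) hv hw)).intervalIntegrable
  have e4 : ∫ θ in (0 : ℝ)..1, (1 - θ) * (δ ⬝ᵥ (AnV g (path θ v w) n).mulVec δ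
        - δ ⬝ᵥ (AnV g (path θ w v) n).mulVec δ)
      = (∫ θ in (0 : ℝ)..1, θ * φ' θ) - ∫ θ in (0 : ℝ)..1, (1 - θ) * φ' θ := by
    rw [← e3, ← intervalIntegral.integral_sub i3 i1]
    refine intervalIntegral.integral_congr fun θ _ => ?_
    simp only [hφ']; ring
  have p0 : path 0 w v = w := by simp [path]
  have p1 : path 1 w v = v := by simp [path]
  have e5 : ((1 / 2 : ℝ) • (inviscidFlux g (consVars g w)
      + inviscidFlux g (consVars g v)).mulVec (fun j => n j)) ⬝ᵥ δ = 1 / 2 * (φ 0 + φ 1) := by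
    simp only [hφ, p0, p1]
    rw [smul_dotProduct, dotProduct_comm, Matrix.add_mulVec, dotProduct_add, smul_eq_mul]
  rw [e4, e5]
  linarith

lemma quadForm_sigmaMV {v w : State d} (hv : v ∈ physV g) (hw : w ∈ physV g) {n : Space d}
    (hn : ‖n‖ = 1) (δ : State d) : δ ⬝ᵥ (sigmaMV g w v n).mulVec δ
      = ∫ θ in (0 : ℝ)..1, (1 - θ) * (δ ⬝ᵥ (genAbs g (path θ w v) n).mulVec δ
        + δ ⬝ᵥ (genAbs g (path θ v w) n).mulVec δ) := by
  have hc : ∀ i j, ∀ {v w : State d}, v ∈ physV g → w ∈ physV g →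
      ContinuousOn (fun θ => genAbs g (path θ v w) n i j) (Set.uIcc 0 1) := fun i j v w hv hw =>
    continuousOn_path_comp g ((continuous_apply_apply i j).comp_continuousOn
      (continuousOn_genAbs g hn)) hv hw
  have hi : ∀ i j, IntervalIntegrable (fun θ => (1 - θ) * (genAbs g (path θ w v) n i j
      + genAbs g (path θ v w) n i j)) volume 0 1 := fun i j =>
    ((Continuous.continuousOn (by fun_prop)).mul
      ((hc i j hw hv).add (hc i j hv hw))).intervalIntegrable
  have h1 : δ ⬝ᵥ (sigmaMV g w v n).mulVec δ = ∑ i, ∑ j, δ i * δ j *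
      ∫ θ in (0 : ℝ)..1, (1 - θ) * (genAbs g (path θ w v) n i j
        + genAbs g (path θ v w) n i j) := by
    simp only [dotProduct, Matrix.mulVec, Finset.mul_sum, sigmaMV, Matrix.of_apply]
    exact Finset.sum_congr rfl fun _ _ => Finset.sum_congr rfl fun _ _ => by ring
  rw [h1]
  simp only [← intervalIntegral.integral_const_mul]
  rw [Finset.sum_congr rfl fun i _ => (intervalIntegral.integral_finsetSum
    fun j _ => (hi i j).const_mul (δ i * δ j)).symm, ← intervalIntegral.integral_finsetSum]
  · refine intervalIntegral.integral_congr fun θ _ => ?_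
    simp only [dotProduct, Matrix.mulVec, Finset.mul_sum, ← Finset.sum_add_distrib]
    exact Finset.sum_congr rfl fun _ _ => Finset.sum_congr rfl fun _ _ => by ring
  · intro i _
    refine ContinuousOn.intervalIntegrable (continuousOn_finsetSum _ fun j _ => ?_)
    exact continuousOn_const.mul ((Continuous.continuousOn (by fun_prop)).mul
      ((hc i j hw hv).add (hc i j hv hw)))

/-- The entropy production of the mean-value flux on a face. -/
lemma meanValue_identity {v w : State d} (hv : v ∈ physV g) (hw : w ∈ physV g) {n : Space d}
    (hn : ‖n‖ = 1) :
    ((1 / 2 : ℝ) • (inviscidFlux g (consVars g w) + inviscidFlux g (consVars g v)).mulVec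
        (fun j => n j) + (1 / 2 : ℝ) • (sigmaMV g w v n).mulVec (v - w)) ⬝ᵥ (v - w)
      - (normalPotential g v n - normalPotential g w n)
      = ∫ θ in (0 : ℝ)..1, (1 - θ) * ((v - w) ⬝ᵥ
        (APlus g (path θ v w) n - AMinus g (path θ w v) n).mulVec (v - w)) := by
  have h1 := trapezoid_potential g hv hw n
  have h2 := quadForm_sigmaMV g hv hw hn (v - w)
  have hq : ∀ {f : State d → StateMat d}, ContinuousOn f (physV g) → ∀ {v' w' : State d},
      v' ∈ physV g → w' ∈ physV g → ContinuousOn (fun θ => (v - w) ⬝ᵥ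
        (f (path θ v' w')).mulVec (v - w)) (Set.uIcc 0 1) := fun hf v' w' hv' hw' =>
    continuousOn_path_comp g ((continuous_quadForm (v - w)).comp_continuousOn hf) hv' hw'
  have c1 := hq (continuousOn_AnV g n) hv hw
  have c2 := hq (continuousOn_AnV g n) hw hv
  have c3 := hq (continuousOn_genAbs g hn) hv hw
  have c4 := hq (continuousOn_genAbs g hn) hw hv
  have cθ : ContinuousOn (fun θ : ℝ => 1 - θ) (Set.uIcc 0 1) :=
    Continuous.continuousOn (by fun_prop)
  have i1 : IntervalIntegrable (fun θ => (1 - θ) *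
      ((v - w) ⬝ᵥ (AnV g (path θ v w) n).mulVec (v - w)
        - (v - w) ⬝ᵥ (AnV g (path θ w v) n).mulVec (v - w))) volume 0 1 :=
    (cθ.mul (c1.sub c2)).intervalIntegrable
  have i2 : IntervalIntegrable (fun θ => (1 - θ) *
      ((v - w) ⬝ᵥ (genAbs g (path θ w v) n).mulVec (v - w)
        + (v - w) ⬝ᵥ (genAbs g (path θ v w) n).mulVec (v - w))) volume 0 1 :=
    (cθ.mul (c4.add c3)).intervalIntegrable
  rw [add_dotProduct, add_sub_right_comm, h1, smul_dotProduct, dotProduct_comm _ (v - w), h2,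
    smul_eq_mul, ← mul_add, ← intervalIntegral.integral_add i1 i2,
    ← intervalIntegral.integral_const_mul]
  refine intervalIntegral.integral_congr fun θ hθ => ?_
  rw [Set.uIcc_of_le zero_le_one] at hθ
  -- A⁺ on one path minus A⁻ on the reversed path is half the difference of the two Ã_n, from the
  -- trapezoidal remainder, plus half the sum of the two |Ã_n|, from σ_MV.
  rw [APlus_eq g (path_mem_physV g hv hw hθ), AMinus_eq g (path_mem_physV g hw hv hθ)]
  simp only [Matrix.sub_mulVec, Matrix.add_mulVec, Matrix.smul_mulVec, dotProduct_sub,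
    dotProduct_add, dotProduct_smul, smul_eq_mul]
  ring

/-- The theorem on parametric integrals asks for joint continuity over all real θ, but beyond [0, 1]
the line may leave the physical set. The parameter is therefore clamped to [0, 1], which does not
change the integral. -/
lemma continuousOn_sigmaMV {X : Type*} [TopologicalSpace X] {S : Set X} {v w : X → State d}
    (hv : ContinuousOn v S) (hw : ContinuousOn w S) (hvp : ∀ x ∈ S, v x ∈ physV g)
    (hwp : ∀ x ∈ S, w x ∈ physV g) {n : Space d} (hn : ‖n‖ = 1) (i j : Fin (d + 2)) :
    ContinuousOn (fun x => sigmaMV g (w x) (v x) n i j) S := by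
  rw [continuousOn_iff_continuous_domRestrict] at *
  have hclamp : ∀ {a b : S → State d}, Continuous a → Continuous b →
      (∀ x, a x ∈ physV g) → (∀ x, b x ∈ physV g) →
      Continuous fun p : S × ℝ => genAbs g (path (Set.projIcc (0 : ℝ) 1 zero_le_one p.2)
        (a p.1) (b p.1)) n i j := by
    intro a b ha hb hap hbp
    have h1 : Continuous fun p : S × ℝ =>
        path (Set.projIcc (0 : ℝ) 1 zero_le_one p.2 : ℝ) (a p.1) (b p.1) := by
      unfold path
      have : Continuous fun p : S × ℝ => (Set.projIcc (0 : ℝ) 1 zero_le_one p.2 : ℝ) :=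
        continuous_subtype_val.comp (continuous_projIcc.comp continuous_snd)
      fun_prop
    exact ((continuous_apply_apply i j).comp_continuousOn (continuousOn_genAbs g hn)).comp_continuous
      h1 fun p => path_mem_physV g (hap _) (hbp _) (Set.projIcc (0 : ℝ) 1 zero_le_one p.2).2
  have h2 := intervalIntegral.continuous_parametric_intervalIntegral_of_continuous' (μ := volume)
    (f := fun (x : S) θ => (1 - θ) * (genAbs g (path (Set.projIcc (0 : ℝ) 1 zero_le_one θ)
        (w x) (v x)) n i j + genAbs g (path (Set.projIcc (0 : ℝ) 1 zero_le_one θ)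
        (v x) (w x)) n i j)) (by
      have e1 := hclamp hw hv (fun x => hwp x x.2) fun x => hvp x x.2
      have e2 := hclamp hv hw (fun x => hvp x x.2) fun x => hwp x x.2
      exact (by fun_prop : Continuous fun p : S × ℝ => 1 - p.2).mul (e1.add e2)) 0 1
  refine h2.congr fun x => ?_
  simp only [Set.domRestrict_apply, sigmaMV, Matrix.of_apply]
  refine intervalIntegral.integral_congr fun θ hθ => ?_
  rw [Set.uIcc_of_le zero_le_one] at hθ
  simp only [Set.projIcc_of_mem zero_le_one hθ]

lemma continuousOn_normalPotential (n : Space d) :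
    ContinuousOn (fun v => normalPotential g v n) (physV g) := by
  refine continuousOn_finsetSum _ fun j _ => (continuousOn_const.mul ?_).mul continuousOn_const
  exact (continuous_apply _).comp_continuousOn (continuousOn_consVars g)

end MeanValue
end HDG

end

noncomputable section
namespace HDG

/-! ### Polynomials on elements -/

section Poly
variable {d : ℕ}

/-- The polynomial function of `P` on physical space. -/
def polyFun (P : MvPolynomial (Fin d) ℝ) (x : Space d) : ℝ := MvPolynomial.eval (fun i => x i) P

lemma hasFDerivAt_polyFun (P : MvPolynomial (Fin d) ℝ) (x : Space d) :
    HasFDerivAt (polyFun P)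
      (∑ j, polyFun (MvPolynomial.pderiv j P) x • (EuclideanSpace.proj j : Space d →L[ℝ] ℝ)) x := by
  induction P using MvPolynomial.induction_on with
  | C a =>
    have : polyFun (MvPolynomial.C a : MvPolynomial (Fin d) ℝ) = fun _ => a := by
      funext y; simp [polyFun]
    rw [this]
    refine (hasFDerivAt_const a x).congr_fderiv ?_
    simp [polyFun]
  | add p q hp hq =>
    have : polyFun (p + q) = fun y => polyFun p y + polyFun q y := by
      funext y; simp [polyFun]
    rw [this]
    refine (hp.add hq).congr_fderiv ?_
    rw [← Finset.sum_add_distrib]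
    refine Finset.sum_congr rfl fun j _ => ?_
    rw [← add_smul]; simp [polyFun]
  | mul_X p i hp =>
    have : polyFun (p * MvPolynomial.X i) = fun y => polyFun p y * y i := by
      funext y; simp [polyFun]
    rw [this]
    have hX : HasFDerivAt (fun y : Space d => y i) (EuclideanSpace.proj i : Space d →L[ℝ] ℝ) x :=
      (EuclideanSpace.proj i : Space d →L[ℝ] ℝ).hasFDerivAt
    refine (hp.mul hX).congr_fderiv ?_
    ext h
    have hj : ∀ j, polyFun (MvPolynomial.pderiv j (p * MvPolynomial.X i)) x * h j
        = x i * (polyFun (MvPolynomial.pderiv j p) x * h j)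
          + if i = j then polyFun p x * h i else 0 := by
      intro j
      rw [MvPolynomial.pderiv_mul, MvPolynomial.pderiv_X]
      by_cases hij : i = j
      · subst hij
        simp only [polyFun, map_add, map_mul, MvPolynomial.eval_X, Pi.single_eq_same, map_one,
          if_true]
        ring
      · simp only [polyFun, map_add, map_mul, MvPolynomial.eval_X, hij, if_false]
        rw [Pi.single_eq_of_ne (by exact hij), map_zero]
        ring
    simp only [add_apply, smul_apply, sum_apply, smul_eq_mul]
    change polyFun p x * h i + x i * ∑ j, polyFun (MvPolynomial.pderiv j p) x * h j
      = ∑ j, polyFun (MvPolynomial.pderiv j (p * MvPolynomial.X i)) x * h j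
    simp only [hj, Finset.sum_add_distrib, Finset.sum_ite_eq, Finset.mem_univ, if_true,
      Finset.mul_sum]
    ring

lemma continuous_polyFun (P : MvPolynomial (Fin d) ℝ) : Continuous (polyFun P) :=
  continuous_iff_continuousAt.mpr fun x => (hasFDerivAt_polyFun P x).continuousAt

lemma fderiv_polyFun (P : MvPolynomial (Fin d) ℝ) (x : Space d) (j : Fin d) :
    fderiv ℝ (polyFun P) x (EuclideanSpace.single j 1) = polyFun (MvPolynomial.pderiv j P) x := by
  rw [(hasFDerivAt_polyFun P x).fderiv]
  simp

lemma hasDerivAt_polyFun_insCoord {m : ℕ} (P : MvPolynomial (Fin (m + 1)) ℝ) (j : Fin (m + 1))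
    (x : Space (m + 1)) : HasDerivAt (fun s => polyFun P (insCoord j s (dropCoord j x)))
      (polyFun (MvPolynomial.pderiv j P) x) (x j) := by
  have h1 : HasDerivAt (fun s : ℝ => insCoord j s (dropCoord j x))
      (EuclideanSpace.single j 1) (x j) := by
    have : (fun s : ℝ => insCoord j s (dropCoord j x))
        = fun s => insCoord j 0 (dropCoord j x) + s • EuclideanSpace.single j (1 : ℝ) := by
      funext s
      ext i
      refine Fin.succAboveCases j ?_ (fun i => ?_) i <;> simp
    rw [this]
    simpa using ((hasDerivAt_id (x j)).smul_const
      (EuclideanSpace.single j (1 : ℝ))).const_add (insCoord j 0 (dropCoord j x))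
  have h2 := hasFDerivAt_polyFun P (insCoord j (x j) (dropCoord j x))
  have h3 := h2.comp_hasDerivAt (x j) h1
  rw [insCoord_dropCoord] at h3
  refine h3.congr_deriv ?_
  rw [← fderiv_polyFun, (hasFDerivAt_polyFun P x).fderiv]

lemma totalDegree_pderiv_le (P : MvPolynomial (Fin d) ℝ) (j : Fin d) :
    (MvPolynomial.pderiv j P).totalDegree ≤ P.totalDegree := by
  conv_lhs => rw [MvPolynomial.as_sum P, map_sum]
  refine MvPolynomial.totalDegree_finsetSum_le fun s hs => ?_
  rw [MvPolynomial.pderiv_monomial]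
  refine (MvPolynomial.totalDegree_monomial_le _ _).trans ?_
  refine le_trans ?_ (MvPolynomial.le_totalDegree hs)
  exact Finsupp.degree_mono (σ := Fin d) (R := ℕ) (tsub_le_self (a := s) (b := Finsupp.single j 1))

/-! ### Polynomials determined by their values on a set with interior. -/

/-- A polynomial that vanishes on a set with interior is zero. -/
lemma eq_zero_of_polyFun_eq_zero {P : MvPolynomial (Fin d) ℝ} {K : Set (Space d)}
    (hK : (interior K).Nonempty) (h : ∀ x ∈ interior K, polyFun P x = 0) : P = 0 := by
  obtain ⟨x, hx⟩ := hK
  have hopen : IsOpen ((WithLp.toLp 2 : (Fin d → ℝ) → Space d) ⁻¹' interior K) :=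
    isOpen_interior.preimage (PiLp.continuous_toLp 2 _)
  obtain ⟨ε, hε, hball⟩ := Metric.isOpen_iff.mp hopen x.ofLp (by simpa using hx)
  refine MvPolynomial.funext_set (fun i => Metric.ball (x i) ε) (fun i => ?_) fun y hy => ?_
  · rw [Real.ball_eq_Ioo]; exact Set.Ioo_infinite (by linarith)
  · have hy' : y ∈ Metric.ball x.ofLp ε := by
      rw [ball_pi _ hε]; exact hy
    simpa [polyFun] using h _ (hball hy')

/-- `L²` projections onto polynomials exist. -/
lemma exists_projection (k : ℕ) {K : Set (Space d)} (hK : IsCompact K)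
    (hint : (interior K).Nonempty) {f : Space d → ℝ} (hf : ContinuousOn f K) :
    ∃ P : MvPolynomial (Fin d) ℝ, P.totalDegree ≤ k ∧
      ∀ Q : MvPolynomial (Fin d) ℝ, Q.totalDegree ≤ k →
        ∫ x in K, (f x - polyFun P x) * polyFun Q x = 0 := by
  set V := MvPolynomial.restrictTotalDegree (Fin d) ℝ k with hV
  have hpi : ∀ P Q : MvPolynomial (Fin d) ℝ,
      IntegrableOn (fun x => polyFun P x * polyFun Q x) K := fun P Q =>
    ((continuous_polyFun P).mul (continuous_polyFun Q)).continuousOn.integrableOn_compact hK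
  have hfi : ∀ Q : MvPolynomial (Fin d) ℝ,
      IntegrableOn (fun x => f x * polyFun Q x) K := fun Q =>
    (hf.mul (continuous_polyFun Q).continuousOn).integrableOn_compact hK
  have padd : ∀ (P Q : MvPolynomial (Fin d) ℝ) x, polyFun (P + Q) x = polyFun P x + polyFun Q x :=
    fun P Q x => by simp [polyFun]
  have psmul : ∀ (a : ℝ) (Q : MvPolynomial (Fin d) ℝ) x, polyFun (a • Q) x = a * polyFun Q x :=
    fun a Q x => by simp [polyFun, MvPolynomial.smul_eval]
  let B : V →ₗ[ℝ] Module.Dual ℝ V := LinearMap.mk₂ ℝ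
    (fun P Q => ∫ x in K, polyFun P.1 x * polyFun Q.1 x)
    (fun P P' Q => by
      rw [← integral_add (hpi _ _) (hpi _ _)]
      simp only [Submodule.coe_add, padd, add_mul])
    (fun a P Q => by
      rw [smul_eq_mul, ← integral_const_mul]
      simp only [Submodule.coe_smul, psmul, mul_assoc])
    (fun P Q Q' => by
      rw [← integral_add (hpi _ _) (hpi _ _)]
      simp only [Submodule.coe_add, padd, mul_add])
    (fun a P Q => by
      rw [smul_eq_mul, ← integral_const_mul]
      simp only [Submodule.coe_smul, psmul, mul_left_comm])
  let ℓ : Module.Dual ℝ V :=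
    { toFun := fun Q => ∫ x in K, f x * polyFun Q.1 x
      map_add' := fun Q Q' => by
        rw [← integral_add (hfi _) (hfi _)]
        simp only [Submodule.coe_add, padd, mul_add]
      map_smul' := fun a Q => by
        rw [RingHom.id_apply, smul_eq_mul, ← integral_const_mul]
        simp only [Submodule.coe_smul, psmul, mul_left_comm] }
  -- The L² form is definite: a polynomial that vanishes almost everywhere on K vanishes on its
  -- interior and is zero. In finite dimension injectivity then gives surjectivity onto the dual, so
  -- ℓ is represented.
  have hinj : Function.Injective B := by
    rw [← LinearMap.ker_eq_bot, LinearMap.ker_eq_bot']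
    intro P hP
    have h0 : ∫ x in K, polyFun P.1 x * polyFun P.1 x = 0 := congrArg (fun L => L P) hP
    have h1 := (setIntegral_eq_zero_iff_of_nonneg_ae
      (Filter.Eventually.of_forall fun x => mul_self_nonneg _) (hpi P.1 P.1)).mp h0
    refine Subtype.ext (eq_zero_of_polyFun_eq_zero hint fun x hx => ?_)
    have h2 : ∀ᵐ x ∂(volume.restrict (interior K)), polyFun P.1 x * polyFun P.1 x = 0 :=
      ae_restrict_of_ae_restrict_of_subset interior_subset h1
    have h3 := Measure.eqOn_open_of_ae_eq (μ := volume) (f := fun x => polyFun P.1 x * polyFun P.1 x)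
      (g := fun _ => 0) h2 isOpen_interior
      ((continuous_polyFun P.1).mul (continuous_polyFun P.1)).continuousOn continuousOn_const
    simpa using h3 hx
  have hsurj : Function.Surjective B :=
    (LinearMap.injective_iff_surjective_of_finrank_eq_finrank
      (Subspace.dual_finrank_eq (K := ℝ) (V := V)).symm).mp hinj
  obtain ⟨P, hP⟩ := hsurj ℓ
  refine ⟨P.1, (MvPolynomial.mem_restrictTotalDegree _ _ _).mp P.2, fun Q hQ => ?_⟩
  have h : ∫ x in K, polyFun P.1 x * polyFun Q x = ∫ x in K, f x * polyFun Q x :=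
    congrArg (fun L => L ⟨Q, (MvPolynomial.mem_restrictTotalDegree _ _ _).mpr hQ⟩) hP
  simp only [sub_mul]
  rw [integral_sub (hfi Q) (hpi _ _), h, sub_self]

/-- A family of polynomials on `K` whose values are differentiable in time has differentiable
coefficients with respect to some fixed finite family of polynomials. -/
lemma exists_differentiable_coeffs (k : ℕ) {K : Set (Space d)} (hint : (interior K).Nonempty)
    {t : ℝ} {f : ℝ → Space d → ℝ} (hf : ∀ᶠ τ in nhds t, IsPolyOn k K (f τ))
    (hd : ∀ x ∈ K, DifferentiableAt ℝ (fun τ => f τ x) t) :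
    ∃ (N : ℕ) (c : ℝ → Fin N → ℝ) (b : Fin N → MvPolynomial (Fin d) ℝ),
      (∀ l, DifferentiableAt ℝ (fun τ => c τ l) t) ∧
      ∀ᶠ τ in nhds t, ∀ x ∈ K, f τ x = ∑ l, c τ l * polyFun (b l) x := by
  classical
  set V := MvPolynomial.restrictTotalDegree (Fin d) ℝ k with hV
  let ev : Space d → Module.Dual ℝ V := fun x =>
    (MvPolynomial.aeval (R := ℝ) fun i => x i).toLinearMap.comp V.subtype
  have hev : ∀ x (P : V), ev x P = polyFun P.1 x := fun x P => by
    simp [ev, polyFun, MvPolynomial.aeval_eq_eval]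
  have hP : ∀ τ, ∃ P : V, IsPolyOn k K (f τ) → ∀ x ∈ K, f τ x = polyFun P.1 x := by
    intro τ
    by_cases h : IsPolyOn k K (f τ)
    · obtain ⟨P, hP, hfP⟩ := h
      exact ⟨⟨P, (MvPolynomial.mem_restrictTotalDegree _ _ _).mpr hP⟩, fun _ => hfP⟩
    · exact ⟨0, fun h' => absurd h' h⟩
  choose P hP using hP
  -- No nonzero polynomial is killed by all evaluations at points of K, so these span the dual.
  -- Every coefficient is thus a finite combination of point values and inherits their
  -- differentiability.
  have hspan : Submodule.span ℝ (ev '' K) = ⊤ := by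
    refine Submodule.span_eq_top_of_ne_zero fun Q hQ => ?_
    by_contra! hc
    refine hQ (Subtype.ext (eq_zero_of_polyFun_eq_zero hint fun x hx => ?_))
    rw [← hev]
    exact hc _ ⟨x, interior_subset hx, rfl⟩
  have hdiff : ∀ φ : Module.Dual ℝ V, DifferentiableAt ℝ (fun τ => φ (P τ)) t := by
    intro φ
    have hφ : φ ∈ Submodule.span ℝ (ev '' K) := hspan ▸ Submodule.mem_top
    induction hφ using Submodule.span_induction with
    | mem φ hφ =>
      obtain ⟨x, hx, rfl⟩ := hφ
      refine (hd x hx).congr_of_eventuallyEq ?_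
      filter_upwards [hf] with τ hτ
      rw [hev, hP τ hτ x hx]
    | zero => simp
    | add φ ψ _ _ h1 h2 => exact h1.add h2
    | smul a φ _ h => exact h.const_smul a
  let b := Module.finBasis ℝ V
  refine ⟨Module.finrank ℝ V, fun τ l => b.coord l (P τ), fun l => (b l).1,
    fun l => hdiff (b.coord l), ?_⟩
  filter_upwards [hf] with τ hτ x hx
  rw [hP τ hτ x hx, ← hev]
  conv_lhs => rw [← b.sum_repr (P τ), map_sum]
  refine Finset.sum_congr rfl fun l _ => ?_
  rw [map_smul, hev]; rfl

end Poly
end HDG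

end

noncomputable section
namespace HDG

/-! ### Time derivative of the entropy of an element -/

section TimeDeriv
variable {d : ℕ} (g : PerfectGas)

lemma continuousOn_genEntropy :
    ContinuousOn (fun v => genEntropy g (consVars g v)) (physV g : Set (State d)) := by
  have h : ContinuousOn (fun v : State d => v ⬝ᵥ consVars g v - (g.γ - 1) * consVars g v 0)
      (physV g) := by
    have hc := continuousOn_pi.mp (continuousOn_consVars (d := d) g)
    refine ContinuousOn.sub (continuousOn_finsetSum _ fun i _ => ?_)
      (continuousOn_const.mul (hc 0))
    exact (continuous_apply i).continuousOn.mul (hc i)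
  refine h.congr fun v hv => ?_
  have h1 := dotProduct_consVars g (consVars_mem g hv)
  rw [entropyVars_consVars g ((mem_physV g).mp hv)] at h1
  simp only [h1, fstVar]
  ring

/-- `H(u(v))` is uniformly Lipschitz at the points of a compact set of physical states. -/
lemma exists_lipschitz_genEntropy {Z : Set (State d)} (hZ : IsCompact Z) (hZp : Z ⊆ physV g) :
    ∃ C δ : ℝ, 0 < δ ∧ ∀ z ∈ Z, ∀ w, ‖w - z‖ ≤ δ →
      w ∈ physV g ∧ |genEntropy g (consVars g w) - genEntropy g (consVars g z)| ≤ C * ‖w - z‖ := by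
  -- On a compact thickening that stays physical the derivative of H(u(v)) is bounded. The segment
  -- from z to w stays in this thickening, and the mean value inequality applies.
  obtain ⟨δ, hδ, hsub⟩ := hZ.exists_cthickening_subset_open (isOpen_physV g) hZp
  have hcomp : IsCompact (Metric.cthickening δ Z) := hZ.cthickening
  have hφ : ∀ s : Fin (d + 2), ∃ B, ∀ z ∈ Metric.cthickening δ Z, ‖∑ l, z l * A0 g z l s‖ ≤ B := by
    intro s
    refine hcomp.exists_bound_of_continuousOn (continuousOn_finsetSum _ fun l _ => ?_)
    exact (continuous_apply l).continuousOn.mul ((continuousOn_A0 g l s).mono hsub)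
  choose B hB using hφ
  refine ⟨∑ s, B s, δ, hδ, fun z hz w hw => ?_⟩
  have hball : ∀ θ ∈ Set.Icc (0 : ℝ) 1, z + θ • (w - z) ∈ Metric.cthickening δ Z := by
    intro θ hθ
    refine Metric.closedBall_subset_cthickening hz δ ?_
    rw [Metric.mem_closedBall, dist_eq_norm, add_sub_cancel_left, norm_smul, Real.norm_eq_abs,
      abs_of_nonneg hθ.1]
    exact (mul_le_of_le_one_left (norm_nonneg _) hθ.2).trans hw
  refine ⟨hsub (by simpa using hball 1 ⟨zero_le_one, le_rfl⟩), ?_⟩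
  have hseg : ∀ θ : ℝ, HasDerivAt (fun θ : ℝ => z + θ • (w - z)) (w - z) θ := fun θ => by
    simpa using ((hasDerivAt_id θ).smul_const (w - z)).const_add z
  have hbound := norm_image_sub_le_of_norm_deriv_le_segment_01'
    (f := fun θ : ℝ => genEntropy g (consVars g (z + θ • (w - z))))
    (f' := fun θ => (z + θ • (w - z)) ⬝ᵥ (A0 g (z + θ • (w - z))).mulVec (w - z))
    (C := (∑ s, B s) * ‖w - z‖)
    (fun θ hθ => (hasDerivAt_genEntropy g (hseg θ) (hsub (hball θ hθ))).hasDerivWithinAt)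
    (fun θ hθ => ?_)
  · simpa using hbound
  · have hy := hball θ ⟨hθ.1, hθ.2.le⟩
    set y := z + θ • (w - z)
    rw [Matrix.dotProduct_mulVec, Finset.sum_mul]
    refine (norm_sum_le _ _).trans (Finset.sum_le_sum fun s _ => ?_)
    rw [norm_mul]
    exact mul_le_mul (hB s y hy) (norm_le_pi_norm (w - z) s) (norm_nonneg _)
      ((norm_nonneg _).trans (hB s y hy))

/-- Differentiability in time is assumed at each x separately. Through the finitely many polynomial
coefficients it yields an estimate |v(τ) - v(t)| ≤ C|τ - t| uniform in x, which supplies the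
dominating function. Physicality is assumed at time t only. -/
lemma hasDerivAt_integral_genEntropy {K : Set (Space d)} (hK : IsCompact K)
    (hint : (interior K).Nonempty) (k : ℕ) {t : ℝ} {v : ℝ → Space d → State d}
    (hv : ∀ᶠ τ in nhds t, ∀ i, IsPolyOn k K fun x => v τ x i)
    (hd : ∀ x ∈ K, DifferentiableAt ℝ (fun τ => v τ x) t) (hphys : ∀ x ∈ K, v t x ∈ physV g) :
    HasDerivAt (fun τ => ∫ x in K, genEntropy g (consVars g (v τ x)))
      (∫ x in K, deriv (fun τ => consVars g (v τ x)) t ⬝ᵥ v t x) t := by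
  have hcoef := fun i => exists_differentiable_coeffs k hint
    (f := fun τ x => v τ x i) (hv.mono fun τ h => h i)
    (fun x hx => differentiableAt_pi.mp (hd x hx) i)
  choose N c b hc hvc using hcoef
  have hvc' : ∀ᶠ τ in nhds t, ∀ x ∈ K, ∀ i, v τ x i = ∑ l, c i τ l * polyFun (b i l) x := by
    filter_upwards [Filter.eventually_all.mpr hvc] with τ h x hx i using h i x hx
  have hcont : ∀ {τ}, (∀ x ∈ K, ∀ i, v τ x i = ∑ l, c i τ l * polyFun (b i l) x) →
      ContinuousOn (v τ) K := fun {τ} h =>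
    continuousOn_pi.mpr fun i => ContinuousOn.congr (f := fun x => ∑ l, c i τ l * polyFun (b i l) x)
      (continuousOn_finsetSum _ fun l _ => continuousOn_const.mul (continuous_polyFun (b i l)).continuousOn)
      fun x hx => h x hx i
  have ht := hvc'.self_of_nhds
  have hvt := hcont ht
  have hder : ∀ x ∈ K, HasDerivAt (fun τ => v τ x)
      (fun i => ∑ l, deriv (fun τ => c i τ l) t * polyFun (b i l) x) t := by
    intro x hx
    refine hasDerivAt_pi.mpr fun i => ?_
    refine HasDerivAt.congr_of_eventuallyEq (f := fun τ => ∑ l, c i τ l * polyFun (b i l) x)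
      (HasDerivAt.fun_sum fun l _ => (hc i l).hasDerivAt.mul_const _) ?_
    filter_upwards [hvc'] with τ h using h x hx i
  have hLip : ∃ C, ∀ᶠ τ in nhds t, ∀ x ∈ K, ‖v τ x - v t x‖ ≤ C * |τ - t| := by
    have hP : ∀ i l, ∃ B, ∀ x ∈ K, ‖polyFun (b i l) x‖ ≤ B := fun i l =>
      hK.exists_bound_of_continuousOn (continuous_polyFun _).continuousOn
    choose B hB using hP
    have hC : ∀ i l, ∃ A, 0 ≤ A ∧ ∀ᶠ τ in nhds t, |c i τ l - c i t l| ≤ A * |τ - t| := by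
      intro i l
      obtain ⟨A, hA, h⟩ := (hc i l).hasDerivAt.isBigO_sub.exists_nonneg
      exact ⟨A, hA, h.bound⟩
    choose A hA0 hA using hC
    refine ⟨∑ i, ∑ l, A i l * |B i l|, ?_⟩
    filter_upwards [hvc', Filter.eventually_all.mpr fun i => Filter.eventually_all.mpr (hA i)]
      with τ hτ hAτ x hx
    have hrow : ∀ i, 0 ≤ ∑ l, A i l * |B i l| := fun i =>
      Finset.sum_nonneg fun l _ => mul_nonneg (hA0 i l) (abs_nonneg _)
    refine (pi_norm_le_iff_of_nonneg (mul_nonneg (Finset.sum_nonneg fun i _ => hrow i)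
      (abs_nonneg _))).mpr fun i => ?_
    refine le_trans ?_ (mul_le_mul_of_nonneg_right
      (Finset.single_le_sum (fun i _ => hrow i) (Finset.mem_univ i)) (abs_nonneg _))
    rw [Pi.sub_apply, hτ x hx i, ht x hx i, ← Finset.sum_sub_distrib, Finset.sum_mul]
    refine (norm_sum_le _ _).trans (Finset.sum_le_sum fun l _ => ?_)
    rw [← sub_mul, norm_mul, mul_right_comm]
    exact mul_le_mul (hAτ i l) ((hB i l x hx).trans (le_abs_self _)) (norm_nonneg _)
      (mul_nonneg (hA0 i l) (abs_nonneg _))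
  obtain ⟨C, hC⟩ := hLip
  obtain ⟨L, δ, hδ, hL⟩ := exists_lipschitz_genEntropy g (hK.image_of_continuousOn hvt)
    (Set.image_subset_iff.mpr hphys)
  have hsmall : ∀ᶠ τ in nhds t, C * |τ - t| ≤ δ := by
    have : Filter.Tendsto (fun τ => C * |τ - t|) (nhds t) (nhds (C * |t - t|)) :=
      (by fun_prop : Continuous fun τ => C * |τ - t|).tendsto t
    rw [sub_self, abs_zero, mul_zero] at this
    exact (this.eventually_lt_const hδ).mono fun _ h => h.le
  -- At these times v(τ) lies within δ of v(t) on K, hence is physical too, and the integrand is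
  -- continuous on K.
  have hgood := hvc'.and (hC.and hsmall)
  have hH : ContinuousOn (fun x => genEntropy g (consVars g (v t x))) K :=
    (continuousOn_genEntropy g).comp hvt hphys
  have hf' : ∀ x ∈ K, HasDerivAt (fun τ => genEntropy g (consVars g (v τ x)))
      (deriv (fun τ => consVars g (v τ x)) t ⬝ᵥ v t x) t := by
    intro x hx
    rw [(hasDerivAt_consVars g (hder x hx) (hphys x hx)).deriv, dotProduct_comm]
    exact hasDerivAt_genEntropy g (hder x hx) (hphys x hx)
  have hf'c : ContinuousOn (fun x => deriv (fun τ => consVars g (v τ x)) t ⬝ᵥ v t x) K := by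
    refine ContinuousOn.congr (f := fun x => ∑ i, (∑ s, A0 g (v t x) i s *
      ∑ l, deriv (fun τ => c s τ l) t * polyFun (b s l) x) * v t x i)
      (continuousOn_finsetSum _ fun i _ => ContinuousOn.mul
        (continuousOn_finsetSum _ fun s _ => ContinuousOn.mul
          ((continuousOn_A0 g i s).comp hvt hphys)
          (continuousOn_finsetSum _ fun l _ =>
            continuousOn_const.mul (continuous_polyFun (b s l)).continuousOn))
        (continuousOn_pi.mp hvt i)) fun x hx => ?_
    simp only [(hasDerivAt_consVars g (hder x hx) (hphys x hx)).deriv]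
    rfl
  have key := hasFDerivAt_integral_of_dominated_loc_of_lip' (𝕜 := ℝ) (μ := volume.restrict K)
    (F := fun τ x => genEntropy g (consVars g (v τ x)))
    (F' := fun x => ContinuousLinearMap.toSpanSingleton ℝ
      (deriv (fun τ => consVars g (v τ x)) t ⬝ᵥ v t x))
    (bound := fun _ => |L| * |C|) hgood (fun τ hτ => ?_)
    (hH.integrableOn_compact hK) ?_ ?_ ?_ ?_
  · have h2 := key.2.hasDerivAt
    rw [ContinuousLinearMap.integral_apply key.1] at h2
    simpa using h2
  · obtain ⟨h1, h2, h3⟩ := hτ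
    refine ContinuousOn.aestronglyMeasurable ?_ hK.measurableSet
    refine (continuousOn_genEntropy g).comp (hcont h1) fun x hx => ?_
    exact (hL _ ⟨x, hx, rfl⟩ _ ((h2 x hx).trans h3)).1
  · exact ContinuousOn.aestronglyMeasurable ((ContinuousLinearMap.toSpanSingletonCLE
      (𝕜 := ℝ) (E := ℝ)).continuous.comp_continuousOn hf'c) hK.measurableSet
  · refine (ae_restrict_iff' hK.measurableSet).mpr (Filter.Eventually.of_forall fun x hx τ hτ => ?_)
    obtain ⟨h1, h2, h3⟩ := hτ
    refine (hL _ ⟨x, hx, rfl⟩ _ ((h2 x hx).trans h3)).2.trans ?_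
    rw [mul_assoc]
    refine mul_le_mul (le_abs_self L) ((h2 x hx).trans ?_) (norm_nonneg _) (abs_nonneg _)
    exact mul_le_mul_of_nonneg_right (le_abs_self C) (abs_nonneg _)
  · exact integrableOn_const (hK.measure_lt_top.ne)
  · refine (ae_restrict_iff' hK.measurableSet).mpr (Filter.Eventually.of_forall fun x hx => ?_)
    exact (hf' x hx).hasFDerivAt

end TimeDeriv
end HDG

end

noncomputable section
namespace HDG

/-! ### Integration by parts on an element -/

lemma frob_eq {d : ℕ} (A B : Grad d) : frob A B = ∑ j, ∑ i, A i j * B i j := by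
  simp [frob, Matrix.trace, Matrix.mul_apply]

/-- The vector of polynomial functions of a vector of polynomials. -/
def polyState {d : ℕ} (P : Fin (d + 2) → MvPolynomial (Fin d) ℝ) (x : Space d) : State d :=
  fun i => polyFun (P i) x

lemma continuous_polyState {d : ℕ} (P : Fin (d + 2) → MvPolynomial (Fin d) ℝ) :
    Continuous (polyState P) :=
  continuous_pi fun i => continuous_polyFun (P i)

lemma grad_eq_of_mem_interior {d : ℕ} {P : Fin (d + 2) → MvPolynomial (Fin d) ℝ}
    {v : Space d → State d} {K : Set (Space d)} (hv : ∀ x ∈ K, v x = polyState P x) {x : Space d}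
    (hx : x ∈ interior K) :
    grad v x = Matrix.of fun i j => polyFun (MvPolynomial.pderiv j (P i)) x := by
  ext i j
  have : (fun y => v y i) =ᶠ[nhds x] polyFun (P i) :=
    Filter.mem_of_superset (mem_interior_iff_mem_nhds.mp hx) fun y hy => congrFun (hv y hy) i
  simp only [grad, Matrix.of_apply]
  rw [this.fderiv_eq, fderiv_polyFun]

/-- The functions of the scheme are prescribed on the closed element only, so `grad`, which uses
`fderiv`, is known only in the interior. The frontier of a convex set is null and may be ignored. -/
lemma setIntegral_congr_interior {d : ℕ} {K : Set (Space d)} (hK : IsCompact K)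
    (hconv : Convex ℝ K) {f f' : Space d → ℝ} (h : ∀ x ∈ interior K, f x = f' x) :
    ∫ x in K, f x = ∫ x in K, f' x := by
  refine setIntegral_congr_ae hK.measurableSet ?_
  have h0 : ∀ᵐ x : Space d, x ∉ frontier K :=
    measure_eq_zero_iff_ae_notMem.mp (hconv.addHaar_frontier volume)
  filter_upwards [h0] with x hx hxK
  refine h x ?_
  by_contra hi
  exact hx ⟨subset_closure hxK, hi⟩

lemma hasDerivAt_polyState_insCoord {m : ℕ} (P : Fin (m + 3) → MvPolynomial (Fin (m + 1)) ℝ)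
    (j : Fin (m + 1)) (x : Space (m + 1)) :
    HasDerivAt (fun s => (polyState P (insCoord j s (dropCoord j x)) : State (m + 1)))
      (fun i => polyFun (MvPolynomial.pderiv j (P i)) x) (x j) :=
  hasDerivAt_pi.mpr fun i => hasDerivAt_polyFun_insCoord (P i) j x

namespace Mesh

variable {m : ℕ} {ι : Type} [Fintype ι] {Ω : Set (Space (m + 1))} (M : Mesh (m + 1) ι Ω)

/-- The inviscid flux against the gradient of the entropy variables is a divergence. -/
lemma integral_frob_inviscidFlux (g : PerfectGas) (hΩ : interior (closure Ω) = Ω) (K : ι)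
    {v : Space (m + 1) → State (m + 1)} {P : Fin (m + 3) → MvPolynomial (Fin (m + 1)) ℝ}
    (hv : ∀ x ∈ M.carrier K, v x = polyState P x) (hp : ∀ x ∈ M.carrier K, v x ∈ physV g) :
    ∫ x in M.carrier K, frob (inviscidFlux g (consVars g (v x))) (grad v x)
      = ∑ F ∈ M.elemFaces K, ∫ x in F, normalPotential g (v x) (M.normal K F)
          ∂(μHE[m] : Measure (Space (m + 1))) := by
  have hK := M.isCompact_carrier K
  have hp' : ∀ x ∈ M.carrier K, polyState P x ∈ physV g := fun x hx => hv x hx ▸ hp x hx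
  have hcP : ContinuousOn (polyState P) (M.carrier K) := (continuous_polyState P).continuousOn
  have hdiv := (M.flatBoundary hΩ K).integral_div hK (M.convex_carrier K)
    (M.interior_carrier_nonempty K)
    (f := fun j x => (g.γ - 1) * midVar (consVars g (polyState P x)) j)
    (f' := fun j x => (fun i => polyFun (MvPolynomial.pderiv j (P i)) x) ⬝ᵥ
      fun i => inviscidFlux g (consVars g (polyState P x)) i j)
    (fun j => continuousOn_const.mul
      (continuousOn_pi.mp ((continuousOn_consVars g).comp hcP hp') _))
    (fun j => continuousOn_finsetSum _ fun i _ => (continuous_polyFun _).continuousOn.mul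
      ((continuousOn_inviscidFlux g i j).comp hcP hp'))
    (fun j x hx => by
      have h1 := hasDerivAt_potential g (hasDerivAt_polyState_insCoord P j x)
        ((mem_physV g).mp (by rw [insCoord_dropCoord]; exact hp' x hx)) j
      simpa only [insCoord_dropCoord] using h1)
  calc ∫ x in M.carrier K, frob (inviscidFlux g (consVars g (v x))) (grad v x)
      = ∫ x in M.carrier K, ∑ j, (fun i => polyFun (MvPolynomial.pderiv j (P i)) x) ⬝ᵥ
          fun i => inviscidFlux g (consVars g (polyState P x)) i j := by
        refine setIntegral_congr_interior hK (M.convex_carrier K) fun x hx => ?_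
        rw [frob_eq, grad_eq_of_mem_interior hv hx, hv x (interior_subset hx)]
        refine Finset.sum_congr rfl fun j _ => Finset.sum_congr rfl fun i _ => ?_
        exact mul_comm _ _
    _ = _ := hdiv
    _ = _ := by
        refine Finset.sum_congr rfl fun F hF => ?_
        have hF' := M.mem_elemFaces.mp hF
        refine setIntegral_congr_fun (M.isCompact_face hF'.1).measurableSet fun x hx => ?_
        simp only [normalPotential]
        rw [hv x (M.frontier_subset_carrier K (hF'.2 hx))]

/-- Polynomial formulas for r are required on all of space, so that `divg r` is known up to the
boundary of the element. The entries of `projQ` satisfy this. -/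
lemma integral_dotProduct_divg (hΩ : interior (closure Ω) = Ω) (K : ι)
    {v : Space (m + 1) → State (m + 1)} {P : Fin (m + 3) → MvPolynomial (Fin (m + 1)) ℝ}
    (hv : ∀ x ∈ M.carrier K, v x = polyState P x)
    {r : Space (m + 1) → Grad (m + 1)}
    {R : Fin (m + 3) → Fin (m + 1) → MvPolynomial (Fin (m + 1)) ℝ}
    (hr : ∀ x i j, r x i j = polyFun (R i j) x) :
    ∫ x in M.carrier K, v x ⬝ᵥ divg r x
      = -(∫ x in M.carrier K, frob (r x) (grad v x))
        + ∑ F ∈ M.elemFaces K, ∫ x in F, v x ⬝ᵥ (r x).mulVec (fun j => M.normal K F j)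
          ∂(μHE[m] : Measure (Space (m + 1))) := by
  have hK := M.isCompact_carrier K
  let DP : Fin (m + 3) → Fin (m + 1) → Space (m + 1) → ℝ :=
    fun i j => polyFun (MvPolynomial.pderiv j (P i))
  let DR : Fin (m + 3) → Fin (m + 1) → Space (m + 1) → ℝ :=
    fun i j => polyFun (MvPolynomial.pderiv j (R i j))
  have hdiv := (M.flatBoundary hΩ K).integral_div hK (M.convex_carrier K)
    (M.interior_carrier_nonempty K)
    (f := fun j x => ∑ i, polyFun (P i) x * polyFun (R i j) x)
    (f' := fun j x => ∑ i, (DP i j x * polyFun (R i j) x + polyFun (P i) x * DR i j x))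
    (fun j => (continuous_finsetSum _ fun i _ =>
      (continuous_polyFun _).mul (continuous_polyFun _)).continuousOn)
    (fun j => (continuous_finsetSum _ fun i _ =>
      ((continuous_polyFun _).mul (continuous_polyFun _)).add
        ((continuous_polyFun _).mul (continuous_polyFun _))).continuousOn)
    (fun j x hx => by
      have h1 := fun i => (hasDerivAt_polyFun_insCoord (P i) j x).fun_mul
        (hasDerivAt_polyFun_insCoord (R i j) j x)
      have h2 := HasDerivAt.fun_sum (u := Finset.univ) fun i _ => h1 i
      simpa only [insCoord_dropCoord] using h2)
  have h1 : ∫ x in M.carrier K, v x ⬝ᵥ divg r x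
      = ∫ x in M.carrier K, ∑ j, ∑ i, polyFun (P i) x * DR i j x := by
    refine setIntegral_congr_fun hK.measurableSet fun x hx => ?_
    have hr' : ∀ i j, (fun y => r y i j) = polyFun (R i j) := fun i j => funext fun y => hr y i j
    simp only [hv x hx, dotProduct, divg, hr', fderiv_polyFun, Finset.mul_sum, polyState]
    exact Finset.sum_comm
  have h2 : ∫ x in M.carrier K, frob (r x) (grad v x)
      = ∫ x in M.carrier K, ∑ j, ∑ i, DP i j x * polyFun (R i j) x := by
    refine setIntegral_congr_interior hK (M.convex_carrier K) fun x hx => ?_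
    rw [frob_eq, grad_eq_of_mem_interior hv hx]
    refine Finset.sum_congr rfl fun j _ => Finset.sum_congr rfl fun i _ => ?_
    rw [hr, mul_comm]; rfl
  have h3 : ∀ F ∈ M.elemFaces K, ∫ x in F, v x ⬝ᵥ (r x).mulVec (fun j => M.normal K F j)
      ∂(μHE[m] : Measure (Space (m + 1)))
      = ∫ x in F, ∑ j, (∑ i, polyFun (P i) x * polyFun (R i j) x) * M.normal K F j
        ∂(μHE[m] : Measure (Space (m + 1))) := by
    intro F hF
    have hF' := M.mem_elemFaces.mp hF
    refine setIntegral_congr_fun (M.isCompact_face hF'.1).measurableSet fun x hx => ?_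
    simp only [hv x (M.frontier_subset_carrier K (hF'.2 hx)), dotProduct, Matrix.mulVec, hr,
      polyState, Finset.mul_sum, Finset.sum_mul, ← mul_assoc]
    exact Finset.sum_comm
  rw [h1, h2, Finset.sum_congr rfl h3, ← hdiv, ← sub_eq_neg_add, ← integral_sub]
  · refine integral_congr_ae (Filter.Eventually.of_forall fun x => ?_)
    simp only [Finset.sum_add_distrib]
    ring
  · exact (continuous_finsetSum _ fun j _ => continuous_finsetSum _ fun i _ =>
      ((continuous_polyFun _).mul (continuous_polyFun _)).add
        ((continuous_polyFun _).mul (continuous_polyFun _))).continuousOn.integrableOn_compact hK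
  · exact (continuous_finsetSum _ fun j _ => continuous_finsetSum _ fun i _ =>
      (continuous_polyFun _).mul (continuous_polyFun _)).continuousOn.integrableOn_compact hK

/-! ### The projection on one element. -/

/-- Entries of the `L²` projection. -/
lemma totalDegree_projScalar_le (k : ℕ) (K : ι) (f : Space (m + 1) → ℝ) :
    (projScalar M k K f).totalDegree ≤ k := by
  unfold projScalar
  split_ifs with h
  · exact h.choose_spec.1
  · simp

lemma integral_projScalar_mul (k : ℕ) (K : ι) {f : Space (m + 1) → ℝ}
    (hf : ContinuousOn f (M.carrier K)) {Q : MvPolynomial (Fin (m + 1)) ℝ}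
    (hQ : Q.totalDegree ≤ k) :
    ∫ x in M.carrier K, polyFun (projScalar M k K f) x * polyFun Q x
      = ∫ x in M.carrier K, f x * polyFun Q x := by
  have hK := M.isCompact_carrier K
  have h := exists_projection k hK (M.interior_carrier_nonempty K) hf
  have h2 : ∫ x in M.carrier K, (f x - polyFun (projScalar M k K f) x) * polyFun Q x = 0 := by
    have hdef : projScalar M k K f = h.choose := by unfold projScalar; exact dif_pos h
    rw [hdef]
    exact h.choose_spec.2 Q hQ
  have i1 : IntegrableOn (fun x => f x * polyFun Q x) (M.carrier K) :=
    (hf.mul (continuous_polyFun Q).continuousOn).integrableOn_compact hK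
  have i2 : IntegrableOn (fun x => polyFun (projScalar M k K f) x * polyFun Q x) (M.carrier K) :=
    ((continuous_polyFun _).mul (continuous_polyFun Q)).continuousOn.integrableOn_compact hK
  simp only [sub_mul] at h2
  rw [integral_sub i1 i2, sub_eq_zero] at h2
  exact h2.symm

lemma projQ_mem_spaceQ (k : ℕ) (r : ElemGrad (m + 1) ι) : projQ M k r ∈ spaceQ M k :=
  fun K i j => ⟨_, M.totalDegree_projScalar_le k K fun y => r K y i j, fun _ _ => rfl⟩

/-- Orthogonality of the projection error, needed with W = q_h and with W = ∇v_h. The latter is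
known in the interior only, hence the form of `hW`. -/
lemma integral_frob_projQ (k : ℕ) (K : ι) {r : ElemGrad (m + 1) ι}
    (hr : ∀ i j, ContinuousOn (fun x => r K x i j) (M.carrier K))
    {W : Space (m + 1) → Grad (m + 1)}
    {Q : Fin (m + 3) → Fin (m + 1) → MvPolynomial (Fin (m + 1)) ℝ}
    (hQ : ∀ i j, (Q i j).totalDegree ≤ k)
    (hW : ∀ x ∈ interior (M.carrier K), ∀ i j, W x i j = polyFun (Q i j) x) :
    ∫ x in M.carrier K, frob (projQ M k r K x) (W x)
      = ∫ x in M.carrier K, frob (r K x) (W x) := by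
  have hK := M.isCompact_carrier K
  have hcongr : ∀ A : Space (m + 1) → Grad (m + 1), ∫ x in M.carrier K, frob (A x) (W x)
      = ∫ x in M.carrier K, ∑ j, ∑ i, A x i j * polyFun (Q i j) x := by
    intro A
    refine setIntegral_congr_interior hK (M.convex_carrier K) fun x hx => ?_
    simp only [frob_eq, hW x hx]
  have hsum : ∀ A : Space (m + 1) → Grad (m + 1),
      (∀ i j, ContinuousOn (fun x => A x i j) (M.carrier K)) →
      ∫ x in M.carrier K, ∑ j, ∑ i, A x i j * polyFun (Q i j) x
        = ∑ j, ∑ i, ∫ x in M.carrier K, A x i j * polyFun (Q i j) x := by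
    intro A hA
    have hi : ∀ i j, IntegrableOn (fun x => A x i j * polyFun (Q i j) x) (M.carrier K) :=
      fun i j => ((hA i j).mul (continuous_polyFun _).continuousOn).integrableOn_compact hK
    rw [integral_finsetSum _ fun j _ => integrable_finsetSum _ fun i _ => hi i j]
    exact Finset.sum_congr rfl fun j _ => integral_finsetSum _ fun i _ => hi i j
  rw [hcongr, hcongr, hsum _ hr]
  refine (hsum (projQ M k r K) fun i j => (continuous_polyFun _).continuousOn).trans ?_
  exact Finset.sum_congr rfl fun j _ => Finset.sum_congr rfl fun i _ =>
    M.integral_projScalar_mul k K (hr i j) (hQ i j)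

end Mesh
end HDG

end

noncomputable section
namespace HDG
namespace Mesh

variable {m : ℕ} {ι : Type} [Fintype ι] {Ω : Set (Space (m + 1))} (M : Mesh (m + 1) ι Ω)

/-! ### Face integrals -/

/-- `f K F` is integrable on `F` for the faces `F ∈ S` on the boundary of `K`. -/
def FaceIntegrable (S : Finset (Set (Space (m + 1))))
    (f : ι → Set (Space (m + 1)) → Space (m + 1) → ℝ) : Prop :=
  ∀ K, ∀ F ∈ S, F ⊆ frontier (M.carrier K) →
    IntegrableOn (f K F) F (μHE[m] : Measure (Space (m + 1)))

/-- `f K F` is continuous on `F` for all faces `F` on the boundary of `K`. -/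
def FaceContinuous {E : Type*} [TopologicalSpace E]
    (f : ι → Set (Space (m + 1)) → Space (m + 1) → E) : Prop :=
  ∀ K, ∀ F ∈ M.faces, F ⊆ frontier (M.carrier K) → ContinuousOn (f K F) F

variable {M}

lemma FaceContinuous.faceIntegrable {f : ι → Set (Space (m + 1)) → Space (m + 1) → ℝ}
    (hf : M.FaceContinuous f) (hΩ : interior (closure Ω) = Ω) : M.FaceIntegrable M.faces f := by
  intro K F hF hFK
  exact ContinuousOn.integrableOn_of_subset_isCompact (hf K F hF hFK) (M.isCompact_face hF)
    (M.isCompact_face hF).measurableSet subset_rfl (M.hausdorff_face_lt_top hΩ hF hFK).ne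

lemma FaceIntegrable.mono {S S' : Finset (Set (Space (m + 1)))}
    {f : ι → Set (Space (m + 1)) → Space (m + 1) → ℝ} (hf : M.FaceIntegrable S' f) (h : S ⊆ S') :
    M.FaceIntegrable S f := fun K F hF => hf K F (h hF)

lemma FaceIntegrable.sub {S : Finset (Set (Space (m + 1)))}
    {f f' : ι → Set (Space (m + 1)) → Space (m + 1) → ℝ} (hf : M.FaceIntegrable S f)
    (hf' : M.FaceIntegrable S f') : M.FaceIntegrable S fun K F x => f K F x - f' K F x :=
  fun K F hF hFK => Integrable.sub (hf K F hF hFK) (hf' K F hF hFK)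

lemma FaceContinuous.dotProduct {a b : ι → Set (Space (m + 1)) → Space (m + 1) → State (m + 1)}
    (ha : M.FaceContinuous a) (hb : M.FaceContinuous b) :
    M.FaceContinuous fun K F x => a K F x ⬝ᵥ b K F x := fun K F hF hFK =>
  continuousOn_finsetSum _ fun i _ => (continuousOn_pi.mp (ha K F hF hFK) i).mul
    (continuousOn_pi.mp (hb K F hF hFK) i)

lemma faceInt_add {S : Finset (Set (Space (m + 1)))}
    {f f' : ι → Set (Space (m + 1)) → Space (m + 1) → ℝ} (hf : M.FaceIntegrable S f)
    (hf' : M.FaceIntegrable S f') :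
    M.faceInt S (fun K F x => f K F x + f' K F x) = M.faceInt S f + M.faceInt S f' := by
  classical
  simp only [faceInt]
  rw [← Finset.sum_add_distrib]
  refine Finset.sum_congr rfl fun K _ => ?_
  rw [← Finset.sum_add_distrib]
  refine Finset.sum_congr rfl fun F hF => ?_
  obtain ⟨h1, h2⟩ := Finset.mem_filter.mp hF
  exact integral_add (hf K F h1 h2) (hf' K F h1 h2)

lemma faceInt_sub {S : Finset (Set (Space (m + 1)))}
    {f f' : ι → Set (Space (m + 1)) → Space (m + 1) → ℝ} (hf : M.FaceIntegrable S f)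
    (hf' : M.FaceIntegrable S f') :
    M.faceInt S (fun K F x => f K F x - f' K F x) = M.faceInt S f - M.faceInt S f' := by
  classical
  simp only [faceInt]
  rw [← Finset.sum_sub_distrib]
  refine Finset.sum_congr rfl fun K _ => ?_
  rw [← Finset.sum_sub_distrib]
  refine Finset.sum_congr rfl fun F hF => ?_
  obtain ⟨h1, h2⟩ := Finset.mem_filter.mp hF
  exact integral_sub (hf K F h1 h2) (hf' K F h1 h2)

lemma faceInt_congr {S : Finset (Set (Space (m + 1)))} (hS : S ⊆ M.faces)
    {f f' : ι → Set (Space (m + 1)) → Space (m + 1) → ℝ}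
    (h : ∀ K, ∀ F ∈ S, F ⊆ frontier (M.carrier K) → ∀ x ∈ F, f K F x = f' K F x) :
    M.faceInt S f = M.faceInt S f' := by
  classical
  simp only [faceInt]
  refine Finset.sum_congr rfl fun K _ => Finset.sum_congr rfl fun F hF => ?_
  obtain ⟨h1, h2⟩ := Finset.mem_filter.mp hF
  exact setIntegral_congr_fun (M.isCompact_face (hS h1)).measurableSet (h K F h1 h2)

lemma faceInt_faces (hΩ : interior (closure Ω) = Ω)
    (f : ι → Set (Space (m + 1)) → Space (m + 1) → ℝ) :
    M.faceInt M.faces f = M.faceInt M.interiorFaces f + M.faceInt M.boundaryFaces f := by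
  classical
  simp only [faceInt]
  rw [← Finset.sum_add_distrib]
  refine Finset.sum_congr rfl fun K _ => ?_
  rw [← Finset.sum_union (Finset.disjoint_filter_filter (M.disjoint_faces hΩ)),
    ← Finset.filter_union]
  refine Finset.sum_congr ?_ fun _ _ => rfl
  ext F
  simp only [Finset.mem_filter, M.mem_faces, Finset.mem_union]

/-- Each interior face is seen by exactly two elements, and their contributions cancel. -/
lemma faceInt_interiorFaces_eq_zero {f : ι → Set (Space (m + 1)) → Space (m + 1) → ℝ}
    (h : ∀ K L, K ≠ L → M.carrier K ∩ M.carrier L ∈ M.interiorFaces →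
      ∀ x ∈ M.carrier K ∩ M.carrier L,
        f L (M.carrier K ∩ M.carrier L) x = -f K (M.carrier K ∩ M.carrier L) x) :
    M.faceInt M.interiorFaces f = 0 := by
  classical
  simp only [faceInt, Finset.sum_filter]
  rw [Finset.sum_comm]
  refine Finset.sum_eq_zero fun F hF => ?_
  obtain ⟨h0, K, L, hKL, hFKL⟩ := M.mem_interiorFaces.mp hF
  have hiff := M.subset_frontier_iff h0 hKL hFKL
  rw [Fintype.sum_eq_add K L hKL fun N hN =>
    if_neg fun hs => ((hiff N).mp hs).elim hN.1 hN.2,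
    if_pos ((hiff K).mpr (Or.inl rfl)), if_pos ((hiff L).mpr (Or.inr rfl))]
  subst hFKL
  have hm : MeasurableSet (M.carrier K ∩ M.carrier L) :=
    ((M.isCompact_carrier K).inter (M.isCompact_carrier L)).measurableSet
  rw [setIntegral_congr_fun (g := fun x => -f K (M.carrier K ∩ M.carrier L) x) hm
    (h K L hKL hF), integral_neg]
  exact add_neg_cancel _

end Mesh

/-! ### The entropy balance -/

section Balance

variable {m : ℕ} {ι : Type} [Fintype ι] {Ω : Set (Space (m + 1))} {M : Mesh (m + 1) ι Ω}

lemma exists_polyState {k : ℕ} {v : ElemState (m + 1) ι} (hv : v ∈ spaceV M k) :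
    ∃ P : ι → Fin (m + 3) → MvPolynomial (Fin (m + 1)) ℝ,
      (∀ K i, (P K i).totalDegree ≤ k) ∧ ∀ K, ∀ x ∈ M.carrier K, v K x = polyState (P K) x := by
  choose P hP hvP using hv
  exact ⟨P, hP, fun K x hx => funext fun i => hvP K i x hx⟩

lemma IsPolyOn.continuousOn {d k : ℕ} {S : Set (Space d)} {f : Space d → ℝ}
    (h : IsPolyOn k S f) : ContinuousOn f S := by
  obtain ⟨P, -, hP⟩ := h
  exact (continuous_polyFun P).continuousOn.congr hP

lemma continuousOn_viscousFlux {d : ℕ} {g : PerfectGas} (vis : Viscosity g d) {S : Set (Space d)}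
    {v : Space d → State d} {q : Space d → Grad d} (hv : ContinuousOn v S)
    (hvp : ∀ x ∈ S, v x ∈ physV g) (hq : ∀ i j, ContinuousOn (fun x => q x i j) S)
    (i : Fin (d + 2)) (j : Fin d) :
    ContinuousOn (fun x => viscousFlux vis (v x) (q x) i j) S := by
  simp only [viscousFlux, Matrix.of_apply]
  exact (continuousOn_finsetSum _ fun k _ => continuousOn_finsetSum _ fun l _ =>
    continuousOn_finsetSum _ fun s _ =>
      (((continuousOn_viscMat vis j k i l).comp hv hvp).mul
        ((continuousOn_A0 g l s).comp hv hvp)).mul (hq s k)).neg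

lemma integral_frob_add_grad (K : ι) {v : Space (m + 1) → State (m + 1)}
    {P : Fin (m + 3) → MvPolynomial (Fin (m + 1)) ℝ}
    (hv : ∀ x ∈ M.carrier K, v x = polyState P x) {A B : Space (m + 1) → Grad (m + 1)}
    (hA : ∀ i j, ContinuousOn (fun x => A x i j) (M.carrier K))
    (hB : ∀ i j, ContinuousOn (fun x => B x i j) (M.carrier K)) :
    ∫ x in M.carrier K, frob (A x + B x) (grad v x)
      = (∫ x in M.carrier K, frob (A x) (grad v x))
        + ∫ x in M.carrier K, frob (B x) (grad v x) := by
  have hK := M.isCompact_carrier K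
  have hcongr : ∀ A : Space (m + 1) → Grad (m + 1), ∫ x in M.carrier K, frob (A x) (grad v x)
      = ∫ x in M.carrier K, ∑ j, ∑ i, A x i j * polyFun (MvPolynomial.pderiv j (P i)) x := by
    intro A
    refine setIntegral_congr_interior hK (M.convex_carrier K) fun x hx => ?_
    rw [frob_eq, grad_eq_of_mem_interior hv hx]
    rfl
  have hint : ∀ A : Space (m + 1) → Grad (m + 1),
      (∀ i j, ContinuousOn (fun x => A x i j) (M.carrier K)) → IntegrableOn
        (fun x => ∑ j, ∑ i, A x i j * polyFun (MvPolynomial.pderiv j (P i)) x) (M.carrier K) :=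
    fun A hA => (continuousOn_finsetSum _ fun j _ => continuousOn_finsetSum _ fun i _ =>
      (hA i j).mul (continuous_polyFun _).continuousOn).integrableOn_compact hK
  rw [hcongr A, hcongr B, ← integral_add (hint A hA) (hint B hB)]
  refine (hcongr fun x => A x + B x).trans ?_
  refine integral_congr_ae (Filter.Eventually.of_forall fun x => ?_)
  simp only [← Finset.sum_add_distrib, Matrix.add_apply, add_mul]

lemma continuousOn_mulVec {X n l : Type*} [TopologicalSpace X] [Fintype l] {S : Set X}
    {A : X → Matrix n l ℝ} {b : X → l → ℝ} (hA : ∀ i j, ContinuousOn (fun x => A x i j) S)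
    (hb : ∀ j, ContinuousOn (fun x => b x j) S) : ContinuousOn (fun x => (A x).mulVec (b x)) S :=
  continuousOn_pi.mpr fun i => continuousOn_finsetSum _ fun j _ => (hA i j).mul (hb j)

lemma faceContinuous_fluxHat (g : PerfectGas) (hΩ : interior (closure Ω) = Ω)
    {v : ElemState (m + 1) ι} {w : Trace (m + 1)} (hv : ∀ K, ContinuousOn (v K) (M.carrier K))
    (hw : ∀ F ∈ M.faces, ContinuousOn (w F) F) (hphys : IsPhysical g M v w) :
    M.FaceContinuous (fluxHat g M (sigmaMV g) v w) := by
  intro K F hF hFK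
  have hsub : F ⊆ M.carrier K := hFK.trans (M.frontier_subset_carrier K)
  have hvF := (hv K).mono hsub
  have hvp : ∀ x ∈ F, v K x ∈ physV g := fun x hx => hphys.1 K x (hsub hx)
  have hwp := hphys.2 F hF
  have h1 : ContinuousOn (fun x => (inviscidFlux g (consVars g (w F x))
      + inviscidFlux g (consVars g (v K x))).mulVec fun j => M.normal K F j) F :=
    continuousOn_mulVec (fun i j => ((continuousOn_inviscidFlux g i j).comp (hw F hF) hwp).add
      ((continuousOn_inviscidFlux g i j).comp hvF hvp)) fun _ => continuousOn_const
  have h2 : ContinuousOn (fun x => (sigmaMV g (w F x) (v K x) (M.normal K F)).mulVec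
      (v K x - w F x)) F :=
    continuousOn_mulVec (continuousOn_sigmaMV g hvF (hw F hF) hvp hwp
      (M.normal_spec hΩ hF hFK).1) (continuousOn_pi.mp (hvF.sub (hw F hF)))
  exact (h1.fun_const_smul _).add (h2.fun_const_smul _)

lemma faceContinuous_projViscousFlux {g : PerfectGas} (vis : Viscosity g (m + 1)) (k : ℕ)
    (q : ElemGrad (m + 1) ι) (v : ElemState (m + 1) ι) (w : Trace (m + 1)) :
    M.FaceContinuous (projViscousFlux vis M k q v w) := fun _ _ _ _ =>
  continuousOn_mulVec (fun _ _ => (continuous_polyFun _).continuousOn) fun _ => continuousOn_const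

lemma normalPotential_neg {d : ℕ} (g : PerfectGas) (v : State d) (n : Space d) :
    normalPotential g v (-n) = -normalPotential g v n := by
  simp [normalPotential]

/-! ### The scheme tested with its own solution. -/

/-- The time derivative of the total entropy. -/
lemma hasDerivAt_totalEntropy (g : PerfectGas) {k : ℕ} {t : ℝ} {v : ℝ → ElemState (m + 1) ι}
    (hv : ∀ᶠ τ in nhds t, v τ ∈ spaceV M k)
    (hd : ∀ K, ∀ x ∈ M.carrier K, DifferentiableAt ℝ (fun τ => v τ K x) t)
    (hphys : ∀ K, ∀ x ∈ M.carrier K, v t K x ∈ physV g) :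
    HasDerivAt (fun τ => totalEntropy g M (v τ))
      (M.volInt fun K x => deriv (fun τ => consVars g (v τ K x)) t ⬝ᵥ v t K x) t :=
  HasDerivAt.fun_sum fun K _ => hasDerivAt_integral_genEntropy g (M.isCompact_carrier K)
    (M.interior_carrier_nonempty K) k (v := fun τ => v τ K) (hv.mono fun _ h i => h K i) (hd K)
    (hphys K)

/-- The volume terms of the evolution equation, tested with `v_h`. -/
lemma volInt_frob_flux (g : PerfectGas) (vis : Viscosity g (m + 1))
    (hΩ : interior (closure Ω) = Ω) {k : ℕ} {v : ElemState (m + 1) ι} {q : ElemGrad (m + 1) ι}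
    (hv : v ∈ spaceV M k) (hq : q ∈ spaceQ M k) (hp : ∀ K, ∀ x ∈ M.carrier K, v K x ∈ physV g) :
    M.volInt (fun K x => frob (inviscidFlux g (consVars g (v K x))
        + viscousFlux vis (v K x) (q K x)) (grad (v K) x))
      = M.faceInt M.faces (fun K F x => normalPotential g (v K x) (M.normal K F))
        + M.volInt (fun K x => frob (viscousFlux vis (v K x) (q K x)) (grad (v K) x)) := by
  obtain ⟨P, -, hvP⟩ := exists_polyState hv
  have hvc : ∀ K, ContinuousOn (v K) (M.carrier K) := fun K =>
    (continuous_polyState (P K)).continuousOn.congr (hvP K)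
  simp only [Mesh.volInt, Mesh.faceInt]
  rw [← Finset.sum_add_distrib]
  refine Finset.sum_congr rfl fun K _ => ?_
  rw [integral_frob_add_grad K (hvP K) (A := fun x => inviscidFlux g (consVars g (v K x)))
    (fun i j => (continuousOn_inviscidFlux g i j).comp (hvc K) (hp K))
    (continuousOn_viscousFlux vis (hvc K) (hp K) fun i j => (hq K i j).continuousOn),
    M.integral_frob_inviscidFlux g hΩ K (hvP K) (hp K)]
  rfl

/-- The gradient equation, tested with the projected viscous flux. -/
lemma volInt_frob_viscousFlux (g : PerfectGas) (vis : Viscosity g (m + 1))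
    (hΩ : interior (closure Ω) = Ω) {k : ℕ} {v : ElemState (m + 1) ι} {q : ElemGrad (m + 1) ι}
    {w : Trace (m + 1)}
    (hv : v ∈ spaceV M k) (hq : q ∈ spaceQ M k) (hp : ∀ K, ∀ x ∈ M.carrier K, v K x ∈ physV g)
    (heq : ∀ r ∈ spaceQ M k, M.volInt (fun K x => frob (q K x) (r K x))
      + M.volInt (fun K x => v K x ⬝ᵥ divg (r K) x)
      - M.faceInt M.faces (fun K F x =>
          w F x ⬝ᵥ (r K x).mulVec (fun j => M.normal K F j)) = 0) :
    M.volInt (fun K x => viscForm vis (v K x) (q K x))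
      + M.volInt (fun K x => frob (viscousFlux vis (v K x) (q K x)) (grad (v K) x))
      = M.faceInt M.faces (fun K F x => v K x ⬝ᵥ projViscousFlux vis M k q v w K F x)
        - M.faceInt M.faces (fun K F x => w F x ⬝ᵥ projViscousFlux vis M k q v w K F x) := by
  obtain ⟨P, hP, hvP⟩ := exists_polyState hv
  have hvc : ∀ K, ContinuousOn (v K) (M.carrier K) := fun K =>
    (continuous_polyState (P K)).continuousOn.congr (hvP K)
  let G : ElemGrad (m + 1) ι := fun K x => viscousFlux vis (v K x) (q K x)
  have hG : ∀ K i j, ContinuousOn (fun x => G K x i j) (M.carrier K) := fun K =>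
    continuousOn_viscousFlux vis (hvc K) (hp K) fun i j => (hq K i j).continuousOn
  have h0 := heq _ (M.projQ_mem_spaceQ k G)
  -- The projection is removed against q_h ∈ 𝒬_h^k, and q : G is minus the dissipation.
  have h1 : M.volInt (fun K x => frob (q K x) (projQ M k G K x))
      = -M.volInt (fun K x => viscForm vis (v K x) (q K x)) := by
    have hcomm : ∀ A B : Grad (m + 1), frob A B = frob B A := fun A B => by
      simp only [frob_eq, mul_comm]
    choose Q hQ hqQ using hq
    simp only [Mesh.volInt]
    rw [← Finset.sum_neg_distrib]
    refine Finset.sum_congr rfl fun K _ => ?_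
    simp only [hcomm (q K _)]
    rw [M.integral_frob_projQ k K (hG K) (hQ K) fun x hx i j => hqQ K i j x (interior_subset hx),
      ← integral_neg]
    refine integral_congr_ae (Filter.Eventually.of_forall fun x => ?_)
    exact (hcomm _ _).trans (frob_viscousFlux vis (v K x) (q K x))
  -- Integration by parts moves the derivative onto v_h. The entries of ∇v_h have degree at most k,
  -- so the projection disappears in the volume but stays in the face term, where it is ĝ_h.
  have h2 : M.volInt (fun K x => v K x ⬝ᵥ divg (projQ M k G K) x)
      = -M.volInt (fun K x => frob (G K x) (grad (v K) x))
        + M.faceInt M.faces (fun K F x => v K x ⬝ᵥ projViscousFlux vis M k q v w K F x) := by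
    simp only [Mesh.volInt, Mesh.faceInt]
    rw [← Finset.sum_neg_distrib, ← Finset.sum_add_distrib]
    refine Finset.sum_congr rfl fun K _ => ?_
    rw [M.integral_dotProduct_divg hΩ K (hvP K) (r := projQ M k G K)
      (R := fun i j => projScalar M k K fun y => G K y i j) (fun _ _ _ => rfl),
      M.integral_frob_projQ k K (hG K)
        (Q := fun i j => MvPolynomial.pderiv j (P K i))
        (fun i j => (totalDegree_pderiv_le _ _).trans (hP K i))
        fun x hx i j => by rw [grad_eq_of_mem_interior (hvP K) hx]; rfl]
    rfl
  rw [h1, h2] at h0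
  change _ = 0 at h0
  have h3 : M.faceInt M.faces (fun K F x =>
      w F x ⬝ᵥ (projQ M k G K x).mulVec (fun j => M.normal K F j))
      = M.faceInt M.faces (fun K F x => w F x ⬝ᵥ projViscousFlux vis M k q v w K F x) := rfl
  rw [h3] at h0
  simp only [G] at h0
  linarith

/-- The balance is the evolution equation tested with v_h plus the identity from the gradient
equation minus the trace equation tested with v̂_h. The integrability statements serve to split the
face integrals. -/
theorem entropy_balance (g : PerfectGas) (vis : Viscosity g (m + 1))
    (hΩ : interior (closure Ω) = Ω) (k : ℕ) (T : Submodule ℝ (Trace (m + 1)))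
    (hT : T ≤ discTraces M k) (bHat : BoundaryTerm (m + 1) ι)
    (vBdry : ℝ → Space (m + 1) → State (m + 1)) (u₀ : Space (m + 1) → State (m + 1)) (tf : ℝ)
    (q : ℝ → ElemGrad (m + 1) ι) (v : ℝ → ElemState (m + 1) ι) (vhat : ℝ → Trace (m + 1))
    (hsol : IsSolution vis M k T (sigmaMV g) (projViscousFlux vis M k) bHat vBdry u₀ tf q v vhat)
    (t : ℝ) (ht : t ∈ Set.Ioo 0 tf) (hphys : IsPhysical g M (v t) (vhat t))
    (hb : ∀ F ∈ M.boundaryFaces, IntegrableOn (bHat (vhat t) (v t) (q t) (vBdry t) F) F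
      (μHE[m] : Measure (Space (m + 1)))) :
    ∃ D : ℝ, HasDerivAt (fun τ => totalEntropy g M (v τ)) D t ∧
      D + M.volInt (fun K x => viscForm vis (v t K x) (q t K x))
        + meanValueFaceTerm g M (v t) (vhat t)
        + boundaryBalance g M (vhat t) (fluxHat g M (sigmaMV g) (v t) (vhat t))
            (projViscousFlux vis M k (q t) (v t) (vhat t))
            (bHat (vhat t) (v t) (q t) (vBdry t)) = 0 := by
  have hV : v t ∈ spaceV M k := hsol.mem_V t ⟨ht.1.le, ht.2⟩
  have hev : ∀ᶠ τ in nhds t, v τ ∈ spaceV M k := by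
    filter_upwards [Ioo_mem_nhds ht.1 ht.2] with τ hτ using hsol.mem_V τ ⟨hτ.1.le, hτ.2⟩
  refine ⟨_, hasDerivAt_totalEntropy g hev (hsol.diff t ht) hphys.1, ?_⟩
  have hvol := hsol.evolution_eq t ht (v t) hV
  rw [volInt_frob_flux g vis hΩ hV (hsol.mem_Q t ht) hphys.1] at hvol
  have hgrad := volInt_frob_viscousFlux g vis hΩ (w := vhat t) hV (hsol.mem_Q t ht) hphys.1
    (hsol.gradient_eq t ht)
  have htrace := hsol.trace_eq t ht (vhat t) (hsol.mem_T t ht)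
  set b := bHat (vhat t) (v t) (q t) (vBdry t) with hbdef
  set V := v t
  set W := vhat t
  set fh := fluxHat g M (sigmaMV g) V W with hfh
  set gh := projViscousFlux vis M k (q t) V W with hgh
  have hVc : ∀ K, ContinuousOn (V K) (M.carrier K) := fun K =>
    continuousOn_pi.mpr fun i => (hV K i).continuousOn
  have hWc : ∀ F ∈ M.faces, ContinuousOn (W F) F := fun F hF =>
    continuousOn_pi.mpr fun i => ((hT (hsol.mem_T t ht)).1 F hF i).continuousOn
  have cV : M.FaceContinuous fun K _ x => V K x := fun K F _ hFK =>
    (hVc K).mono (hFK.trans (M.frontier_subset_carrier K))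
  have cW : M.FaceContinuous fun _ F x => W F x := fun _ F hF _ => hWc F hF
  have cf : M.FaceContinuous fh := faceContinuous_fluxHat g hΩ hVc hWc hphys
  have cg : M.FaceContinuous gh := faceContinuous_projViscousFlux vis k (q t) V W
  have ifV := (cf.dotProduct cV).faceIntegrable hΩ
  have ifW := (cf.dotProduct cW).faceIntegrable hΩ
  have igV := (cg.dotProduct cV).faceIntegrable hΩ
  have igW := (cg.dotProduct cW).faceIntegrable hΩ
  have iψV : M.FaceIntegrable M.faces fun K F x => normalPotential g (V K x) (M.normal K F) :=
    Mesh.FaceContinuous.faceIntegrable (fun K F hF hFK => (continuousOn_normalPotential g _).comp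
      (cV K F hF hFK) fun x hx => hphys.1 K x (M.frontier_subset_carrier K (hFK hx))) hΩ
  have iψW : M.FaceIntegrable M.faces fun K F x => normalPotential g (W F x) (M.normal K F) :=
    Mesh.FaceContinuous.faceIntegrable (fun K F hF hFK => (continuousOn_normalPotential g _).comp
      (cW K F hF hFK) (hphys.2 F hF)) hΩ
  have cFW : M.FaceContinuous fun K F x =>
      (inviscidFlux g (consVars g (W F x))).mulVec fun j => M.normal K F j := by
    intro K F hF _
    have hFc : ∀ i j, ContinuousOn (fun x => inviscidFlux g (consVars g (W F x)) i j) F :=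
      fun i j => (continuousOn_inviscidFlux g i j).comp (hWc F hF) (hphys.2 F hF)
    exact continuousOn_mulVec hFc fun _ => continuousOn_const
  have iFW := (cW.dotProduct cFW).faceIntegrable hΩ
  have hI : M.interiorFaces ⊆ M.faces := fun F hF => M.mem_faces.mpr (Or.inl hF)
  have hB : M.boundaryFaces ⊆ M.faces := fun F hF => M.mem_faces.mpr (Or.inr hF)
  -- On each boundary face b̂_h is merely integrable, while v̂_h is continuous on a compact set;
  -- their product is integrable.
  have ibW : M.FaceIntegrable M.boundaryFaces fun _ F x => b F x ⬝ᵥ W F x := by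
    intro K F hF _
    refine integrable_finsetSum _ fun i _ => ?_
    exact IntegrableOn.mul_continuousOn ((hb F hF).eval i)
      (continuousOn_pi.mp (hWc F (hB hF)) i) (M.isCompact_face (hB hF))
  have s1 : M.faceInt M.faces (fun K F x => (fh K F x + gh K F x) ⬝ᵥ V K x)
      = M.faceInt M.faces (fun K F x => fh K F x ⬝ᵥ V K x)
        + M.faceInt M.faces (fun K F x => gh K F x ⬝ᵥ V K x) := by
    simp only [add_dotProduct]
    exact Mesh.faceInt_add ifV igV
  have s2 : M.faceInt M.interiorFaces (fun K F x => (fh K F x + gh K F x) ⬝ᵥ W F x)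
      = M.faceInt M.interiorFaces (fun K F x => fh K F x ⬝ᵥ W F x)
        + M.faceInt M.interiorFaces (fun K F x => gh K F x ⬝ᵥ W F x) := by
    simp only [add_dotProduct]
    exact Mesh.faceInt_add (ifW.mono hI) (igW.mono hI)
  have s3 : M.faceInt M.boundaryFaces (fun K F x => W F x ⬝ᵥ (fh K F x + gh K F x - b F x))
      = M.faceInt M.boundaryFaces (fun K F x => fh K F x ⬝ᵥ W F x)
        + M.faceInt M.boundaryFaces (fun K F x => gh K F x ⬝ᵥ W F x)
        - M.faceInt M.boundaryFaces (fun _ F x => b F x ⬝ᵥ W F x) := by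
    have : M.FaceIntegrable M.boundaryFaces
        (fun K F x => fh K F x ⬝ᵥ W F x + gh K F x ⬝ᵥ W F x) :=
      fun K F hF hFK => (ifW K F (hB hF) hFK).add (igW K F (hB hF) hFK)
    rw [← Mesh.faceInt_add (ifW.mono hB) (igW.mono hB), ← Mesh.faceInt_sub this ibW]
    simp only [dotProduct_comm (W _ _), add_dotProduct, sub_dotProduct]
  have s4 : meanValueFaceTerm g M V W
      = M.faceInt M.faces (fun K F x => fh K F x ⬝ᵥ V K x)
        - M.faceInt M.faces (fun K F x => fh K F x ⬝ᵥ W F x)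
        - (M.faceInt M.faces (fun K F x => normalPotential g (V K x) (M.normal K F))
          - M.faceInt M.faces (fun K F x => normalPotential g (W F x) (M.normal K F))) := by
    rw [← Mesh.faceInt_sub ifV ifW, ← Mesh.faceInt_sub iψV iψW, ← Mesh.faceInt_sub
      (ifV.sub ifW) (iψV.sub iψW)]
    refine Mesh.faceInt_congr subset_rfl fun K F hF hFK x hx => ?_
    rw [← dotProduct_sub]
    exact (meanValue_identity g (hphys.1 K x (M.frontier_subset_carrier K (hFK hx)))
      (hphys.2 F hF x hx) (M.normal_spec hΩ hF hFK).1).symm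
  -- The trace v̂_h has one value on an interior face while the normals are opposite, so the
  -- potential of v̂_h cancels there.
  have s5 : M.faceInt M.interiorFaces (fun K F x => normalPotential g (W F x) (M.normal K F))
      = 0 := by
    refine Mesh.faceInt_interiorFaces_eq_zero fun K L hKL hF x hx => ?_
    rw [M.normal_eq_neg hΩ hKL (M.mem_interiorFaces.mp hF).1, normalPotential_neg]
  have s6 : M.faceInt M.boundaryFaces (fun K F x =>
      entropyFlux g (consVars g (W F x)) ⬝ᵥ fun j => M.normal K F j)
      = M.faceInt M.boundaryFaces (fun K F x => W F x ⬝ᵥ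
          (inviscidFlux g (consVars g (W F x))).mulVec (fun j => M.normal K F j))
        - M.faceInt M.boundaryFaces
          (fun K F x => normalPotential g (W F x) (M.normal K F)) := by
    rw [← Mesh.faceInt_sub (iFW.mono hB) (iψW.mono hB)]
    refine Mesh.faceInt_congr hB fun K F hF hFK x hx => ?_
    rw [normalPotential_eq g (hphys.2 F (hB hF) x hx)]
    ring
  have s7 := Mesh.faceInt_faces hΩ (M := M) (fun K F x => fh K F x ⬝ᵥ W F x)
  have s8 := Mesh.faceInt_faces hΩ (M := M) (fun K F x => gh K F x ⬝ᵥ W F x)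
  have s9 := Mesh.faceInt_faces hΩ (M := M)
    (fun K F x => normalPotential g (W F x) (M.normal K F))
  simp only [dotProduct_comm (V _ _) (gh _ _ _), dotProduct_comm (W _ _) (gh _ _ _)] at hgrad
  rw [boundaryBalance, s3, s4, s6]
  rw [s1] at hvol
  rw [s2] at htrace
  linarith

end Balance
end HDG

end

theorem mainTheorem8 {d : ℕ} (hd₁ : 1 ≤ d) (hd₃ : d ≤ 3)
    (g : HDG.PerfectGas) (vis : HDG.Viscosity g d)
    {ι : Type} [Fintype ι] {Ω : Set (HDG.Space d)} (hΩ : interior (closure Ω) = Ω)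
    (M : HDG.Mesh d ι Ω) (k : ℕ)
    (T : Submodule ℝ (HDG.Trace d))
    (hT₁ : HDG.contTraces M k ≤ T) (hT₂ : T ≤ HDG.discTraces M k)
    (bHat : HDG.BoundaryTerm d ι) (vBdry : ℝ → HDG.Space d → HDG.State d)
    (u₀ : HDG.Space d → HDG.State d) (tf : ℝ)
    (q : ℝ → HDG.ElemGrad d ι) (v : ℝ → HDG.ElemState d ι) (vhat : ℝ → HDG.Trace d)
    (hsol : HDG.IsSolution vis M k T (HDG.sigmaMV g) (HDG.projViscousFlux vis M k)
      bHat vBdry u₀ tf q v vhat)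
    (t : ℝ) (ht : t ∈ Set.Ioo 0 tf)
    (hphys : HDG.IsPhysical g M (v t) (vhat t))
    (hb : ∀ F ∈ M.boundaryFaces, MeasureTheory.IntegrableOn
      (bHat (vhat t) (v t) (q t) (vBdry t) F) F
      (MeasureTheory.Measure.euclideanHausdorffMeasure (d - 1))) :
    ∃ D : ℝ, HasDerivAt (fun τ => HDG.totalEntropy g M (v τ)) D t ∧
      D + M.volInt (fun K x => HDG.viscForm vis (v t K x) (q t K x))
        + HDG.meanValueFaceTerm g M (v t) (vhat t)
        + HDG.boundaryBalance g M (vhat t)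
            (HDG.fluxHat g M (HDG.sigmaMV g) (v t) (vhat t))
            (HDG.projViscousFlux vis M k (q t) (v t) (vhat t))
            (bHat (vhat t) (v t) (q t) (vBdry t)) = 0 := by
  -- With d = m + 1 the face dimension d - 1 reduces to m, and there is a coordinate to project
  -- along.
  obtain ⟨m, rfl⟩ := Nat.exists_eq_add_of_le' hd₁
  exact HDG.entropy_balance g vis hΩ k T hT₂ bHat vBdry u₀ tf q v vhat hsol t ht hphys hb
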